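/- Let $N\ge 1$ be an integer, $m>N/2$ a real number, $\varrho\in(0,1)$, and $q_\star=\frac{N+2}{N+1}$. For real-valued functions on $\mathbb R^N$ put $$|v|_m=\Bigl(\int_{\mathbb R^N}(1+|\xi|^{2m})\,|v(\xi)|^2\,d\xi\Bigr)^{1/2},\qquad \|v\|_m=\bigl(|v|_m^2+|\nabla v|_m^2\bigr)^{1/2},$$ where $\nabla v$ is the weak gradient, and let $H^1_m(\mathbb R^N)=\{v\in H^1(\mathbb R^N) : \|v\|_m<\infty\}$, with norm $\|\cdot\|_m$. Let $\mathcal L v=\Delta v+\frac12\,\xi\cdot\nabla v+\frac N2\,v$, and let $(e^{\tau\mathcal L})_{\tau\ge0}$ be the semigroup it generates, that is, $e^{0\mathcal L}w=w$ and, for $\tau>0$, $$(e^{\tau\mathcal L}w)(\xi)=\frac{1}{(4\pi a(\tau))^{N/2}}\int_{\mathbb R^N}\exp\Bigl(-\frac{|\xi-e^{-\tau/2}\eta|^2}{4a(\tau)}\Bigr)w(\eta)\,d\eta,\qquad a(\tau)=1-e^{-\tau}.$$ Let $\chi\in C^\infty([0,\infty))$ satisfy $0\le\chi\le1$, $\chi(r)=1$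 for $r\le1$ and $\chi(r)=0$ for $r\ge4$, put $\chi_\varrho(r)=\chi(r/\varrho^2)$, and let $$F_\varrho(v)=\chi_\varrho(\|v\|_m^2)\,|\nabla v|^{q_\star},\qquad v\in H^1_m(\mathbb R^N).$$ Consider the initial-value problem $\partial_\tau v=\mathcal L v-F_\varrho(v)$, $v(0)=v_0\in H^1_m(\mathbb R^N)$. A global (mild) solution is a function $v\in C([0,\infty);H^1_m(\mathbb R^N))$ such that, for all $\tau\ge0$, $$v(\tau)=e^{\tau\mathcal L}v_0-\int_0^\tau e^{(\tau-s)\mathcal L}F_\varrho(v(s))\,ds ,$$ the integral being a convergent Bochner integral in $H^1_m(\mathbb R^N)$. Then: 1. For every $v_0\in H^1_m(\mathbb R^N)$ the problem has exactly one global mild solution $v\in C([0,\infty);H^1_m(\mathbb R^N))$. 2. For $\tau\ge0$ let $\varphi_\tau:H^1_m(\mathbb R^N)\to H^1_m(\mathbb R^N)$ be defined by $\varphi_\tau(v_0)=v(\tau)$. The maps $\varphi_\tau$ are globally Lipschitz continuous, uniformly in $\tau$ on compact intervals: for every $T\ge 0$ there is $L(T)<\infty$ such that $\|\varphi_\tau(v_0)-\varphi_\tau(\hat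 v_0)\|_m\le L(T)\,\|v_0-\hat v_0\|_m$ for all $\tau\in[0,T]$ and all $v_0,\hat v_0\in H^1_m(\mathbb R^N)$. 3. For every $\tau\ge0$ the map $\varphi_\tau$ is of class $C^1$ (in the Fréchet sense), and $(\varphi_\tau)_{\tau\ge0}$ is a $C^1$ semiflow in $H^1_m(\mathbb R^N)$: $\varphi_0=\mathrm{id}$, $\varphi_{\sigma+\tau}=\varphi_\sigma\circ\varphi_\tau$ for all $\sigma,\tau\ge0$, the map $(\tau,v_0)\mapsto\varphi_\tau(v_0)$ is continuous on $[0,\infty)\times H^1_m(\mathbb R^N)$, and each $\varphi_\tau$ is $C^1$. -/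

import Mathlib

open MeasureTheory
open scoped NNReal ENNReal ContDiff RealInnerProductSpace

noncomputable section

namespace ViscousHJ

/-- The space `ℝ^N` with its Euclidean norm. -/
abbrev E (N : ℕ) : Type := EuclideanSpace ℝ (Fin N)

/-- The weight `1 + |ξ|^{2m}`. -/
def weight (N : ℕ) (m : ℝ) (ξ : E N) : ℝ := 1 + ‖ξ‖ ^ (2 * m)

/-- The measure `(1 + |ξ|^{2m}) dξ`. -/
def weightMeasure (N : ℕ) (m : ℝ) : Measure (E N) :=
  volume.withDensity fun ξ => ENNReal.ofReal (weight N m ξ)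

/-- The weighted space `L²_m(ℝ^N) = L²(ℝ^N; (1 + |ξ|^{2m}) dξ)` of functions with values in `F`;
its norm is `|v|_m = (∫ (1 + |ξ|^{2m}) |v(ξ)|² dξ)^{1/2}`. -/
abbrev L2m (N : ℕ) (m : ℝ) (F : Type) [NormedAddCommGroup F] : Type :=
  Lp F 2 (weightMeasure N m)

/-- `w` is the weak (distributional) gradient of `v` on `ℝ^N`. -/
def IsWeakGradient {N : ℕ} (v : E N → ℝ) (w : E N → E N) : Prop :=
  ∀ φ : E N → ℝ, ContDiff ℝ ∞ φ → HasCompactSupport φ → ∀ e : E N,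
    ∫ ξ, v ξ * fderiv ℝ φ ξ e = - ∫ ξ, ⟪w ξ, e⟫ * φ ξ

lemma weight_pos (N : ℕ) (m : ℝ) (ξ : E N) : 0 < weight N m ξ := by
  unfold weight; positivity

lemma one_le_weight (N : ℕ) (m : ℝ) (ξ : E N) : 1 ≤ weight N m ξ := by
  unfold weight
  have : 0 ≤ ‖ξ‖ ^ (2 * m) := by positivity
  linarith

lemma measurable_weight (N : ℕ) (m : ℝ) : Measurable (weight N m) := by
  unfold weight; fun_prop

/-- Testing against a continuous compactly supported function is a continuous linear functional
on `L²_m`. -/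
lemma exists_inner_eq_integral {N : ℕ} {m : ℝ} {F : Type} [NormedAddCommGroup F]
    [InnerProductSpace ℝ F] (ψ : E N → F) (hψ : Continuous ψ) (hc : HasCompactSupport ψ) :
    ∃ g : L2m N m F, ∀ v : L2m N m F, ∫ ξ, ⟪v ξ, ψ ξ⟫ = ⟪v, g⟫ := by
  have hm := measurable_weight N m
  have hmem : MemLp (fun ξ => (weight N m ξ)⁻¹ • ψ ξ) 2 (weightMeasure N m) := by
    have hmeas : StronglyMeasurable (fun ξ => (weight N m ξ)⁻¹ • ψ ξ) :=
      hm.inv.stronglyMeasurable.smul hψ.stronglyMeasurable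
    rw [memLp_two_iff_integrable_sq_norm hmeas.aestronglyMeasurable, weightMeasure,
      integrable_withDensity_iff_integrable_smul' hm.ennreal_ofReal (by simp)]
    have hint : Integrable (fun ξ => ‖ψ ξ‖ ^ 2) (volume : Measure (E N)) :=
      (hψ.memLp_of_hasCompactSupport (p := 2) hc).integrable_norm_pow (by norm_num)
    refine hint.mono' ?_ (Filter.Eventually.of_forall fun ξ => ?_)
    · exact (hm.ennreal_ofReal.ennreal_toReal.stronglyMeasurable.smul
        (hmeas.norm.pow 2)).aestronglyMeasurable
    · have h0 := weight_pos N m ξ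
      have h1 := one_le_weight N m ξ
      have h2 : (weight N m ξ)⁻¹ ≤ 1 := inv_le_one_of_one_le₀ h1
      have h3 : ‖(weight N m ξ)⁻¹ • ψ ξ‖ = (weight N m ξ)⁻¹ * ‖ψ ξ‖ := by
        rw [norm_smul, norm_inv, Real.norm_of_nonneg h0.le]
      rw [ENNReal.toReal_ofReal h0.le, h3, mul_pow, smul_eq_mul,
        Real.norm_of_nonneg (by positivity)]
      calc weight N m ξ * ((weight N m ξ)⁻¹ ^ 2 * ‖ψ ξ‖ ^ 2)
          = (weight N m ξ)⁻¹ * ‖ψ ξ‖ ^ 2 := by field_simp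
        _ ≤ 1 * ‖ψ ξ‖ ^ 2 := by gcongr
        _ = ‖ψ ξ‖ ^ 2 := one_mul _
  refine ⟨hmem.toLp _, fun v => ?_⟩
  rw [L2.inner_def]
  have h1 : ∫ ξ, ⟪v ξ, (hmem.toLp _ : L2m N m F) ξ⟫ ∂(weightMeasure N m)
      = ∫ ξ, ⟪v ξ, (weight N m ξ)⁻¹ • ψ ξ⟫ ∂(weightMeasure N m) := by
    refine integral_congr_ae ?_
    filter_upwards [hmem.coeFn_toLp] with ξ hξ
    rw [hξ]
  rw [h1]
  unfold weightMeasure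
  rw [integral_withDensity_eq_integral_toReal_smul hm.ennreal_ofReal (by simp)]
  refine integral_congr_ae (Filter.Eventually.of_forall fun ξ => ?_)
  have := weight_pos N m ξ
  simp only [ENNReal.toReal_ofReal this.le, inner_smul_right, smul_eq_mul]
  field_simp

/-- For elements of `L²_m`, the weak gradient condition is a family of linear closed conditions. -/
lemma exists_isWeakGradient_iff (N : ℕ) (m : ℝ) :
    ∃ S : Set (L2m N m ℝ × L2m N m (E N)), ∀ (v : L2m N m ℝ) (w : L2m N m (E N)),
      IsWeakGradient v w ↔ ∀ p ∈ S, ⟪v, p.1⟫ + ⟪w, p.2⟫ = 0 := by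
  have key : ∀ (φ : E N → ℝ) (e : E N), ContDiff ℝ ∞ φ → HasCompactSupport φ →
      ∃ p : L2m N m ℝ × L2m N m (E N), ∀ (v : L2m N m ℝ) (w : L2m N m (E N)),
        ∫ ξ, v ξ * fderiv ℝ φ ξ e = ⟪v, p.1⟫ ∧ ∫ ξ, ⟪w ξ, e⟫ * φ ξ = ⟪w, p.2⟫ := by
    intro φ e hφ hc
    obtain ⟨g, hg⟩ := exists_inner_eq_integral (m := m) (fun ξ => fderiv ℝ φ ξ e)
      ((hφ.continuous_fderiv (by simp)).clm_apply continuous_const) (hc.fderiv_apply ℝ e)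
    obtain ⟨h, hh⟩ := exists_inner_eq_integral (m := m) (fun ξ => φ ξ • e)
      (hφ.continuous.smul continuous_const) hc.smul_right
    refine ⟨(g, h), fun v w => ⟨?_, ?_⟩⟩
    · rw [← hg v]
      refine integral_congr_ae (Filter.Eventually.of_forall fun ξ => ?_)
      simp [mul_comm]
    · rw [← hh w]
      refine integral_congr_ae (Filter.Eventually.of_forall fun ξ => ?_)
      simp [inner_smul_right, mul_comm]
  choose! p hp using key
  refine ⟨{q | ∃ φ e, ContDiff ℝ ∞ φ ∧ HasCompactSupport φ ∧ q = p φ e}, fun v w => ⟨?_, ?_⟩⟩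
  · rintro h q ⟨φ, e, hφ, hc, rfl⟩
    obtain ⟨h1, h2⟩ := hp φ e hφ hc v w
    have h3 := h φ hφ hc e
    rw [h1, h2] at h3
    linarith
  · intro h φ hφ hc e
    obtain ⟨h1, h2⟩ := hp φ e hφ hc v w
    have h3 := h _ ⟨φ, e, hφ, hc, rfl⟩
    rw [h1, h2]
    linarith

/-- The weighted Sobolev space `H¹_m(ℝ^N)`. A function `v` with weak gradient `∇v` is recorded as
the pair `(v, ∇v)` (the weak gradient is determined by `v`), and the norm inherited from the
`ℓ²`-product is `‖v‖_m = (|v|_m² + |∇v|_m²)^{1/2}`. -/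
def H1m (N : ℕ) (m : ℝ) : Submodule ℝ (WithLp 2 (L2m N m ℝ × L2m N m (E N))) where
  carrier := {u | IsWeakGradient u.fst u.snd}
  zero_mem' := by
    obtain ⟨S, hS⟩ := exists_isWeakGradient_iff N m
    refine (hS _ _).2 fun p _ => ?_
    simp
  add_mem' := by
    obtain ⟨S, hS⟩ := exists_isWeakGradient_iff N m
    intro a b ha hb
    refine (hS _ _).2 fun p hp => ?_
    have h1 := (hS _ _).1 ha p hp
    have h2 := (hS _ _).1 hb p hp
    simp only [WithLp.add_fst, WithLp.add_snd, inner_add_left]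
    linarith
  smul_mem' := by
    obtain ⟨S, hS⟩ := exists_isWeakGradient_iff N m
    intro c a ha
    refine (hS _ _).2 fun p hp => ?_
    have h1 := (hS _ _).1 ha p hp
    simp only [WithLp.smul_fst, WithLp.smul_snd, real_inner_smul_left]
    linear_combination c * h1

/-- `H¹_m` is complete, so that integrals of `H¹_m`-valued functions are meaningful. -/
instance instCompleteSpaceH1m (N : ℕ) (m : ℝ) : CompleteSpace (H1m N m) := by
  obtain ⟨S, hS⟩ := exists_isWeakGradient_iff N m
  have h : IsClosed (H1m N m : Set (WithLp 2 (L2m N m ℝ × L2m N m (E N)))) := by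
    have : (H1m N m : Set (WithLp 2 (L2m N m ℝ × L2m N m (E N))))
        = ⋂ p ∈ S, {u | ⟪u.fst, p.1⟫ + ⟪u.snd, p.2⟫ = 0} := by
      ext u
      simp only [Set.mem_iInter, Set.mem_ofPred_eq]
      exact hS _ _
    rw [this]
    refine isClosed_biInter fun p _ => isClosed_eq ?_ continuous_const
    have h1 : Continuous fun u : WithLp 2 (L2m N m ℝ × L2m N m (E N)) => u.fst :=
      (WithLp.fstL 2 ℝ _ _).continuous
    have h2 : Continuous fun u : WithLp 2 (L2m N m ℝ × L2m N m (E N)) => u.snd :=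
      (WithLp.sndL 2 ℝ _ _).continuous
    exact (h1.inner continuous_const).add (h2.inner continuous_const)
  exact h.completeSpace_coe

/-- The function underlying an element of `H¹_m`. -/
def H1m.fn {N : ℕ} {m : ℝ} (v : H1m N m) : E N → ℝ :=
  (v : WithLp 2 (L2m N m ℝ × L2m N m (E N))).fst

/-- The weak gradient of an element of `H¹_m`. -/
def H1m.grad {N : ℕ} {m : ℝ} (v : H1m N m) : E N → E N :=
  (v : WithLp 2 (L2m N m ℝ × L2m N m (E N))).snd

/-- The operator `𝓛f(ξ) = Δf(ξ) + ½ ξ·∇f(ξ) + (N/2) f(ξ)`. -/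
def opL {N : ℕ} (f : E N → ℝ) (ξ : E N) : ℝ :=
  Laplacian.laplacian f ξ + 1 / 2 * fderiv ℝ f ξ ξ + N / 2 * f ξ

/-- The kernel of `e^{τ𝓛}`, `τ > 0`:
`K_τ(ξ, η) = (4π a(τ))^{-N/2} exp(-|ξ - e^{-τ/2} η|² / (4 a(τ)))` with `a(τ) = 1 - e^{-τ}`. -/
def kernelL {N : ℕ} (τ : ℝ) (ξ η : E N) : ℝ :=
  (4 * Real.pi * (1 - Real.exp (-τ))) ^ (-(N : ℝ) / 2) *
    Real.exp (-‖ξ - Real.exp (-τ / 2) • η‖ ^ 2 / (4 * (1 - Real.exp (-τ))))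

lemma hasFDerivAt_gaussian {N : ℕ} (C b : ℝ) (p ξ : E N) :
    HasFDerivAt (fun ξ : E N => C * Real.exp (-‖ξ - p‖ ^ 2 / b))
      ((C * Real.exp (-‖ξ - p‖ ^ 2 / b) * (-2 / b)) • innerSL ℝ (ξ - p)) ξ := by
  have h1 : HasFDerivAt (fun ξ : E N => ‖ξ - p‖ ^ 2) ((2:ℝ) • innerSL ℝ (ξ - p)) ξ := by
    refine ((hasFDerivAt_id ξ).sub_const p).norm_sq.congr_fderiv ?_
    ext x
    simp
  refine ((h1.fun_neg.mul_const b⁻¹).exp.const_mul C).congr_fderiv ?_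
  ext x
  simp [div_eq_mul_inv]
  ring

lemma laplacian_gaussian {N : ℕ} (C b : ℝ) (p ξ : E N) :
    Laplacian.laplacian (fun ξ : E N => C * Real.exp (-‖ξ - p‖ ^ 2 / b)) ξ
      = C * Real.exp (-‖ξ - p‖ ^ 2 / b) * (4 / b ^ 2 * ‖ξ - p‖ ^ 2 - 2 / b * N) := by
  set f := fun ξ : E N => C * Real.exp (-‖ξ - p‖ ^ 2 / b) with hf
  have h1 : fderiv ℝ f = fun ξ => (f ξ * (-2 / b)) • innerSL ℝ (ξ - p) :=
    funext fun ξ => (hasFDerivAt_gaussian C b p ξ).fderiv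
  let B : E N →L[ℝ] E N →L[ℝ] ℝ := innerSL ℝ
  have h2 : HasFDerivAt (fderiv ℝ f) ((f ξ * (-2 / b)) • B +
      ((-2 / b) • ((f ξ * (-2 / b)) • B (ξ - p))).smulRight (B (ξ - p))) ξ := by
    rw [h1]
    have ha := (hasFDerivAt_gaussian C b p ξ).mul_const (-2 / b)
    have hb : HasFDerivAt (fun ξ : E N => B (ξ - p)) B ξ := by
      have h := (B.hasFDerivAt (x := ξ)).sub_const (B p)
      simpa only [map_sub] using h
    exact ha.smul hb
  have h3 : ∀ i : Fin N, iteratedFDeriv ℝ 2 f ξ ![EuclideanSpace.basisFun (Fin N) ℝ i,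
      EuclideanSpace.basisFun (Fin N) ℝ i] = f ξ * (4 / b ^ 2 * (ξ - p) i ^ 2 - 2 / b) := by
    intro i
    rw [iteratedFDeriv_two_apply, h2.fderiv]
    have hB : ∀ x y : E N, B x y = ⟪x, y⟫ := fun x y => innerSL_apply_apply ℝ x y
    simp only [add_apply, smul_apply, ContinuousLinearMap.smulRight_apply, smul_eq_mul, hB,
      EuclideanSpace.basisFun_apply, Matrix.cons_val_zero, Matrix.cons_val_one,
      EuclideanSpace.inner_single_right]
    simp
    ring
  rw [InnerProductSpace.laplacian_eq_iteratedFDeriv_orthonormalBasis f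
    (EuclideanSpace.basisFun (Fin N) ℝ)]
  simp only [h3]
  rw [← Finset.mul_sum, Finset.sum_sub_distrib, ← Finset.mul_sum, EuclideanSpace.real_norm_sq_eq]
  simp only [hf, Finset.sum_const, Finset.card_univ, Fintype.card_fin, nsmul_eq_mul, mul_comm,
    EuclideanSpace.real_norm_sq_eq]

/-- The kernel solves the linear equation `∂_τ K = 𝓛 K` in the variable `ξ`; this ties the
explicit formula for `e^{τ𝓛}` to the operator `𝓛`. -/
theorem hasDerivAt_kernelL {N : ℕ} (τ : ℝ) (hτ : 0 < τ) (ξ η : E N) :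
    HasDerivAt (fun t => kernelL t ξ η) (opL (fun ζ => kernelL τ ζ η) ξ) τ := by
  have ha : 0 < 1 - Real.exp (-τ) := by
    have : Real.exp (-τ) < 1 := by simpa using hτ
    linarith
  have hL : opL (fun ζ => kernelL τ ζ η) ξ = kernelL τ ξ η *
     (‖ξ - Real.exp (-τ / 2) • η‖ ^ 2 / (4 * (1 - Real.exp (-τ)) ^ 2)
      - N / (2 * (1 - Real.exp (-τ)))
      - ⟪ξ - Real.exp (-τ / 2) • η, ξ⟫ / (4 * (1 - Real.exp (-τ))) + N / 2) := by
    unfold opL kernelL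
    rw [laplacian_gaussian, (hasFDerivAt_gaussian _ _ _ ξ).fderiv]
    simp only [smul_apply, innerSL_apply_apply, smul_eq_mul]
    generalize (4 * Real.pi * (1 - Real.exp (-τ))) ^ (-(N : ℝ) / 2) *
      Real.exp (-‖ξ - Real.exp (-τ / 2) • η‖ ^ 2 / (4 * (1 - Real.exp (-τ)))) = K
    generalize 1 - Real.exp (-τ) = a at ha
    field_simp
    ring
  rw [hL]
  have h0 : HasDerivAt (fun t : ℝ => 1 - Real.exp (-t)) (Real.exp (-τ)) τ := by
    simpa using ((hasDerivAt_id τ).neg.exp.const_sub 1)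
  have h1 : HasDerivAt (fun t : ℝ => Real.exp (-t / 2)) (Real.exp (-τ/2) * (-1/2)) τ := by
    simpa using (((hasDerivAt_id τ).neg.div_const 2).exp)
  have h2 := ((h1.smul_const η).const_sub ξ).norm_sq
  have h3 := (h0.const_mul (4 * Real.pi)).rpow_const (p := -(N:ℝ)/2) (Or.inl (by positivity))
  have h4 := (h2.neg.div (h0.const_mul 4) (by positivity)).exp
  have h5 := h3.mul h4
  refine h5.congr_deriv ?_
  have he : Real.exp (-τ / 2) • η = ξ - (ξ - Real.exp (-τ / 2) • η) := by abel
  have h6 : ⟪ξ - Real.exp (-τ / 2) • η, -((Real.exp (-τ / 2) * (-1 / 2)) • η)⟫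
      = (⟪ξ - Real.exp (-τ / 2) • η, ξ⟫ - ‖ξ - Real.exp (-τ / 2) • η‖ ^ 2) / 2 := by
    rw [← real_inner_self_eq_norm_sq, ← inner_sub_right, ← he, inner_neg_right,
      real_inner_smul_right, real_inner_smul_right]
    ring
  have h7 : (4 * Real.pi * (1 - Real.exp (-τ))) ^ (-(N : ℝ) / 2 - 1)
      = (4 * Real.pi * (1 - Real.exp (-τ))) ^ (-(N : ℝ) / 2)
        / (4 * Real.pi * (1 - Real.exp (-τ))) := by
    rw [Real.rpow_sub_one (by positivity)]
  simp only [Pi.neg_apply, h6, h7, kernelL, Pi.div_apply]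
  generalize (4 * Real.pi * (1 - Real.exp (-τ))) ^ (-(N : ℝ) / 2) = P
  generalize Real.exp (-‖ξ - Real.exp (-τ / 2) • η‖ ^ 2 / (4 * (1 - Real.exp (-τ)))) = Q
  have h8 : Real.exp (-τ) = 1 - (1 - Real.exp (-τ)) := by ring
  generalize 1 - Real.exp (-τ) = a at ha h8
  rw [h8]
  generalize ‖ξ - Real.exp (-τ / 2) • η‖ = R
  have := Real.pi_pos
  field_simp
  ring

/-- The semigroup `e^{τ𝓛}`, `τ ≥ 0`, generated by `𝓛`, acting on (integrable) functions. -/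
def expL {N : ℕ} (τ : ℝ) (f : E N → ℝ) (ξ : E N) : ℝ :=
  if τ = 0 then f ξ else ∫ η, kernelL τ ξ η * f η

/-- The critical exponent `q⋆ = (N + 2) / (N + 1)`. -/
def qStar (N : ℕ) : ℝ := (N + 2) / (N + 1)

/-- A smooth cut-off on `[0, ∞)`, equal to `1` on `[0, 1]` and to `0` on `[4, ∞)`. -/
structure IsCutoff (χ : ℝ → ℝ) : Prop where
  smooth : ContDiffOn ℝ ∞ χ (Set.Ici 0)
  nonneg : ∀ r, 0 ≤ r → 0 ≤ χ r
  le_one : ∀ r, 0 ≤ r → χ r ≤ 1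
  eq_one : ∀ r, 0 ≤ r → r ≤ 1 → χ r = 1
  eq_zero : ∀ r, 4 ≤ r → χ r = 0

/-- The truncated nonlinearity `F_ρ(v) = χ(‖v‖_m² / ρ²) |∇v|^{q⋆}`. -/
def truncF {N : ℕ} {m : ℝ} (χ : ℝ → ℝ) (ρ : ℝ) (v : H1m N m) (ξ : E N) : ℝ :=
  χ (‖v‖ ^ 2 / ρ ^ 2) * ‖H1m.grad v ξ‖ ^ qStar N

/-- `v ∈ C([0, ∞); H¹_m)` is a mild solution of `∂_τ v = 𝓛v - F_ρ(v)`, `v(0) = v₀`: for all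
`τ ≥ 0`, `v(τ) = e^{τ𝓛} v₀ - ∫₀^τ e^{(τ-s)𝓛} F_ρ(v(s)) ds`, where `w = e^{τ𝓛} v₀` and
`g(s) = e^{(τ-s)𝓛} F_ρ(v(s))`, `0 ≤ s < τ`, are elements of `H¹_m` and the integral is a
(convergent) Bochner integral in `H¹_m`. -/
def IsMildSolution {N : ℕ} {m : ℝ} (χ : ℝ → ℝ) (ρ : ℝ) (v₀ : H1m N m)
    (v : C(ℝ≥0, H1m N m)) : Prop :=
  ∀ τ : ℝ≥0, ∃ (w : H1m N m) (g : ℝ → H1m N m),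
    H1m.fn w =ᵐ[volume] expL τ (H1m.fn v₀) ∧
    (∀ s : ℝ≥0, s < τ → H1m.fn (g s) =ᵐ[volume] expL ((τ : ℝ) - s) (truncF χ ρ (v s))) ∧
    IntervalIntegrable g volume 0 τ ∧
    v τ = w - ∫ s in (0 : ℝ)..τ, g s

/-- A continuous semiflow `(φ_τ)_{τ ≥ 0}` on `X` all of whose time-`τ` maps are of class `C¹`. -/
structure IsC1Semiflow {X : Type} [NormedAddCommGroup X] [NormedSpace ℝ X]
    (φ : ℝ≥0 → X → X) : Prop where
  zero : ∀ x, φ 0 x = x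
  add : ∀ σ τ x, φ (σ + τ) x = φ σ (φ τ x)
  continuous : Continuous fun p : ℝ≥0 × X => φ p.1 p.2
  contDiff : ∀ τ, ContDiff ℝ 1 (φ τ)

end ViscousHJ

end

/-! Put `X = H¹_m` and let `Y` be `L^{2/q}` for the measure `(1 + |ξ|^{2m}) dξ`, with `q = q⋆`. The
truncated nonlinearity is a `C¹`, globally Lipschitz map from `X` to `Y`, and `e^{τ𝓛}` maps `Y` to
`X` with norm `O(τ^{-γ})` as `τ → 0`, where `γ = 1/2 + N(q - 1)/4 < 1`. So the loss of regularity in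
the nonlinearity costs only an integrable singularity in Duhamel's formula.

Given this, the mild equation on `[0, t]` reads `u + V(F ∘ u) = T(·)x` in `C([0, t]; X)`, with `V` a
bounded Volterra operator. After the substitution `u(s) = e^{λs} w(s)` with `λ` large, the nonlinear
term is `1/2`-Lipschitz, and the left-hand side is the identity plus a `C¹` contraction, hence a
`C¹` diffeomorphism with Lipschitz inverse (`exists_homeomorph_id_add`). Existence, uniqueness,
Lipschitz and `C¹` dependence on `x` are all read off from this one inverse (`exists_solutionMap`).
Uniqueness glues the intervals together, and translation in time gives the semiflow law
(`exists_semiflow`).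

Three analytic facts feed this scheme.

The map `g ↦ |g|^q` from `L²` to `L^{2/q}` is `C¹` because its first-order remainder is pointwise at
most a multiple of `|h|^q` (`exists_hasFDerivAt_powOp`); the cut-off then makes it globally
Lipschitz (`contDiff_lipschitz_truncation`).

On `H¹_m`, `e^{τ𝓛}v` is a Gaussian average of the functions `β^N v(β(· - y))` with `β = e^{τ/2}` and
`y = √(1 - e^{-τ}) z`. These operators act on weak gradients by the chain rule and are strongly
continuous in their parameters, so boundedness and strong continuity follow from Bochner
integration; `fn_heat` identifies the average with the kernel formula, and Chapman–Kolmogorov gives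
the semigroup law.

The smoothing estimate combines a Gaussian bound for the kernel and its gradient, with the weight
absorbed (`exists_kernelL_le`), with Young's inequality (`eLpNorm_weightMeasure_le`).

The condition `m > N/2` places the weighted spaces inside `L¹`, which gives the kernel integrals a
meaning. -/

noncomputable section

namespace ViscousHJ

/-! ### Calculus on spaces of continuous functions -/

section Abstract

open Set Filter Topology

/-- If `G` is `C¹` and a contraction, then `id + G` is a `C¹`-diffeomorphism with Lipschitz
inverse. -/
lemma exists_homeomorph_id_add {Z : Type*} [NormedAddCommGroup Z] [NormedSpace ℝ Z]
    [CompleteSpace Z] {G : Z → Z} (hG : ContDiff ℝ 1 G) (hL : LipschitzWith (1 / 2) G) :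
    ∃ e : Z ≃ₜ Z, (∀ z, e z = z + G z) ∧ ContDiff ℝ 1 e.symm ∧ LipschitzWith 2 e.symm := by
  -- The quantitative inverse function theorem applies on the whole space: `id + G` differs from the
  -- identity by a map of Lipschitz constant `1/2 < 1 = ‖id⁻¹‖⁻¹`.
  have happ : ApproximatesLinearOn (fun z => z + G z)
      ((ContinuousLinearEquiv.refl ℝ Z : Z ≃L[ℝ] Z) : Z →L[ℝ] Z) univ (1 / 2) := by
    refine LipschitzOnWith.approximatesLinearOn ?_
    have : (fun z => z + G z) -
        (((ContinuousLinearEquiv.refl ℝ Z : Z ≃L[ℝ] Z) : Z →L[ℝ] Z) : Z → Z) = G := by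
      ext z; simp
    rw [this]
    exact hL.lipschitzOnWith
  have hc : Subsingleton Z ∨ (1 / 2 : ℝ≥0) <
      ‖(((ContinuousLinearEquiv.refl ℝ Z).symm : Z ≃L[ℝ] Z) : Z →L[ℝ] Z)‖₊⁻¹ := by
    rcases subsingleton_or_nontrivial Z with h | h
    · exact Or.inl h
    · right
      have : ‖(((ContinuousLinearEquiv.refl ℝ Z).symm : Z ≃L[ℝ] Z) : Z →L[ℝ] Z)‖₊ = 1 := by
        simp [ContinuousLinearMap.nnnorm_id]
      rw [this, inv_one, ← NNReal.coe_lt_coe]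
      norm_num
  let e := happ.toHomeomorph _ hc
  have he : ∀ z, e z = z + G z := fun z => rfl
  have hGd : ∀ z, ‖fderiv ℝ G z‖ ≤ 1 / 2 := fun z => by
    simpa using norm_fderiv_le_of_lipschitz ℝ hL (x₀ := z)
  -- Neumann series: `‖DG(z)‖ ≤ 1/2`, so the derivative of `id + G` is invertible everywhere.
  have hunit : ∀ z, ∃ A : Z ≃L[ℝ] Z,
      (A : Z →L[ℝ] Z) = ContinuousLinearMap.id ℝ Z + fderiv ℝ G z := fun z => by
    have h1 : ‖-fderiv ℝ G z‖ < 1 := by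
      rw [norm_neg]; exact (hGd z).trans_lt (by norm_num)
    refine ⟨ContinuousLinearEquiv.unitsEquiv ℝ Z (Units.oneSub _ h1), ?_⟩
    ext x
    simp
  choose A hA using hunit
  refine ⟨e, he, ?_, ?_⟩
  · have hfun : (e : Z → Z) = fun z => z + G z := funext he
    refine e.contDiff_symm (f₀' := A) (fun z => ?_) ?_
    · rw [hA, hfun]
      exact (hasFDerivAt_id z).add ((hG.differentiable (by simp)) z).hasFDerivAt
    · rw [hfun]
      exact contDiff_id.add hG
  · refine LipschitzWith.of_dist_le_mul fun x y => ?_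
    have h1 := hL.dist_le_mul (e.symm x) (e.symm y)
    have hx := he (e.symm x)
    have hy := he (e.symm y)
    rw [e.apply_symm_apply] at hx hy
    rw [dist_eq_norm] at h1 ⊢
    rw [dist_eq_norm] at h1 ⊢
    have h2 : e.symm x - e.symm y = (x - y) - (G (e.symm x) - G (e.symm y)) := by
      have h3 : e.symm x = x - G (e.symm x) := eq_sub_of_add_eq hx.symm
      have h4 : e.symm y = y - G (e.symm y) := eq_sub_of_add_eq hy.symm
      calc e.symm x - e.symm y = (x - G (e.symm x)) - (y - G (e.symm y)) := by rw [← h3, ← h4]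
        _ = _ := by abel
    have h3 := norm_sub_le (x - y) (G (e.symm x) - G (e.symm y))
    rw [← h2] at h3
    push_cast at h1 ⊢
    linarith

/-- Post-composition with a `C¹` map is a `C¹` map between spaces of continuous functions on a
compact space. -/
lemma contDiff_postcomp {α X Y : Type*} [TopologicalSpace α] [CompactSpace α]
    [NormedAddCommGroup X] [NormedSpace ℝ X] [NormedAddCommGroup Y] [NormedSpace ℝ Y]
    (F : C(X, Y)) (hF : ContDiff ℝ 1 F) : ContDiff ℝ 1 (fun u : C(α, X) => F.comp u) := by
  obtain ⟨F', hF'c, hF'⟩ := contDiff_one_iff_hasFDerivAt.1 hF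
  let DF : C(X, X →L[ℝ] Y) := ⟨F', hF'c⟩
  let appL : C(α, X →L[ℝ] Y) →L[ℝ] C(α, X) →L[ℝ] C(α, Y) :=
    LinearMap.mkContinuous₂ (E := C(α, X →L[ℝ] Y)) (F := C(α, X)) (G := C(α, Y)) (σ₁₃ := .id ℝ)
      (σ₂₃ := .id ℝ)
      (LinearMap.mk₂ ℝ (fun A h => ⟨fun s => A s (h s), by fun_prop⟩)
        (fun _ _ _ => by ext; simp) (fun _ _ _ => by ext; simp)
        (fun _ _ _ => by ext; simp) (fun _ _ _ => by ext; simp)) 1 fun A h => by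
      rw [ContinuousMap.norm_le _ (by positivity), one_mul]
      intro s
      exact (A s).le_of_opNorm_le_of_le (A.norm_coe_le_norm s) (h.norm_coe_le_norm s)
  have happ : ∀ A h s, appL A h s = A s (h s) := fun _ _ _ => rfl
  refine contDiff_one_iff_hasFDerivAt.2 ⟨fun u => appL (DF.comp u),
    appL.continuous.comp (ContinuousMap.continuous_postcomp DF), fun u => ?_⟩
  rw [hasFDerivAt_iff_isLittleO_nhds_zero, Asymptotics.isLittleO_iff]
  intro ε hε
  have hcont : ContinuousAt (fun k : C(α, X) => DF.comp (u + k)) 0 :=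
    ((ContinuousMap.continuous_postcomp DF).comp (continuous_const.add continuous_id)).continuousAt
  obtain ⟨δ, hδ, hball⟩ := (Metric.continuousAt_iff (α := C(α, X)) (β := C(α, X →L[ℝ] Y))).1 hcont ε hε
  filter_upwards [Metric.ball_mem_nhds (0 : C(α, X)) hδ] with h hh
  rw [ContinuousMap.norm_le _ (by positivity)]
  intro s
  have hhs : ‖h s‖ < δ := (h.norm_coe_le_norm s).trans_lt (by simpa using hh)
  -- Perturbing `u` by the constant function `y - u s` turns sup-norm continuity of `k ↦ F' ∘ (u +
  -- k)` into closeness of `F' y` and `F' (u s)`, with a `δ` that does not depend on `s`. The mean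
  -- value inequality on the ball then bounds the remainder uniformly in `s`.
  have hb : ∀ y ∈ Metric.ball (u s) δ, ‖F' y - F' (u s)‖ ≤ ε := fun y hy => by
    have hk : dist (ContinuousMap.const α (y - u s)) (0 : C(α, X)) < δ := by
      rw [dist_zero_right]
      refine lt_of_le_of_lt ((ContinuousMap.norm_le _ (norm_nonneg (y - u s))).2 fun _ => le_rfl) ?_
      simpa [dist_eq_norm] using hy
    have h1 := (ContinuousMap.dist_apply_le_dist s).trans (hball hk).le
    simpa [DF, dist_eq_norm] using h1
  have h2 := (convex_ball (u s) δ).norm_image_sub_le_of_norm_hasFDerivWithin_le'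
    (f := F) (f' := F') (φ := F' (u s)) (C := ε) (x := u s) (y := u s + h s)
    (fun y _ => (hF' y).hasFDerivWithinAt) hb (Metric.mem_ball_self hδ) (by simpa using hhs)
  have h3 : ‖F (u s + h s) - F (u s) - F' (u s) (h s)‖ ≤ ε * ‖h s‖ := by simpa using h2
  exact h3.trans (mul_le_mul_of_nonneg_left (h.norm_coe_le_norm s) hε.le)

/-- Multiplication by a continuous scalar function as a continuous linear map. -/
def mulCLM {α X : Type*} [TopologicalSpace α] [CompactSpace α]
    [NormedAddCommGroup X] [NormedSpace ℝ X] (c : C(α, ℝ)) : C(α, X) →L[ℝ] C(α, X) :=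
  LinearMap.mkContinuous
    { toFun := fun u => ⟨fun s => c s • u s, by fun_prop⟩
      map_add' := fun _ _ => by ext; simp
      map_smul' := fun r u => by ext s; simp [smul_comm (c s) r] } ‖c‖ fun u => by
    rw [ContinuousMap.norm_le _ (by positivity)]
    intro s
    simp only [LinearMap.coe_mk, AddHom.coe_mk, ContinuousMap.coe_mk, norm_smul]
    exact mul_le_mul (c.norm_coe_le_norm s) (u.norm_coe_le_norm s) (norm_nonneg _) (norm_nonneg _)

@[simp] lemma mulCLM_apply {α X : Type*} [TopologicalSpace α] [CompactSpace α]
    [NormedAddCommGroup X] [NormedSpace ℝ X] (c : C(α, ℝ)) (u : C(α, X)) (s : α) :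
    mulCLM c u s = c s • u s := rfl

/-! ### Convolution with an operator family singular at time zero -/

section Volterra

variable {X Y : Type*} [NormedAddCommGroup X] [NormedSpace ℝ X] [NormedAddCommGroup Y]
  [NormedSpace ℝ Y] {S : ℝ → Y →L[ℝ] X} {b : ℝ → ℝ} {t : ℝ}

lemma convolution_comm (S : ℝ → Y →L[ℝ] X) (f : ℝ → Y) (τ : ℝ) :
    ∫ s in (0 : ℝ)..τ, S (τ - s) (f s) = ∫ r in (0 : ℝ)..τ, S r (f (τ - r)) := by
  have := intervalIntegral.integral_comp_sub_left (a := 0) (b := τ)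
    (fun r => S r (f (τ - r))) τ
  simpa using this

lemma aestronglyMeasurable_comp_sub
    (hS : ContinuousOn (fun p : ℝ × Y => S p.1 p.2) (Ioi 0 ×ˢ univ)) {f : ℝ → Y}
    (hf : Continuous f) (τ : ℝ) :
    AEStronglyMeasurable (fun r => S r (f (τ - r))) (volume.restrict (Ioc 0 t)) := by
  have : ContinuousOn (fun r => S r (f (τ - r))) (Ioi 0) :=
    hS.comp (f := fun r : ℝ => (r, f (τ - r))) (by fun_prop) fun r hr => ⟨hr, mem_univ _⟩
  exact (this.aestronglyMeasurable measurableSet_Ioi).mono_measure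
    (Measure.restrict_mono Ioc_subset_Ioi_self le_rfl)

lemma intervalIntegrable_comp_sub
    (hS : ContinuousOn (fun p : ℝ × Y => S p.1 p.2) (Ioi 0 ×ˢ univ))
    (hb : ∀ r ∈ Ioc 0 t, ‖S r‖ ≤ b r) (hbi : IntegrableOn b (Ioc 0 t)) {f : ℝ → Y}
    (hf : Continuous f) {M : ℝ} (hM : ∀ s, ‖f s‖ ≤ M) (τ : ℝ) :
    IntegrableOn (fun r => S r (f (τ - r))) (Ioc 0 t) := by
  refine Integrable.mono' (hbi.mul_const M) (aestronglyMeasurable_comp_sub hS hf τ) ?_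
  refine (ae_restrict_iff' measurableSet_Ioc).2 (Eventually.of_forall fun r hr => ?_)
  exact (S r).le_of_opNorm_le_of_le (hb r hr) (hM _)

/-- With the operator in the variable `r`, its singularity no longer moves with `τ`. Writing the
integral over the fixed interval `(0, t]` with the indicator of `r < τ`, dominated convergence with
majorant `b(r) M` applies: for `r ≠ τ₀` the integrand is continuous in `τ` at `τ₀`. -/
lemma continuous_convolution
    (hS : ContinuousOn (fun p : ℝ × Y => S p.1 p.2) (Ioi 0 ×ˢ univ))
    (hb : ∀ r ∈ Ioc 0 t, ‖S r‖ ≤ b r) (hbi : IntegrableOn b (Ioc 0 t)) {f : ℝ → Y}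
    (hf : Continuous f) {M : ℝ} (hM : ∀ s, ‖f s‖ ≤ M) :
    ContinuousOn (fun τ => ∫ r in (0 : ℝ)..τ, S r (f (τ - r))) (Icc 0 t) := by
  have hM0 : 0 ≤ M := (norm_nonneg _).trans (hM 0)
  have key : Continuous fun τ => ∫ r in Ioc 0 t, (Iio τ).indicator (fun r => S r (f (τ - r))) r := by
    refine continuous_iff_continuousAt.2 fun τ₀ => ?_
    refine continuousAt_of_dominated (bound := fun r => b r * M) ?_ ?_ (hbi.mul_const M) ?_
    · exact Eventually.of_forall fun τ =>
        (aestronglyMeasurable_comp_sub hS hf τ).indicator measurableSet_Iio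
    · refine Eventually.of_forall fun τ => ?_
      refine (ae_restrict_iff' measurableSet_Ioc).2 (Eventually.of_forall fun r hr => ?_)
      exact (norm_indicator_le_norm_self _ _).trans
        ((S r).le_of_opNorm_le_of_le (hb r hr) (hM _))
    · have hne : ∀ᵐ r ∂(volume.restrict (Ioc 0 t)), r ≠ τ₀ := by
        refine ae_restrict_of_ae ?_
        simp [ae_iff, measure_singleton]
      filter_upwards [hne] with r hr
      rcases lt_or_gt_of_ne hr with h | h
      · have h1 : ContinuousAt (fun τ => S r (f (τ - r))) τ₀ := by fun_prop
        refine h1.congr ?_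
        filter_upwards [lt_mem_nhds h] with τ hτ
        rw [indicator_of_mem (show r ∈ Iio τ from hτ)]
      · refine (continuousAt_const (y := (0 : X))).congr ?_
        filter_upwards [gt_mem_nhds h] with τ hτ
        rw [indicator_of_notMem (by simpa using (le_of_lt hτ))]
  refine key.continuousOn.congr fun τ hτ => ?_
  beta_reduce
  rw [integral_indicator measurableSet_Iio, Measure.restrict_restrict measurableSet_Iio,
    intervalIntegral.integral_of_le hτ.1, integral_Ioc_eq_integral_Ioo]
  have : Iio τ ∩ Ioc 0 t = Ioo 0 τ := by
    ext r
    simp only [mem_inter_iff, mem_Iio, mem_Ioc, mem_Ioo]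
    have := hτ.2
    constructor
    · rintro ⟨h1, h2, h3⟩; exact ⟨h2, h1⟩
    · rintro ⟨h1, h2⟩; exact ⟨h2, h1, by linarith⟩
  rw [this]

/-- The Volterra operator `f ↦ ∫₀^τ S(τ-s) f(s) ds` on continuous functions on `[0, t]`. -/
lemma exists_volterra (ht : 0 ≤ t)
    (hS : ContinuousOn (fun p : ℝ × Y => S p.1 p.2) (Ioi 0 ×ˢ univ))
    (hb : ∀ r ∈ Ioc 0 t, ‖S r‖ ≤ b r) (hbi : IntegrableOn b (Ioc 0 t)) :
    ∃ V : C(Icc 0 t, Y) →L[ℝ] C(Icc 0 t, X),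
      (∀ f (τ : Icc 0 t), V f τ = ∫ s in (0 : ℝ)..τ, S (τ - s) (f (projIcc 0 t ht s))) ∧
      ‖V‖ ≤ ∫ r in Ioc 0 t, b r := by
  -- `projIcc` extends `f` by its end values to a bounded continuous function on `ℝ`; the values
  -- outside `[0, t]` never enter the integrals.
  have hf : ∀ f : C(Icc 0 t, Y), Continuous fun s => f (projIcc 0 t ht s) := fun f =>
    f.continuous.comp continuous_projIcc
  have hfM : ∀ (f : C(Icc 0 t, Y)) s, ‖f (projIcc 0 t ht s)‖ ≤ ‖f‖ := fun f s =>
    f.norm_coe_le_norm _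
  have hInt : ∀ (f : C(Icc 0 t, Y)) (τ : Icc 0 t), IntervalIntegrable
      (fun r => S r (f (projIcc 0 t ht (τ - r)))) volume 0 τ := fun f τ => by
    rw [intervalIntegrable_iff_integrableOn_Ioc_of_le τ.2.1]
    exact (intervalIntegrable_comp_sub hS hb hbi (hf f) (hfM f) τ).mono_set
      (Ioc_subset_Ioc_right τ.2.2)
  have hb0 : ∀ r ∈ Ioc 0 t, 0 ≤ b r := fun r hr => (norm_nonneg _).trans (hb r hr)
  let V₀ : C(Icc 0 t, Y) →ₗ[ℝ] C(Icc 0 t, X) :=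
    { toFun := fun f => ⟨fun τ => ∫ r in (0 : ℝ)..τ, S r (f (projIcc 0 t ht (τ - r))),
        continuousOn_iff_continuous_domRestrict.1
          (continuous_convolution hS hb hbi (hf f) (hfM f))⟩
      map_add' := fun f g => by
        ext τ
        simp only [ContinuousMap.coe_mk, ContinuousMap.add_apply, map_add]
        exact intervalIntegral.integral_add (hInt f τ) (hInt g τ)
      map_smul' := fun c f => by
        ext τ
        simp only [ContinuousMap.coe_mk, ContinuousMap.smul_apply, map_smul, RingHom.id_apply]
        exact intervalIntegral.integral_smul c _ }
  have hV₀ : ∀ f, ‖V₀ f‖ ≤ (∫ r in Ioc 0 t, b r) * ‖f‖ := fun f => by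
    have hB : 0 ≤ ∫ r in Ioc 0 t, b r := setIntegral_nonneg measurableSet_Ioc hb0
    rw [ContinuousMap.norm_le _ (by positivity)]
    intro τ
    change ‖∫ r in (0 : ℝ)..τ, S r (f (projIcc 0 t ht (τ - r)))‖ ≤ _
    rw [intervalIntegral.integral_of_le τ.2.1, ← integral_mul_const]
    have hsub : Ioc (0 : ℝ) τ ⊆ Ioc 0 t := Ioc_subset_Ioc_right τ.2.2
    calc ‖∫ r in Ioc (0 : ℝ) τ, S r (f (projIcc 0 t ht (τ - r)))‖
        ≤ ∫ r in Ioc (0 : ℝ) τ, b r * ‖f‖ := by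
          refine norm_integral_le_of_norm_le ((hbi.mono_set hsub).mul_const _) ?_
          refine (ae_restrict_iff' measurableSet_Ioc).2 (Eventually.of_forall fun r hr => ?_)
          exact (S r).le_of_opNorm_le_of_le (hb r (hsub hr)) (hfM f _)
      _ ≤ ∫ r in Ioc (0 : ℝ) t, b r * ‖f‖ := by
          refine setIntegral_mono_set (hbi.mul_const _) ?_ hsub.eventuallyLE
          refine (ae_restrict_iff' measurableSet_Ioc).2 (Eventually.of_forall fun r hr => ?_)
          exact mul_nonneg (hb0 r hr) (norm_nonneg _)
  refine ⟨V₀.mkContinuous _ hV₀, fun f τ => ?_, LinearMap.mkContinuous_norm_le _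
    (setIntegral_nonneg measurableSet_Ioc hb0) _⟩
  exact (convolution_comm S (fun s => f (projIcc 0 t ht s)) τ).symm

end Volterra

end Abstract

/-! ### Abstract mild solutions and their semiflow -/

section MildSolutions

open Set Filter Topology

variable {X Y : Type} [NormedAddCommGroup X] [NormedSpace ℝ X] [NormedAddCommGroup Y]
  [NormedSpace ℝ Y]

/-- A strongly continuous semigroup `T` on `X` that extends to a family `S` of operators from `Y`
to `X` with an integrable singularity at time `0`. -/
structure IsSmoothingSemigroup (T : ℝ → X →L[ℝ] X) (S : ℝ → Y →L[ℝ] X) : Prop where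
  zero : ∀ x, T 0 x = x
  add : ∀ σ τ, 0 ≤ σ → 0 ≤ τ → ∀ x, T (σ + τ) x = T σ (T τ x)
  continuous : ∀ x, Continuous fun τ => T τ x
  comp : ∀ σ τ, 0 ≤ σ → 0 < τ → ∀ y, T σ (S τ y) = S (σ + τ) y
  bound : ∃ γ < (1 : ℝ), ∀ t, ∃ C, ∀ τ ∈ Ioc 0 t, ‖S τ‖ ≤ C * τ ^ (-γ)

namespace IsSmoothingSemigroup

variable {T : ℝ → X →L[ℝ] X} {S : ℝ → Y →L[ℝ] X}

/-- Uniform boundedness principle: each orbit is continuous, hence bounded on the compact interval.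
-/
lemma exists_norm_le [CompleteSpace X] (h : IsSmoothingSemigroup T S) (a b : ℝ) :
    ∃ M, 0 ≤ M ∧ ∀ τ ∈ Icc a b, ‖T τ‖ ≤ M := by
  obtain ⟨M, hM⟩ := banach_steinhaus (g := fun τ : Icc a b => T τ) fun x => by
    obtain ⟨C, hC⟩ := (isCompact_Icc (a := a) (b := b)).exists_bound_of_continuousOn
      (h.continuous x).continuousOn
    exact ⟨C, fun τ => hC τ τ.2⟩
  exact ⟨max M 0, le_max_right _ _, fun τ hτ => (hM ⟨τ, hτ⟩).trans (le_max_left _ _)⟩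

lemma continuous_uncurry [CompleteSpace X] (h : IsSmoothingSemigroup T S) :
    Continuous fun p : ℝ × X => T p.1 p.2 := by
  refine continuous_iff_continuousAt.2 fun ⟨τ₀, x₀⟩ => ?_
  obtain ⟨M, hM0, hM⟩ := h.exists_norm_le (τ₀ - 1) (τ₀ + 1)
  rw [ContinuousAt, tendsto_iff_norm_sub_tendsto_zero]
  have h1 : Tendsto (fun p : ℝ × X => M * ‖p.2 - x₀‖ + ‖T p.1 x₀ - T τ₀ x₀‖)
      (𝓝 (τ₀, x₀)) (𝓝 (M * ‖x₀ - x₀‖ + ‖T τ₀ x₀ - T τ₀ x₀‖)) := by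
    have := h.continuous x₀
    exact Continuous.tendsto (f := fun p : ℝ × X => M * ‖p.2 - x₀‖ + ‖T p.1 x₀ - T τ₀ x₀‖)
      (by fun_prop) (τ₀, x₀)
  simp only [sub_self, norm_zero, mul_zero, add_zero] at h1
  refine squeeze_zero' (Eventually.of_forall fun _ => norm_nonneg _) ?_ h1
  have hmem : ∀ᶠ p : ℝ × X in 𝓝 (τ₀, x₀), p.1 ∈ Icc (τ₀ - 1) (τ₀ + 1) :=
    continuous_fst.continuousAt.eventually (Icc_mem_nhds (by simp) (by simp))
  filter_upwards [hmem] with p hp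
  calc ‖T p.1 p.2 - T τ₀ x₀‖ = ‖T p.1 (p.2 - x₀) + (T p.1 x₀ - T τ₀ x₀)‖ := by
        rw [map_sub]; congr 1; abel
    _ ≤ ‖T p.1 (p.2 - x₀)‖ + ‖T p.1 x₀ - T τ₀ x₀‖ := norm_add_le _ _
    _ ≤ _ := by
        gcongr
        exact (T p.1).le_of_opNorm_le (hM _ hp) _

/-- No continuity of `S` is assumed; it is inherited from `T`, because near `τ₀ > 0` one has `S τ =
T (τ - τ₀/2) ∘ S (τ₀/2)`. -/
lemma continuousOn_uncurry [CompleteSpace X] (h : IsSmoothingSemigroup T S) :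
    ContinuousOn (fun p : ℝ × Y => S p.1 p.2) (Ioi 0 ×ˢ univ) := by
  rintro ⟨τ₀, y₀⟩ ⟨hτ₀, -⟩
  have hτ₀ : 0 < τ₀ := hτ₀
  refine ContinuousAt.continuousWithinAt ?_
  have h1 : Continuous fun p : ℝ × Y => T (p.1 - τ₀ / 2) (S (τ₀ / 2) p.2) :=
    h.continuous_uncurry.comp (f := fun p : ℝ × Y => (p.1 - τ₀ / 2, S (τ₀ / 2) p.2)) (by fun_prop)
  refine h1.continuousAt.congr ?_
  have hmem : ∀ᶠ p : ℝ × Y in 𝓝 (τ₀, y₀), τ₀ / 2 < p.1 :=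
    continuous_fst.continuousAt.eventually (lt_mem_nhds (show τ₀ / 2 < τ₀ by linarith))
  filter_upwards [hmem] with p hp
  rw [h.comp _ _ (by linarith) (by linarith)]
  congr 2
  ring

end IsSmoothingSemigroup

/-- Mild solutions of `u' = Au - F(u)`, `u(0) = x`, on a bounded time interval. -/
def IsMildOn (T : ℝ → X →L[ℝ] X) (S : ℝ → Y →L[ℝ] X) (F : X → Y) {t : ℝ} (ht : 0 ≤ t) (x : X)
    (u : C(Icc 0 t, X)) : Prop :=
  ∀ τ : Icc 0 t, u τ = T τ x - ∫ s in (0 : ℝ)..τ, S (τ - s) (F (u (projIcc 0 t ht s)))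

lemma integrableOn_exp_mul_rpow {γ : ℝ} (hγ : γ < 1) (C t lam : ℝ) :
    IntegrableOn (fun r : ℝ => Real.exp (-(lam * r)) * (C * r ^ (-γ))) (Ioc 0 t) := by
  rcases le_or_gt t 0 with ht | ht
  · simp [Ioc_eq_empty_of_le ht]
  have h1 : IntervalIntegrable (fun r : ℝ => r ^ (-γ)) volume 0 t :=
    intervalIntegral.intervalIntegrable_rpow' (by linarith)
  have h2 := (h1.const_mul C).continuousOn_mul (g := fun r => Real.exp (-(lam * r)))
    (by fun_prop)
  exact (intervalIntegrable_iff_integrableOn_Ioc_of_le ht.le).1 h2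

/-- This is what lets an exponential weight in time make the Volterra operator small on an interval
of any length, so that no continuation in short steps is needed. -/
lemma tendsto_integral_exp_mul_rpow {γ : ℝ} (hγ : γ < 1) (C t : ℝ) :
    Tendsto (fun lam : ℝ => ∫ r in Ioc 0 t, Real.exp (-(lam * r)) * (C * r ^ (-γ))) atTop
      (𝓝 0) := by
  rw [show 𝓝 (0 : ℝ) = 𝓝 (∫ r in Ioc (0 : ℝ) t, (0 : ℝ)) by simp]
  refine tendsto_integral_filter_of_dominated_convergence (fun r => ‖C * r ^ (-γ)‖) ?_ ?_ ?_ ?_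
  · exact Eventually.of_forall fun lam => (integrableOn_exp_mul_rpow hγ C t lam).1
  · filter_upwards [eventually_ge_atTop 0] with lam hlam
    refine (ae_restrict_iff' measurableSet_Ioc).2 (Eventually.of_forall fun r hr => ?_)
    rw [norm_mul]
    refine mul_le_of_le_one_left (norm_nonneg _) ?_
    rw [Real.norm_eq_abs, Real.abs_exp, Real.exp_le_one_iff]
    have := mul_nonneg hlam hr.1.le
    linarith
  · have := (integrableOn_exp_mul_rpow hγ C t 0).norm
    simpa using this
  · refine (ae_restrict_iff' measurableSet_Ioc).2 (Eventually.of_forall fun r hr => ?_)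
    have h1 : Tendsto (fun lam : ℝ => Real.exp (-(lam * r))) atTop (𝓝 0) :=
      Real.tendsto_exp_neg_atTop_nhds_zero.comp (tendsto_id.atTop_mul_const hr.1)
    simpa using h1.mul_const (C * r ^ (-γ))

variable {T : ℝ → X →L[ℝ] X} {S : ℝ → Y →L[ℝ] X} {F : X → Y}

/-- The solution map on a bounded time interval. -/
lemma exists_solutionMap [CompleteSpace X] (h : IsSmoothingSemigroup T S) (hF : ContDiff ℝ 1 F)
    {L : ℝ≥0} (hL : LipschitzWith L F) {t : ℝ} (ht : 0 ≤ t) :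
    ∃ Φ : X → C(Icc 0 t, X), ContDiff ℝ 1 Φ ∧ (∃ K, LipschitzWith K Φ) ∧
      ∀ x u, IsMildOn T S F ht x u ↔ u = Φ x := by
  obtain ⟨γ, hγ, hbd⟩ := h.bound
  obtain ⟨C, hC⟩ := hbd t
  obtain ⟨M, hM0, hM⟩ := h.exists_norm_le 0 t
  -- `lam` is so large that (norm of the weighted Volterra operator) times (Lipschitz constant of
  -- `F`) is at most `1/2`.
  obtain ⟨lam, hlam⟩ : ∃ lam : ℝ,
      (∫ r in Ioc 0 t, Real.exp (-(lam * r)) * (C * r ^ (-γ))) * L ≤ 1 / 2 := by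
    have h1 := (tendsto_integral_exp_mul_rpow hγ C t).mul_const (L : ℝ)
    rw [zero_mul] at h1
    exact (h1.eventually (ge_mem_nhds (by norm_num : (0 : ℝ) < 1 / 2))).exists
  have hSc := h.continuousOn_uncurry
  obtain ⟨V, hV, hVn⟩ := exists_volterra (S := fun r => Real.exp (-(lam * r)) • S r)
    (b := fun r => Real.exp (-(lam * r)) * (C * r ^ (-γ))) ht
    (by
      have h1 : Continuous fun p : ℝ × Y => Real.exp (-(lam * p.1)) := by fun_prop
      exact h1.continuousOn.smul hSc)
    (fun r hr => by
      rw [norm_smul, Real.norm_eq_abs, Real.abs_exp]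
      exact mul_le_mul_of_nonneg_left (hC r hr) (Real.exp_pos _).le)
    (integrableOn_exp_mul_rpow hγ C t lam)
  let E₁ : C(Icc 0 t, ℝ) := ⟨fun s => Real.exp (lam * s), by fun_prop⟩
  let E₂ : C(Icc 0 t, ℝ) := ⟨fun s => Real.exp (-(lam * s)), by fun_prop⟩
  have hE : ∀ s, E₁ s * E₂ s = 1 := fun s => by simp [E₁, E₂, ← Real.exp_add]
  have hE' : ∀ s, E₂ s * E₁ s = 1 := fun s => by rw [mul_comm, hE]
  let Fc : C(X, Y) := ⟨F, hF.continuous⟩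
  -- The nonlinear term in the unknown `w = e^{-λs} u`. Conjugating `F` by the factors `e^{λs}` and
  -- `e^{-λs}` keeps its Lipschitz constant `L`.
  let G : C(Icc 0 t, X) → C(Icc 0 t, X) := fun u => V (mulCLM E₂ (Fc.comp (mulCLM E₁ u)))
  have hGc : ContDiff ℝ 1 G :=
    V.contDiff.comp ((mulCLM E₂).contDiff.comp
      ((contDiff_postcomp Fc hF).comp (mulCLM E₁).contDiff))
  have hGL : LipschitzWith (1 / 2) G := by
    refine LipschitzWith.of_dist_le_mul fun u v => ?_
    rw [dist_eq_norm, dist_eq_norm]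
    have h1 : ‖mulCLM E₂ (Fc.comp (mulCLM E₁ u)) - mulCLM E₂ (Fc.comp (mulCLM E₁ v))‖
        ≤ L * ‖u - v‖ := by
      rw [ContinuousMap.norm_le _ (by positivity)]
      intro s
      have h2 := hL.dist_le_mul (E₁ s • u s) (E₁ s • v s)
      rw [dist_eq_norm, dist_eq_norm, ← smul_sub, norm_smul] at h2
      have h3 : 0 < E₂ s := Real.exp_pos _
      have h4 : 0 < E₁ s := Real.exp_pos _
      calc ‖E₂ s • F (E₁ s • u s) - E₂ s • F (E₁ s • v s)‖
          = E₂ s * ‖F (E₁ s • u s) - F (E₁ s • v s)‖ := by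
            rw [← smul_sub, norm_smul, Real.norm_of_nonneg h3.le]
        _ ≤ E₂ s * (L * (‖E₁ s‖ * ‖u s - v s‖)) := by gcongr
        _ = (E₁ s * E₂ s) * (L * ‖(u - v) s‖) := by
            rw [Real.norm_of_nonneg h4.le, ContinuousMap.sub_apply]; ring
        _ ≤ L * ‖u - v‖ := by
            rw [hE, one_mul]
            exact mul_le_mul_of_nonneg_left ((u - v).norm_coe_le_norm s) L.2
    have h5 : G u - G v = V (mulCLM E₂ (Fc.comp (mulCLM E₁ u)) -
        mulCLM E₂ (Fc.comp (mulCLM E₁ v))) := (map_sub V _ _).symm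
    rw [h5]
    refine (V.le_of_opNorm_le_of_le hVn h1).trans ?_
    rw [← mul_assoc]
    have h6 : (((1 / 2 : ℝ≥0)) : ℝ) = 1 / 2 := by norm_num
    rw [h6]
    exact mul_le_mul_of_nonneg_right hlam (norm_nonneg _)
  obtain ⟨e, he, hes, heL⟩ := exists_homeomorph_id_add hGc hGL
  let 𝒯 : X →L[ℝ] C(Icc 0 t, X) := LinearMap.mkContinuous
    { toFun := fun x => ⟨fun τ => T τ x, (h.continuous x).comp continuous_subtype_val⟩
      map_add' := fun _ _ => by ext; simp
      map_smul' := fun _ _ => by ext; simp } M fun x => by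
    rw [ContinuousMap.norm_le _ (by positivity)]
    exact fun τ => (T τ).le_of_opNorm_le (hM τ τ.2) x
  have hinv₁ : ∀ u : C(Icc 0 t, X), mulCLM E₁ (mulCLM E₂ u) = u := fun u => by
    ext s; simp [smul_smul, hE]
  have hinv₂ : ∀ u : C(Icc 0 t, X), mulCLM E₂ (mulCLM E₁ u) = u := fun u => by
    ext s; simp [smul_smul, hE']
  -- The exponentials recombine by `e^{-λ(τ-s)} e^{-λs} = e^{-λτ}`, so the weighted equation is the
  -- original one multiplied by `e^{-λτ}`.
  have hG : ∀ u (τ : Icc 0 t), G (mulCLM E₂ u) τ =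
      E₂ τ • ∫ s in (0 : ℝ)..τ, S (τ - s) (F (u (projIcc 0 t ht s))) := fun u τ => by
    change V (mulCLM E₂ (Fc.comp (mulCLM E₁ (mulCLM E₂ u)))) τ = _
    rw [hinv₁, hV, ← intervalIntegral.integral_smul]
    refine intervalIntegral.integral_congr fun s hs => ?_
    rw [uIcc_of_le τ.2.1] at hs
    have hs' : s ∈ Icc 0 t := ⟨hs.1, hs.2.trans τ.2.2⟩
    simp only [projIcc_of_mem ht hs', mulCLM_apply, ContinuousMap.comp_apply, smul_apply, map_smul,
      smul_smul]
    congr 1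
    simp only [E₂, ContinuousMap.coe_mk, ← Real.exp_add]
    ring_nf
  refine ⟨fun x => mulCLM E₁ (e.symm (mulCLM E₂ (𝒯 x))), ?_, ?_, fun x u => ?_⟩
  · exact (mulCLM E₁).contDiff.comp (hes.comp ((mulCLM E₂).contDiff.comp 𝒯.contDiff))
  · exact ⟨_, (mulCLM E₁).lipschitz.comp (heL.comp ((mulCLM E₂).lipschitz.comp 𝒯.lipschitz))⟩
  · have h1 : IsMildOn T S F ht x u ↔ e (mulCLM E₂ u) = mulCLM E₂ (𝒯 x) := by
      rw [ContinuousMap.ext_iff]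
      refine forall_congr' fun τ => ?_
      have h2 : 𝒯 x τ = T τ x := rfl
      have h3 : E₂ τ ≠ 0 := (Real.exp_pos _).ne'
      rw [he, ContinuousMap.add_apply, hG, mulCLM_apply, mulCLM_apply, h2, ← smul_add,
        (smul_right_injective X h3).eq_iff, eq_sub_iff_add_eq]
    rw [h1]
    constructor
    · intro h2
      beta_reduce
      rw [← h2, e.symm_apply_apply, hinv₁]
    · rintro rfl
      rw [hinv₂, e.apply_symm_apply]

/-- Mild solutions of `u' = Au - F(u)`, `u(0) = x`, on `[0, ∞)`. -/
def IsMild (T : ℝ → X →L[ℝ] X) (S : ℝ → Y →L[ℝ] X) (F : X → Y) (x : X) (v : C(ℝ≥0, X)) : Prop :=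
  ∀ τ : ℝ≥0, v τ = T τ x - ∫ s in (0 : ℝ)..τ, S (τ - s) (F (v s.toNNReal))

/-- The restriction of a function on `[0, ∞)` to `[0, t]`. -/
def restrictIcc (t : ℝ) (v : C(ℝ≥0, X)) : C(Icc 0 t, X) :=
  ⟨fun s => v (s : ℝ).toNNReal, by fun_prop⟩

lemma isMild_iff {x : X} {v : C(ℝ≥0, X)} :
    IsMild T S F x v ↔ ∀ t (ht : 0 ≤ t), IsMildOn T S F ht x (restrictIcc t v) := by
  have key : ∀ t (ht : 0 ≤ t) (τ : Icc 0 t),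
      ∫ s in (0 : ℝ)..τ, S ((τ : ℝ) - s) (F (restrictIcc t v (projIcc 0 t ht s)))
        = ∫ s in (0 : ℝ)..τ, S ((τ : ℝ) - s) (F (v s.toNNReal)) := fun t ht τ => by
    refine intervalIntegral.integral_congr fun s hs => ?_
    rw [uIcc_of_le τ.2.1] at hs
    simp [restrictIcc, projIcc_of_mem ht ⟨hs.1, hs.2.trans τ.2.2⟩]
  constructor
  · intro h t ht τ
    rw [key]
    have := h (τ : ℝ).toNNReal
    rwa [Real.coe_toNNReal _ τ.2.1] at this
  · intro h τ
    have := h τ τ.coe_nonneg ⟨τ, τ.coe_nonneg, le_rfl⟩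
    rw [key] at this
    simpa [restrictIcc] using this

lemma IsMildOn.restrict {t t' : ℝ} (ht : 0 ≤ t) (ht' : 0 ≤ t') (htt' : t' ≤ t) {x : X}
    {u : C(Icc 0 t, X)} (hu : IsMildOn T S F ht x u) :
    IsMildOn T S F ht' x (u.comp ⟨inclusion (Icc_subset_Icc_right htt'), continuous_inclusion _⟩) := by
  intro τ
  have := hu (inclusion (Icc_subset_Icc_right htt') τ)
  refine this.trans ?_
  congr 1
  refine intervalIntegral.integral_congr fun s hs => ?_
  rw [coe_inclusion, uIcc_of_le τ.2.1] at hs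
  have h1 : s ∈ Icc 0 t' := ⟨hs.1, hs.2.trans τ.2.2⟩
  have h2 : s ∈ Icc 0 t := ⟨hs.1, h1.2.trans htt'⟩
  simp [projIcc_of_mem ht h2, projIcc_of_mem ht' h1, inclusion]

lemma IsMild.intervalIntegrable [CompleteSpace X] (h : IsSmoothingSemigroup T S)
    (hF : Continuous F) (v : C(ℝ≥0, X)) (τ : ℝ≥0) :
    IntervalIntegrable (fun s => S (τ - s) (F (v s.toNNReal))) volume 0 τ := by
  obtain ⟨γ, hγ, hbd⟩ := h.bound
  obtain ⟨C, hC⟩ := hbd τ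
  -- Freezing the trajectory outside `[0, τ]` makes it bounded on `ℝ`, as the majorant `C r^{-γ} M`
  -- requires.
  have hcont : Continuous fun s : ℝ => F (v (projIcc 0 (τ : ℝ) τ.coe_nonneg s : ℝ).toNNReal) := by
    have : Continuous (projIcc 0 (τ : ℝ) τ.coe_nonneg) := continuous_projIcc
    fun_prop
  obtain ⟨M, hM⟩ : ∃ M, ∀ s : ℝ, ‖F (v (projIcc 0 (τ : ℝ) τ.coe_nonneg s : ℝ).toNNReal)‖ ≤ M := by
    obtain ⟨M, hM⟩ := (isCompact_Icc (a := 0) (b := (τ : ℝ))).exists_bound_of_continuousOn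
      (f := fun s => F (v s.toNNReal)) (Continuous.continuousOn (by fun_prop))
    exact ⟨M, fun s => hM _ (projIcc 0 (τ : ℝ) τ.coe_nonneg s).2⟩
  have h1 := intervalIntegrable_comp_sub (t := τ) (b := fun r => C * r ^ (-γ))
    h.continuousOn_uncurry hC (by simpa using integrableOn_exp_mul_rpow hγ C τ 0) hcont hM τ
  have h2 := ((intervalIntegrable_iff_integrableOn_Ioc_of_le τ.coe_nonneg).2 h1).comp_sub_left τ
  rw [sub_self] at h2
  simp only [sub_zero, sub_sub_cancel] at h2
  refine h2.symm.congr fun s hs => ?_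
  rw [uIoc_of_le τ.coe_nonneg] at hs
  simp [projIcc_of_mem τ.coe_nonneg ⟨hs.1.le, hs.2⟩]

/-- Translating a mild solution in time gives a mild solution. -/
lemma IsMild.shift [CompleteSpace X] (h : IsSmoothingSemigroup T S) (hF : Continuous F) {x : X}
    {v : C(ℝ≥0, X)} (hv : IsMild T S F x v) (τ : ℝ≥0) :
    IsMild T S F (v τ) ⟨fun σ => v (σ + τ), by fun_prop⟩ := by
  intro σ
  have hi := IsMild.intervalIntegrable h hF v (σ + τ)
  have hi' := IsMild.intervalIntegrable h hF v τ
  have e1 := hv (σ + τ)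
  have e2 := hv τ
  simp only [ContinuousMap.coe_mk]
  have hsplit := intervalIntegral.integral_add_adjacent_intervals (μ := volume)
    (f := fun s => S ((σ + τ : ℝ≥0) - s) (F (v s.toNNReal)))
    (a := 0) (b := τ) (c := (σ + τ : ℝ≥0))
    (hi.mono_set (by
      rw [uIcc_of_le τ.coe_nonneg, uIcc_of_le (σ + τ).coe_nonneg]
      exact Icc_subset_Icc_right (by simp)))
    (hi.mono_set (by
      rw [uIcc_of_le (by simp), uIcc_of_le (σ + τ).coe_nonneg]
      exact Icc_subset_Icc_left τ.coe_nonneg))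
  have h1 : ∫ s in (0 : ℝ)..τ, S ((σ + τ : ℝ≥0) - s) (F (v s.toNNReal))
      = T σ (∫ s in (0 : ℝ)..τ, S (τ - s) (F (v s.toNNReal))) := by
    rw [← ContinuousLinearMap.intervalIntegral_comp_comm _ hi']
    -- The endpoint `s = τ` is removed because there the operator is `S 0`, to which the composition
    -- law does not apply.
    rw [intervalIntegral.integral_of_le τ.coe_nonneg, intervalIntegral.integral_of_le τ.coe_nonneg,
      integral_Ioc_eq_integral_Ioo, integral_Ioc_eq_integral_Ioo]
    refine setIntegral_congr_fun measurableSet_Ioo fun s hs => ?_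
    rw [h.comp _ _ σ.coe_nonneg (by linarith [hs.2])]
    congr 2
    push_cast
    ring
  have h2 : ∫ s in (τ : ℝ)..(σ + τ : ℝ≥0), S ((σ + τ : ℝ≥0) - s) (F (v s.toNNReal))
      = ∫ s in (0 : ℝ)..σ, S (σ - s) (F (v (s.toNNReal + τ))) := by
    have := intervalIntegral.integral_comp_add_right (a := 0) (b := σ)
      (fun s => S ((σ + τ : ℝ≥0) - s) (F (v s.toNNReal))) τ
    rw [zero_add, ← NNReal.coe_add] at this
    rw [← this]
    refine intervalIntegral.integral_congr fun s hs => ?_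
    rw [uIcc_of_le σ.coe_nonneg] at hs
    rw [Real.toNNReal_add hs.1 τ.coe_nonneg, Real.toNNReal_coe]
    congr 2
    push_cast
    ring
  rw [e1, ← hsplit, h1, h2, NNReal.coe_add, h.add _ _ σ.coe_nonneg τ.coe_nonneg]
  rw [e2, map_sub]
  abel

/-- Global well-posedness of the mild formulation, and the semiflow it generates. -/
theorem exists_semiflow [CompleteSpace X] (h : IsSmoothingSemigroup T S) (hF : ContDiff ℝ 1 F)
    {L : ℝ≥0} (hL : LipschitzWith L F) :
    (∀ x, ∃! v, IsMild T S F x v) ∧ ∃ φ : ℝ≥0 → X → X,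
      (∀ x v, IsMild T S F x v → ∀ τ, φ τ x = v τ) ∧
      (∀ t : ℝ≥0, ∃ K : ℝ≥0, ∀ τ ≤ t, LipschitzWith K (φ τ)) ∧ IsC1Semiflow φ := by
  choose Φ hΦc hΦL hΦ using fun t : ℝ≥0 => exists_solutionMap h hF hL t.coe_nonneg
  -- Consistency of the solution maps for different horizons: the restriction of a solution is a
  -- solution, and solutions are unique.
  have hres : ∀ (t τ : ℝ≥0) (hτ : τ ≤ t) x,
      Φ t x ⟨τ, τ.coe_nonneg, hτ⟩ = Φ τ x ⟨τ, τ.coe_nonneg, le_rfl⟩ := fun t τ hτ x => by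
    have h1 := ((hΦ t x (Φ t x)).2 rfl).restrict t.coe_nonneg τ.coe_nonneg hτ
    rw [← (hΦ τ x _).1 h1]
    rfl
  let φ : ℝ≥0 → X → X := fun τ x => Φ τ x ⟨τ, τ.coe_nonneg, le_rfl⟩
  have hφ : ∀ (t τ : ℝ≥0) (hτ : τ ≤ t) x, φ τ x = Φ t x ⟨τ, τ.coe_nonneg, hτ⟩ :=
    fun t τ hτ x => (hres t τ hτ x).symm
  have hcont : Continuous fun p : ℝ≥0 × X => φ p.1 p.2 := by
    refine continuous_iff_continuousAt.2 fun ⟨τ₀, x₀⟩ => ?_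
    -- A horizon beyond `τ₀`, so that a whole neighbourhood of `τ₀` is governed by one continuous
    -- map `Φ t` followed by evaluation, which is jointly continuous.
    let t := τ₀ + 1
    have h1 : Continuous fun p : ℝ≥0 × X => Φ t p.2 (projIcc 0 (t : ℝ) t.coe_nonneg p.1) := by
      have h2 : Continuous (projIcc 0 (t : ℝ) t.coe_nonneg) := continuous_projIcc
      have h3 : Continuous (Φ t) := (hΦc t).continuous
      exact continuous_eval.comp ((h3.comp continuous_snd).prodMk
        (h2.comp (NNReal.continuous_coe.comp continuous_fst)))
    refine h1.continuousAt.congr ?_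
    have hmem : ∀ᶠ p : ℝ≥0 × X in 𝓝 (τ₀, x₀), p.1 < t :=
      continuous_fst.continuousAt.eventually (gt_mem_nhds (by simp [t]))
    filter_upwards [hmem] with p hp
    rw [hφ t p.1 hp.le]
    congr 1
    exact projIcc_of_mem _ ⟨p.1.coe_nonneg, hp.le⟩
  have hsol : ∀ x, IsMild T S F x ⟨fun τ => φ τ x,
      hcont.comp (continuous_id.prodMk continuous_const)⟩ := fun x => by
    refine isMild_iff.2 fun t ht => ?_
    lift t to ℝ≥0 using ht
    refine (hΦ t x _).2 ?_
    ext s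
    have : φ (s : ℝ).toNNReal x = _ := hφ t (s : ℝ).toNNReal (Real.toNNReal_le_iff_le_coe.2 s.2.2) x
    refine this.trans ?_
    congr 1
    ext
    simp [s.2.1]
  have huniq : ∀ x v, IsMild T S F x v → ∀ τ, φ τ x = v τ := fun x v hv τ => by
    have h1 := (hΦ τ x _).1 (isMild_iff.1 hv τ τ.coe_nonneg)
    have h2 : φ τ x = Φ τ x ⟨τ, τ.coe_nonneg, le_rfl⟩ := rfl
    rw [h2, ← h1]
    change v (τ : ℝ).toNNReal = v τ
    rw [Real.toNNReal_coe]
  refine ⟨fun x => ⟨_, hsol x, fun v hv => ?_⟩, φ, huniq, fun t => ?_, ?_, ?_, hcont, fun τ => ?_⟩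
  · ext τ
    exact (huniq x v hv τ).symm
  · obtain ⟨K, hK⟩ := hΦL t
    refine ⟨K, fun τ hτ => LipschitzWith.of_dist_le_mul fun x y => ?_⟩
    rw [hφ t τ hτ, hφ t τ hτ]
    exact (ContinuousMap.dist_apply_le_dist _).trans (hK.dist_le_mul x y)
  · intro x
    have := hsol x 0
    simpa [h.zero] using this
  · intro σ τ x
    have := huniq _ _ ((hsol x).shift h hF.continuous τ) σ
    exact this.symm
  · exact (ContinuousMap.evalCLM ℝ (⟨τ, τ.coe_nonneg, le_rfl⟩ : Icc 0 (τ : ℝ))).contDiff.comp (hΦc τ)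

end MildSolutions

/-! ### The power nonlinearity and its truncation -/

section Nemytskii

open Set Filter Topology

section Pointwise

variable {V : Type*} [NormedAddCommGroup V] [InnerProductSpace ℝ V]

lemma norm_rpow_sub_one_smul {θ : ℝ} (hθ : 0 < θ) (a : V) :
    ‖‖a‖ ^ (θ - 1) • a‖ = ‖a‖ ^ θ := by
  rcases eq_or_ne a 0 with rfl | ha
  · simp [Real.zero_rpow hθ.ne']
  have h := norm_pos_iff.2 ha
  rw [norm_smul, Real.norm_of_nonneg (by positivity), Real.rpow_sub_one h.ne']
  field_simp

/-- The map `a ↦ |a|^{θ-1} a` is Hölder continuous of exponent `θ`. -/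
lemma norm_rpow_smul_sub_le {θ : ℝ} (hθ : 0 < θ) (hθ1 : θ < 1) (a b : V) :
    ‖‖a‖ ^ (θ - 1) • a - ‖b‖ ^ (θ - 1) • b‖ ≤ 4 * ‖a - b‖ ^ θ := by
  wlog hab : ‖b‖ ≤ ‖a‖ generalizing a b
  · rw [norm_sub_rev, norm_sub_rev a b]
    exact this b a (le_of_not_ge hab)
  rcases eq_or_ne b 0 with rfl | hb
  · rw [smul_zero, sub_zero, sub_zero, norm_rpow_sub_one_smul hθ]
    have : 0 ≤ ‖a‖ ^ θ := by positivity
    linarith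
  rcases eq_or_ne a b with rfl | hne
  · simp only [sub_self, norm_zero]
    positivity
  have hB := norm_pos_iff.2 hb
  have hA := hB.trans_le hab
  have hd : 0 < ‖a - b‖ := norm_pos_iff.2 (sub_ne_zero.2 hne)
  -- Since `θ < 1`, the longer vector has the smaller coefficient. After this splitting both terms
  -- are at most `‖a‖^(θ-1) ‖a - b‖`, and `‖a‖ ≥ ‖a - b‖ / 2` with `2^(1-θ) ≤ 2` gives the constant
  -- `4 = 2 · 2`.
  have h1 : ‖a‖ ^ (θ - 1) • a - ‖b‖ ^ (θ - 1) • b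
      = ‖a‖ ^ (θ - 1) • (a - b) - (‖b‖ ^ (θ - 1) - ‖a‖ ^ (θ - 1)) • b := by
    rw [smul_sub, sub_smul]; abel
  have h2 : ‖a‖ ^ (θ - 1) ≤ ‖b‖ ^ (θ - 1) :=
    Real.rpow_le_rpow_of_nonpos hB hab (by linarith)
  have h3 : ‖b‖ ^ θ ≤ ‖a‖ ^ θ := Real.rpow_le_rpow hB.le hab hθ.le
  have h4 : ‖b‖ ^ (θ - 1) * ‖b‖ = ‖b‖ ^ θ := by
    rw [Real.rpow_sub_one hB.ne']; field_simp
  have h5 : ‖a‖ ^ (θ - 1) * ‖a‖ = ‖a‖ ^ θ := by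
    rw [Real.rpow_sub_one hA.ne']; field_simp
  have hdA : ‖a - b‖ / 2 ≤ ‖a‖ := by
    have := norm_sub_le a b
    linarith
  have h6 : ‖a‖ ^ (θ - 1) ≤ (‖a - b‖ / 2) ^ (θ - 1) :=
    Real.rpow_le_rpow_of_nonpos (by positivity) hdA (by linarith)
  have h7 : (‖a - b‖ / 2) ^ (θ - 1) ≤ 2 * ‖a - b‖ ^ (θ - 1) := by
    rw [Real.div_rpow hd.le (by norm_num), div_eq_inv_mul]
    refine mul_le_mul_of_nonneg_right ?_ (by positivity)
    rw [← Real.rpow_neg (by norm_num)]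
    calc (2 : ℝ) ^ (-(θ - 1)) ≤ 2 ^ (1 : ℝ) :=
          Real.rpow_le_rpow_of_exponent_le (by norm_num) (by linarith)
      _ = 2 := by norm_num
  have h8 : ‖a - b‖ ^ (θ - 1) * ‖a - b‖ = ‖a - b‖ ^ θ := by
    rw [Real.rpow_sub_one hd.ne']; field_simp
  have h9 : ‖a‖ - ‖b‖ ≤ ‖a - b‖ := norm_sub_norm_le a b
  have hp : 0 ≤ ‖a‖ ^ (θ - 1) := by positivity
  calc ‖‖a‖ ^ (θ - 1) • a - ‖b‖ ^ (θ - 1) • b‖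
      ≤ ‖a‖ ^ (θ - 1) * ‖a - b‖ + (‖b‖ ^ (θ - 1) - ‖a‖ ^ (θ - 1)) * ‖b‖ := by
        rw [h1]
        refine (norm_sub_le _ _).trans_eq ?_
        rw [norm_smul, norm_smul, Real.norm_of_nonneg hp, Real.norm_of_nonneg (sub_nonneg.2 h2)]
    _ ≤ ‖a‖ ^ (θ - 1) * ‖a - b‖ + ‖a‖ ^ (θ - 1) * (‖a‖ - ‖b‖) := by
        rw [sub_mul, h4, mul_sub, h5]; linarith
    _ ≤ 2 * ‖a‖ ^ (θ - 1) * ‖a - b‖ := by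
        have := mul_le_mul_of_nonneg_left h9 hp
        linarith
    _ ≤ 2 * (2 * ‖a - b‖ ^ (θ - 1)) * ‖a - b‖ := by
        have := h6.trans h7
        gcongr
    _ = 4 * ‖a - b‖ ^ θ := by rw [← h8]; ring

/-- The subgradient inequality for `|·|^q`. -/
lemma rpow_norm_add_inner_le {q : ℝ} (hq : 1 < q) (a b : V) :
    ‖a‖ ^ q + q * ⟪‖a‖ ^ (q - 2) • a, b - a⟫ ≤ ‖b‖ ^ q := by
  rcases eq_or_ne a 0 with rfl | ha
  · simp only [norm_zero, smul_zero, inner_zero_left, mul_zero, add_zero]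
    rw [Real.zero_rpow (by linarith)]
    positivity
  have hA := norm_pos_iff.2 ha
  have hconj : (q.conjExponent).HolderConjugate q := (Real.HolderConjugate.conjExponent hq).symm
  -- After Cauchy–Schwarz the claim is `q ‖a‖^(q-1) ‖b‖ ≤ (q - 1) ‖a‖^q + ‖b‖^q`, which is Young's
  -- inequality with the exponents `q/(q-1)` and `q`.
  have hy := Real.young_inequality_of_nonneg (a := ‖a‖ ^ (q - 1)) (b := ‖b‖) (by positivity)
    (norm_nonneg _) hconj
  have h1 : (‖a‖ ^ (q - 1)) ^ q.conjExponent = ‖a‖ ^ q := by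
    rw [← Real.rpow_mul hA.le, Real.conjExponent]
    congr 1
    have : q - 1 ≠ 0 := by linarith
    field_simp
  have h2 : ‖a‖ ^ (q - 2) * ‖a‖ ^ 2 = ‖a‖ ^ q := by
    rw [← Real.rpow_natCast, ← Real.rpow_add hA]
    congr 1
    push_cast
    ring
  have h3 : ‖a‖ ^ (q - 2) * ‖a‖ = ‖a‖ ^ (q - 1) := by
    nth_rewrite 2 [← Real.rpow_one ‖a‖]
    rw [← Real.rpow_add hA]
    congr 1
    ring
  have h4 : ‖a‖ ^ (q - 2) * ⟪a, b⟫ ≤ ‖a‖ ^ (q - 1) * ‖b‖ := by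
    rw [← h3, mul_assoc]
    exact mul_le_mul_of_nonneg_left (real_inner_le_norm a b) (by positivity)
  rw [h1, Real.conjExponent] at hy
  have h5 : ‖a‖ ^ (q - 1) * ‖b‖ * q ≤ (q - 1) * ‖a‖ ^ q + ‖b‖ ^ q := by
    have h6 : q - 1 ≠ 0 := by linarith
    have h7 : (‖a‖ ^ q / (q / (q - 1)) + ‖b‖ ^ q / q) * q = (q - 1) * ‖a‖ ^ q + ‖b‖ ^ q := by
      field_simp
    rw [← h7]
    exact mul_le_mul_of_nonneg_right hy (by linarith)
  rw [real_inner_smul_left, inner_sub_right, real_inner_self_eq_norm_sq, mul_sub, h2]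
  nlinarith

/-- Convexity replaces differentiation. The subgradient inequality at `a` shows that the remainder
is nonnegative; the one at `a + h` bounds it by `q` times the increment of `|·|^{q-2}(·)` paired
with `h`, and Hölder continuity of exponent `q - 1` bounds that increment. -/
lemma abs_rpow_norm_sub_le {q : ℝ} (hq : 1 < q) (hq2 : q < 2) (a h : V) :
    |‖a + h‖ ^ q - ‖a‖ ^ q - q * ⟪‖a‖ ^ (q - 2) • a, h⟫| ≤ 4 * q * ‖h‖ ^ q := by
  have h1 := rpow_norm_add_inner_le hq a (a + h)
  have h2 := rpow_norm_add_inner_le hq (a + h) a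
  have h3 := norm_rpow_smul_sub_le (θ := q - 1) (by linarith) (by linarith) (a + h) a
  rw [add_sub_cancel_left] at h1 h3
  rw [show a - (a + h) = -h by abel, inner_neg_right] at h2
  rw [show q - 1 - 1 = q - 2 by ring] at h3
  have h4 : ⟪‖a + h‖ ^ (q - 2) • (a + h), h⟫ - ⟪‖a‖ ^ (q - 2) • a, h⟫ ≤ 4 * ‖h‖ ^ q := by
    rw [← inner_sub_left]
    refine (real_inner_le_norm _ _).trans ?_
    calc _ ≤ 4 * ‖h‖ ^ (q - 1) * ‖h‖ := by gcongr
      _ = 4 * ‖h‖ ^ q := by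
        rcases eq_or_ne h 0 with rfl | hh
        · simp [Real.zero_rpow (by linarith : q ≠ 0)]
        · rw [Real.rpow_sub_one (norm_pos_iff.2 hh).ne']
          have := (norm_pos_iff.2 hh).ne'
          field_simp
  rw [abs_of_nonneg (by linarith)]
  nlinarith

end Pointwise

section LpMaps

variable {α V W : Type*} [MeasurableSpace α] {μ : Measure α} [NormedAddCommGroup V]
  [NormedAddCommGroup W]

lemma memLp_of_norm_le_rpow {θ : ℝ} (hθ : 0 < θ) (h : Lp V 2 μ) {g : α → W}
    (hg : AEStronglyMeasurable g μ) {C : ℝ} (hle : ∀ᵐ x ∂μ, ‖g x‖ ≤ C * ‖h x‖ ^ θ) :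
    MemLp g (ENNReal.ofReal (2 / θ)) μ := by
  have h1 : MemLp (fun x => ‖h x‖ ^ θ) (ENNReal.ofReal (2 / θ)) μ := by
    refine ⟨((Lp.aestronglyMeasurable h).norm.aemeasurable.pow_const θ).aestronglyMeasurable, ?_⟩
    rw [eLpNorm_norm_rpow _ hθ, ← ENNReal.ofReal_mul (by positivity)]
    refine ENNReal.rpow_lt_top_of_nonneg hθ.le ?_
    have : ENNReal.ofReal (2 / θ * θ) = 2 := by
      rw [div_mul_cancel₀ _ hθ.ne']; simp
    rw [this]
    exact Lp.eLpNorm_ne_top h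
  refine (h1.const_mul C).mono hg ?_
  filter_upwards [hle] with x hx
  exact hx.trans (le_abs_self _)

/-- Since `|h|^θ` has `L^{2/θ}` norm exactly `‖h‖^θ`, pointwise power bounds pass to norms. With `θ
= q` this gives the Taylor remainder, with `θ = q - 1` the continuity of the derivative. -/
lemma norm_Lp_le_rpow {θ : ℝ} (hθ : 0 < θ) (h : Lp V 2 μ) (G : Lp W (ENNReal.ofReal (2 / θ)) μ)
    {C : ℝ} (hle : ∀ᵐ x ∂μ, ‖G x‖ ≤ C * ‖h x‖ ^ θ) : ‖G‖ ≤ C * ‖h‖ ^ θ := by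
  have hp : ENNReal.ofReal (2 / θ * θ) = 2 := by
    rw [div_mul_cancel₀ _ hθ.ne']; simp
  have hpow := memLp_of_norm_le_rpow hθ h (C := 1) (g := fun x => ‖h x‖ ^ θ)
    ((Lp.aestronglyMeasurable h).norm.aemeasurable.pow_const θ).aestronglyMeasurable
    (Eventually.of_forall fun x => by
      rw [one_mul, Real.norm_of_nonneg (by positivity)])
  have h1 : ‖G‖ ≤ C * ‖hpow.toLp _‖ := by
    refine Lp.norm_le_mul_norm_of_ae_le_mul ?_
    filter_upwards [hle, hpow.coeFn_toLp] with x hx hx'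
    rw [hx', Real.norm_of_nonneg (by positivity)]
    exact hx
  have h2 : ‖hpow.toLp _‖ = ‖h‖ ^ θ := by
    rw [Lp.norm_toLp, eLpNorm_norm_rpow _ hθ, ← ENNReal.ofReal_mul (by positivity), hp,
      ← ENNReal.toReal_rpow, Lp.norm_def]
  rwa [h2] at h1

lemma memLp_rpow {q : ℝ} (hq : 1 < q) (g : Lp V 2 μ) :
    MemLp (fun x => ‖g x‖ ^ q) (ENNReal.ofReal (2 / q)) μ := by
  refine memLp_of_norm_le_rpow (by linarith) g (C := 1)
    ((Lp.aestronglyMeasurable g).norm.aemeasurable.pow_const _).aestronglyMeasurable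
    (Eventually.of_forall fun x => ?_)
  rw [one_mul, Real.norm_of_nonneg (by positivity)]

/-- The Nemytskii operator `g ↦ |g|^q` from `L²` to `L^{2/q}`. -/
def powOp {q : ℝ} (hq : 1 < q) (g : Lp V 2 μ) : Lp ℝ (ENNReal.ofReal (2 / q)) μ :=
  (memLp_rpow hq g).toLp

lemma norm_powOp_le {q : ℝ} (hq : 1 < q) (g : Lp V 2 μ) : ‖powOp hq g‖ ≤ ‖g‖ ^ q := by
  rw [← one_mul (‖g‖ ^ q)]
  refine norm_Lp_le_rpow (by linarith) g _ ?_
  filter_upwards [(memLp_rpow hq g).coeFn_toLp] with x hx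
  rw [powOp, hx, one_mul, Real.norm_of_nonneg (by positivity)]

variable [InnerProductSpace ℝ V]

lemma memLp_rpow_smul {q : ℝ} (hq : 1 < q) (g : Lp V 2 μ) :
    MemLp (fun x => ‖g x‖ ^ (q - 2) • g x) (ENNReal.ofReal (2 / (q - 1))) μ := by
  refine memLp_of_norm_le_rpow (by linarith) g (C := 1) ?_ (Eventually.of_forall fun x => ?_)
  · exact ((Lp.aestronglyMeasurable g).norm.aemeasurable.pow_const _).aestronglyMeasurable.smul
      (Lp.aestronglyMeasurable g)
  · rw [one_mul, ← norm_rpow_sub_one_smul (θ := q - 1) (by linarith),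
      show q - 1 - 1 = q - 2 by ring]

/-- The operator `g ↦ |g|^{q-2} g` from `L²` to `L^{2/(q-1)}`. -/
def powSmulOp {q : ℝ} (hq : 1 < q) (g : Lp V 2 μ) : Lp V (ENNReal.ofReal (2 / (q - 1))) μ :=
  (memLp_rpow_smul hq g).toLp

lemma norm_powSmulOp_le {q : ℝ} (hq : 1 < q) (g : Lp V 2 μ) :
    ‖powSmulOp hq g‖ ≤ ‖g‖ ^ (q - 1) := by
  rw [← one_mul (‖g‖ ^ (q - 1))]
  refine norm_Lp_le_rpow (by linarith) g _ ?_
  filter_upwards [(memLp_rpow_smul hq g).coeFn_toLp] with x hx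
  rw [powSmulOp, hx, one_mul, ← norm_rpow_sub_one_smul (θ := q - 1) (by linarith),
    show q - 1 - 1 = q - 2 by ring]

lemma norm_powSmulOp_sub_le {q : ℝ} (hq : 1 < q) (hq2 : q < 2) (g h : Lp V 2 μ) :
    ‖powSmulOp hq g - powSmulOp hq h‖ ≤ 4 * ‖g - h‖ ^ (q - 1) := by
  refine norm_Lp_le_rpow (by linarith) (g - h) _ ?_
  filter_upwards [(memLp_rpow_smul hq g).coeFn_toLp, (memLp_rpow_smul hq h).coeFn_toLp,
    Lp.coeFn_sub g h, Lp.coeFn_sub (powSmulOp hq g) (powSmulOp hq h)] with x h1 h2 h3 h4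
  rw [h4, h3, Pi.sub_apply, Pi.sub_apply, powSmulOp, powSmulOp, h1, h2]
  have := norm_rpow_smul_sub_le (θ := q - 1) (by linarith) (by linarith) (g x) (h x)
  rwa [show q - 1 - 1 = q - 2 by ring] at this

lemma continuous_powSmulOp {q : ℝ} (hq : 1 < q) (hq2 : q < 2)
    [Fact (1 ≤ ENNReal.ofReal (2 / (q - 1)))] :
    Continuous (powSmulOp hq : Lp V 2 μ → Lp V (ENNReal.ofReal (2 / (q - 1))) μ) := by
  refine continuous_iff_continuousAt.2 fun h => ?_
  rw [ContinuousAt, tendsto_iff_norm_sub_tendsto_zero]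
  refine squeeze_zero (fun _ => norm_nonneg _) (fun g => norm_powSmulOp_sub_le hq hq2 g h) ?_
  have h1 : Continuous fun g : Lp V 2 μ => 4 * ‖g - h‖ ^ (q - 1) :=
    continuous_const.mul ((continuous_id.sub continuous_const).norm.rpow_const
      fun _ => Or.inr (by linarith))
  have h2 := h1.tendsto h
  simpa [Real.zero_rpow (by linarith : q - 1 ≠ 0)] using h2

lemma holderTriple_pow {q : ℝ} (hq : 1 < q) :
    ENNReal.HolderTriple (ENNReal.ofReal (2 / (q - 1))) 2 (ENNReal.ofReal (2 / q)) := by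
  constructor
  have h1 : 0 < q - 1 := by linarith
  have h2 : 0 < q := by linarith
  have h3 : (2 : ℝ≥0∞) = ENNReal.ofReal 2 := by simp
  rw [h3, ← ENNReal.ofReal_inv_of_pos (by positivity), ← ENNReal.ofReal_inv_of_pos (by positivity),
    ← ENNReal.ofReal_inv_of_pos (by positivity), ← ENNReal.ofReal_add (by positivity) (by positivity)]
  congr 1
  field_simp
  ring

lemma one_le_ofReal_two_div {q : ℝ} (hq : 0 < q) (hq2 : q ≤ 2) :
    1 ≤ ENNReal.ofReal (2 / q) := by
  rw [← ENNReal.ofReal_one]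
  exact ENNReal.ofReal_le_ofReal ((one_le_div hq).2 hq2)

/-- The Nemytskii operator `g ↦ |g|^q` is of class `C¹`, with a derivative bounded on bounded
sets. -/
lemma exists_hasFDerivAt_powOp {q : ℝ} (hq : 1 < q) (hq2 : q < 2)
    [hp : Fact (1 ≤ ENNReal.ofReal (2 / q))] :
    ∃ D : Lp V 2 μ → Lp V 2 μ →L[ℝ] Lp ℝ (ENNReal.ofReal (2 / q)) μ, Continuous D ∧
      (∀ g, HasFDerivAt (powOp hq) (D g) g) ∧ ∀ g, ‖D g‖ ≤ q * ‖g‖ ^ (q - 1) := by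
  have hs : Fact (1 ≤ ENNReal.ofReal (2 / (q - 1))) :=
    ⟨one_le_ofReal_two_div (by linarith) (by linarith)⟩
  -- The derivative at `g` is `h ↦ q ⟨|g|^{q-2} g, h⟩`, a Hölder pairing of `L^{2/(q-1)}` with `L²`
  -- into `L^{2/q}`, since `(q-1)/2 + 1/2 = q/2`.
  have hH := holderTriple_pow hq
  let B : V →L[ℝ] V →L[ℝ] ℝ := innerSL ℝ
  have hB : ‖B‖ ≤ 1 := norm_innerSL_le ℝ
  let H := B.holderL μ (ENNReal.ofReal (2 / (q - 1))) 2 (ENNReal.ofReal (2 / q))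
  refine ⟨fun g => q • H (powSmulOp hq g),
    (H.continuous.comp (continuous_powSmulOp hq hq2)).const_smul q, fun g => ?_, fun g => ?_⟩
  · have hrem : ∀ h : Lp V 2 μ,
        ‖powOp hq (g + h) - powOp hq g - (q • H (powSmulOp hq g)) h‖ ≤ 4 * q * ‖h‖ ^ q := by
      intro h
      refine norm_Lp_le_rpow (by linarith) h _ ?_
      have hd : (q • H (powSmulOp hq g)) h = q • B.holder _ (powSmulOp hq g) h := rfl
      rw [hd]
      filter_upwards [(memLp_rpow_smul hq g).coeFn_toLp, (memLp_rpow hq g).coeFn_toLp,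
        (memLp_rpow hq (g + h)).coeFn_toLp, Lp.coeFn_add g h,
        Lp.coeFn_sub (powOp hq (g + h) - powOp hq g) (q • B.holder _ (powSmulOp hq g) h),
        Lp.coeFn_sub (powOp hq (g + h)) (powOp hq g),
        Lp.coeFn_smul q (B.holder (ENNReal.ofReal (2 / q)) (powSmulOp hq g) h),
        B.coeFn_holder (r := ENNReal.ofReal (2 / q)) (powSmulOp hq g) h]
        with x h1 h2 h3 h4 h5 h6 h7 h8
      rw [h5, Pi.sub_apply, h6, h7, Pi.sub_apply, Pi.smul_apply, h8]
      simp only [powOp, powSmulOp]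
      rw [h1, h2, h3, h4, Pi.add_apply, Real.norm_eq_abs]
      exact abs_rpow_norm_sub_le hq hq2 (g x) (h x)
    rw [hasFDerivAt_iff_isLittleO_nhds_zero, Asymptotics.isLittleO_iff]
    intro ε hε
    have hc : Continuous fun h : Lp V 2 μ => 4 * q * ‖h‖ ^ (q - 1) :=
      continuous_const.mul (continuous_norm.rpow_const fun _ => Or.inr (by linarith))
    have hev : ∀ᶠ h : Lp V 2 μ in 𝓝 0, 4 * q * ‖h‖ ^ (q - 1) < ε := by
      refine (hc.tendsto 0).eventually (gt_mem_nhds ?_)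
      simpa [Real.zero_rpow (by linarith : q - 1 ≠ 0)] using hε
    filter_upwards [hev] with h hh
    refine (hrem h).trans ?_
    have h2 : 4 * q * ‖h‖ ^ q = 4 * q * ‖h‖ ^ (q - 1) * ‖h‖ := by
      rcases eq_or_ne h 0 with rfl | hh
      · simp [Real.zero_rpow (by linarith : q ≠ 0)]
      · rw [Real.rpow_sub_one (norm_pos_iff.2 hh).ne']
        have := (norm_pos_iff.2 hh).ne'
        field_simp
    rw [h2]
    exact mul_le_mul_of_nonneg_right hh.le (norm_nonneg _)
  · have hq0 : 0 ≤ q := by linarith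
    refine ContinuousLinearMap.opNorm_le_bound _ (by positivity) fun h => ?_
    change ‖q • B.holder (ENNReal.ofReal (2 / q)) (powSmulOp hq g) h‖ ≤ _
    rw [norm_smul, Real.norm_of_nonneg hq0, mul_assoc]
    refine mul_le_mul_of_nonneg_left ?_ hq0
    refine (B.norm_holder_apply_apply_le (r := ENNReal.ofReal (2 / q)) _ h).trans ?_
    refine mul_le_mul_of_nonneg_right ?_ (norm_nonneg h)
    calc ‖B‖ * ‖powSmulOp hq g‖ ≤ 1 * ‖g‖ ^ (q - 1) :=
          mul_le_mul hB (norm_powSmulOp_le hq g) (norm_nonneg _) zero_le_one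
      _ = ‖g‖ ^ (q - 1) := one_mul _

end LpMaps

section Truncation

/-- As `χ = 1` on `[0, 1]`, continuing it by the constant `1` to the left stays smooth. This yields
a function smooth on all of `ℝ`, to which the chain rule applies at `x = 0` as well. -/
lemma IsCutoff.exists_smooth {χ : ℝ → ℝ} (hχ : IsCutoff χ) :
    ∃ χ' : ℝ → ℝ, ContDiff ℝ ∞ χ' ∧ ∀ r, 0 ≤ r → χ' r = χ r := by
  refine ⟨fun r => if r < 1 then 1 else χ r, ?_, fun r hr => ?_⟩
  · refine contDiff_iff_contDiffAt.2 fun r => ?_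
    rcases lt_or_ge r 1 with h | h
    · refine (contDiffAt_const (c := (1 : ℝ))).congr_of_eventuallyEq ?_
      filter_upwards [gt_mem_nhds h] with s hs
      rw [if_pos hs]
    · have h0 : (0 : ℝ) < r := by linarith
      refine (hχ.smooth.contDiffAt (Ici_mem_nhds h0)).congr_of_eventuallyEq ?_
      filter_upwards [lt_mem_nhds h0] with s hs
      split_ifs with hs1
      · exact (hχ.eq_one s hs.le hs1.le).symm
      · rfl
  · simp only
    split_ifs with h
    · exact (hχ.eq_one r hr h.le).symm
    · rfl

/-- Truncating a `C¹` map makes it globally Lipschitz. -/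
lemma contDiff_lipschitz_truncation {X Y : Type*} [NormedAddCommGroup X] [InnerProductSpace ℝ X]
    [NormedAddCommGroup Y] [NormedSpace ℝ Y] {χ : ℝ → ℝ} (hχ : IsCutoff χ) {ρ : ℝ} (hρ : 0 < ρ)
    {P : X → Y} {D : X → X →L[ℝ] Y} (hD : Continuous D) (hP : ∀ x, HasFDerivAt P (D x) x)
    {M : ℝ} (hPM : ∀ x, ‖x‖ ≤ 2 * ρ → ‖P x‖ ≤ M) (hDM : ∀ x, ‖x‖ ≤ 2 * ρ → ‖D x‖ ≤ M) :
    ContDiff ℝ 1 (fun x => χ (‖x‖ ^ 2 / ρ ^ 2) • P x) ∧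
      ∃ L : ℝ≥0, LipschitzWith L (fun x => χ (‖x‖ ^ 2 / ρ ^ 2) • P x) := by
  obtain ⟨χ', hχ's, hχ'⟩ := hχ.exists_smooth
  have heq : (fun x : X => χ (‖x‖ ^ 2 / ρ ^ 2) • P x)
      = fun x => χ' (‖x‖ ^ 2 / ρ ^ 2) • P x := by
    ext x
    rw [hχ' _ (by positivity)]
  have hPc : ContDiff ℝ 1 P := contDiff_one_iff_hasFDerivAt.2 ⟨D, hD, hP⟩
  have hc : ContDiff ℝ 1 fun x : X => χ' (‖x‖ ^ 2 / ρ ^ 2) :=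
    (hχ's.of_le (by simp)).comp ((contDiff_norm_sq ℝ).div_const _)
  have hcd : ContDiff ℝ 1 fun x : X => χ' (‖x‖ ^ 2 / ρ ^ 2) • P x := hc.smul hPc
  rw [heq]
  refine ⟨hcd, ?_⟩
  obtain ⟨C, hC⟩ := (isCompact_Icc (a := (0 : ℝ)) (b := 4)).exists_bound_of_continuousOn
    (hχ's.continuous_deriv (by simp)).continuousOn
  have hM0 : 0 ≤ M := (norm_nonneg _).trans (hPM 0 (by simpa using hρ.le))
  have hC0 : 0 ≤ C := (norm_nonneg _).trans (hC 0 (by simp))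
  -- For `‖x‖ ≤ 2ρ` this is the product rule, with `C` bounding the derivative of the cut-off on
  -- `[0, 4]` and `2(2ρ)/ρ²` that of `‖x‖²/ρ²`. For `‖x‖ > 2ρ` the map vanishes near `x`.
  have hbound : ∀ x : X, ‖fderiv ℝ (fun x : X => χ' (‖x‖ ^ 2 / ρ ^ 2) • P x) x‖
      ≤ M + C * (2 * (2 * ρ) / ρ ^ 2) * M := by
    intro x
    rcases le_or_gt ‖x‖ (2 * ρ) with hx | hx
    · have hr0 : 0 ≤ ‖x‖ ^ 2 / ρ ^ 2 := by positivity
      have hr4 : ‖x‖ ^ 2 / ρ ^ 2 ≤ 4 := by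
        rw [div_le_iff₀ (by positivity)]
        nlinarith [norm_nonneg x]
      have h1 : HasFDerivAt (fun x : X => ‖x‖ ^ 2 / ρ ^ 2)
          ((ρ ^ 2)⁻¹ • ((2 : ℝ) • innerSL ℝ x)) x := by
        have h0 := (hasStrictFDerivAt_norm_sq x).hasFDerivAt.mul_const ((ρ ^ 2)⁻¹)
        rw [ofNat_smul_eq_nsmul ℝ 2]
        simpa [div_eq_mul_inv] using h0
      have h2 := ((hχ's.differentiable (by simp)) (‖x‖ ^ 2 / ρ ^ 2)).hasDerivAt.comp_hasFDerivAt x h1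
      have h3 := h2.smul (hP x)
      have h4 : HasFDerivAt (fun x : X => χ' (‖x‖ ^ 2 / ρ ^ 2) • P x) _ x := h3
      rw [h4.fderiv]
      refine (norm_add_le _ _).trans (add_le_add ?_ ?_)
      · rw [norm_smul]
        have h5 : ‖χ' (‖x‖ ^ 2 / ρ ^ 2)‖ ≤ 1 := by
          rw [hχ' _ hr0, Real.norm_of_nonneg (hχ.nonneg _ hr0)]
          exact hχ.le_one _ hr0
        calc _ ≤ 1 * M := mul_le_mul h5 (hDM x hx) (norm_nonneg _) zero_le_one
          _ = M := one_mul M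
      · rw [ContinuousLinearMap.norm_smulRight_apply]
        refine mul_le_mul ?_ (hPM x hx) (norm_nonneg _) (by positivity)
        rw [norm_smul]
        refine mul_le_mul (hC _ ⟨hr0, hr4⟩) ?_ (norm_nonneg _) hC0
        rw [norm_smul, norm_smul, innerSL_apply_norm, norm_inv, norm_pow,
          Real.norm_of_nonneg hρ.le, Real.norm_of_nonneg (by norm_num : (0 : ℝ) ≤ 2),
          div_eq_inv_mul]
        gcongr
    · have h1 : (fun x : X => χ' (‖x‖ ^ 2 / ρ ^ 2) • P x) =ᶠ[𝓝 x] fun _ => 0 := by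
        filter_upwards [(continuous_norm.tendsto x).eventually (lt_mem_nhds hx)] with y hy
        rw [hχ' _ (by positivity), hχ.eq_zero, zero_smul]
        rw [le_div_iff₀ (by positivity)]
        nlinarith
      rw [h1.fderiv_eq, fderiv_fun_const]
      simp only [Pi.zero_apply, norm_zero]
      positivity
  refine ⟨⟨M + C * (2 * (2 * ρ) / ρ ^ 2) * M, by positivity⟩, ?_⟩
  exact lipschitzWith_of_nnnorm_fderiv_le (hcd.differentiable (by simp)) hbound

end Truncation

end Nemytskii

/-! ### The weight and the embedding into integrable functions -/

section Weight

open Set Filter Topology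

variable {N : ℕ} {m : ℝ}

lemma weight_mono (hm : 0 < m) {x y : E N} (h : ‖x‖ ≤ ‖y‖) : weight N m x ≤ weight N m y := by
  unfold weight
  gcongr

/-- Submultiplicativity up to a constant: it bounds translations on the weighted spaces, and in
convolution estimates it distributes the weight over kernel and function. -/
lemma weight_add_le (hm : 0 < m) (x y : E N) :
    weight N m (x + y) ≤ 2 ^ (2 * m) * (weight N m x * weight N m y) := by
  have h1 : ‖x + y‖ ^ (2 * m) ≤ 2 ^ (2 * m) * (‖x‖ ^ (2 * m) + ‖y‖ ^ (2 * m)) := by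
    have h2 : ‖x + y‖ ≤ 2 * max ‖x‖ ‖y‖ := by
      have := norm_add_le x y
      have := le_max_left ‖x‖ ‖y‖
      have := le_max_right ‖x‖ ‖y‖
      linarith
    have h3 : (max ‖x‖ ‖y‖) ^ (2 * m) ≤ ‖x‖ ^ (2 * m) + ‖y‖ ^ (2 * m) := by
      have hx : 0 ≤ ‖x‖ ^ (2 * m) := by positivity
      have hy : 0 ≤ ‖y‖ ^ (2 * m) := by positivity
      rcases max_cases ‖x‖ ‖y‖ with h | h <;> rw [h.1] <;> linarith
    calc ‖x + y‖ ^ (2 * m) ≤ (2 * max ‖x‖ ‖y‖) ^ (2 * m) := by gcongr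
      _ = 2 ^ (2 * m) * (max ‖x‖ ‖y‖) ^ (2 * m) :=
          Real.mul_rpow (by norm_num) (le_max_of_le_left (norm_nonneg _))
      _ ≤ _ := by gcongr
  have h4 : (1 : ℝ) ≤ 2 ^ (2 * m) := Real.one_le_rpow (by norm_num) (by linarith)
  have h5 : 0 ≤ ‖x‖ ^ (2 * m) * ‖y‖ ^ (2 * m) := by positivity
  unfold weight
  nlinarith

lemma continuous_weight (hm : 0 < m) : Continuous (weight N m) := by
  unfold weight
  exact continuous_const.add (continuous_norm.rpow_const fun _ => Or.inr (by linarith))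

lemma volume_le_weightMeasure : (volume : Measure (E N)) ≤ weightMeasure N m := by
  unfold weightMeasure
  conv_lhs => rw [← withDensity_one (μ := (volume : Measure (E N)))]
  refine withDensity_mono (Eventually.of_forall fun ξ => ?_)
  simpa using one_le_weight N m ξ

lemma volume_ac_weightMeasure : (volume : Measure (E N)) ≪ weightMeasure N m :=
  Measure.absolutelyContinuous_of_le volume_le_weightMeasure

lemma weightMeasure_ac_volume : weightMeasure N m ≪ (volume : Measure (E N)) :=
  withDensity_absolutelyContinuous _ _

lemma lintegral_weightMeasure (f : E N → ℝ≥0∞) :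
    ∫⁻ ξ, f ξ ∂weightMeasure N m = ∫⁻ ξ, ENNReal.ofReal (weight N m ξ) * f ξ := by
  rw [weightMeasure, lintegral_withDensity_eq_lintegral_mul_non_measurable _
    (measurable_weight N m).ennreal_ofReal (by simp)]
  rfl

/-- The quantitative use of `m > N/2`: the decay `|ξ|^{-2m}` is integrable at infinity exactly
because `2m > N`. -/
lemma integrable_inv_weight (hm : (N : ℝ) / 2 < m) :
    Integrable (fun ξ : E N => (weight N m ξ)⁻¹) := by
  have hm0 : 0 < m := lt_of_le_of_lt (by positivity) hm
  have h1 : Integrable (fun ξ : E N => 2 ^ (2 * m) * (1 + ‖ξ‖) ^ (-(2 * m))) := by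
    refine (integrable_one_add_norm ?_).const_mul _
    rw [finrank_euclideanSpace, Fintype.card_fin]
    linarith
  refine h1.mono' (measurable_weight N m).inv.aestronglyMeasurable (Eventually.of_forall fun ξ => ?_)
  have hw := weight_pos N m ξ
  rw [Real.norm_of_nonneg (by positivity), inv_le_iff_one_le_mul₀ hw,
    Real.rpow_neg (by positivity)]
  have h2 : (1 + ‖ξ‖) ^ (2 * m) ≤ 2 ^ (2 * m) * weight N m ξ := by
    have h3 : 1 + ‖ξ‖ ≤ 2 * max 1 ‖ξ‖ := by
      have := le_max_left 1 ‖ξ‖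
      have := le_max_right 1 ‖ξ‖
      linarith
    have h4 : (max 1 ‖ξ‖) ^ (2 * m) ≤ weight N m ξ := by
      unfold weight
      have hx : 0 ≤ ‖ξ‖ ^ (2 * m) := by positivity
      rcases max_cases 1 ‖ξ‖ with h | h <;> rw [h.1]
      · rw [Real.one_rpow]; linarith
      · linarith
    calc (1 + ‖ξ‖) ^ (2 * m) ≤ (2 * max 1 ‖ξ‖) ^ (2 * m) := by gcongr
      _ = 2 ^ (2 * m) * (max 1 ‖ξ‖) ^ (2 * m) :=
          Real.mul_rpow (by norm_num) (le_max_of_le_left zero_le_one)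
      _ ≤ _ := by gcongr
  have h5 : (0 : ℝ) < (1 + ‖ξ‖) ^ (2 * m) := by positivity
  rw [mul_comm _ ((1 + ‖ξ‖) ^ (2 * m))⁻¹, mul_assoc, ← div_eq_inv_mul, one_le_div h5]
  exact h2

/-- Functions in the weighted spaces are integrable. -/
lemma integrable_of_memLp_weightMeasure {F : Type*} [NormedAddCommGroup F]
    (hm : (N : ℝ) / 2 < m) {p : ℝ} (hp1 : 1 ≤ p) (hp2 : p ≤ 2) {f : E N → F}
    (hf : MemLp f (ENNReal.ofReal p) (weightMeasure N m)) : Integrable f := by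
  have hp0 : 0 < p := by linarith
  have h1 : Integrable (fun ξ => ‖f ξ‖ ^ p) (weightMeasure N m) := by
    have := hf.integrable_norm_rpow (by simpa using hp0) (by simp)
    rwa [ENNReal.toReal_ofReal hp0.le] at this
  rw [weightMeasure, integrable_withDensity_iff_integrable_smul'
    (measurable_weight N m).ennreal_ofReal (by simp)] at h1
  refine (h1.add (integrable_inv_weight hm)).mono' (hf.1.mono_ac volume_ac_weightMeasure)
    (Eventually.of_forall fun ξ => ?_)
  have hw := weight_pos N m ξ
  have hw1 := one_le_weight N m ξ
  rw [Pi.add_apply, ENNReal.toReal_ofReal hw.le, smul_eq_mul]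
  -- With `w` the weight, either `|f| ≤ 1/w`, or `|f|^{1-p} ≤ w^{p-1} ≤ w` because `1 ≤ p ≤ 2`.
  -- Hence `|f| ≤ w |f|^p + 1/w` in both cases.
  rcases le_or_gt ‖f ξ‖ (weight N m ξ)⁻¹ with h | h
  · have : 0 ≤ weight N m ξ * ‖f ξ‖ ^ p := by positivity
    linarith
  · have hf0 : 0 < ‖f ξ‖ := lt_trans (by positivity) h
    have h2 : ‖f ξ‖ ^ (1 - p) ≤ weight N m ξ := by
      calc ‖f ξ‖ ^ (1 - p) ≤ ((weight N m ξ)⁻¹) ^ (1 - p) :=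
            Real.rpow_le_rpow_of_nonpos (by positivity) h.le (by linarith)
        _ = weight N m ξ ^ (p - 1) := by
            rw [Real.inv_rpow hw.le, ← Real.rpow_neg hw.le]; ring_nf
        _ ≤ weight N m ξ ^ (1 : ℝ) := Real.rpow_le_rpow_of_exponent_le hw1 (by linarith)
        _ = _ := Real.rpow_one _
    have h3 : ‖f ξ‖ = ‖f ξ‖ ^ (1 - p) * ‖f ξ‖ ^ p := by
      rw [← Real.rpow_add hf0]; simp
    have h4 : ‖f ξ‖ ^ (1 - p) * ‖f ξ‖ ^ p ≤ weight N m ξ * ‖f ξ‖ ^ p := by gcongr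
    have h5 : 0 < (weight N m ξ)⁻¹ := by positivity
    linarith

lemma integrable_L2m {F : Type} [NormedAddCommGroup F] (hm : (N : ℝ) / 2 < m) (f : L2m N m F) :
    Integrable (f : E N → F) := by
  refine integrable_of_memLp_weightMeasure (p := 2) hm (by norm_num) le_rfl ?_
  simpa using Lp.memLp f

end Weight

/-! ### Dilations and translations on the weighted `L²` space -/

section Dilation

open Set Filter Topology

variable {N : ℕ} {m : ℝ} {F : Type} [NormedAddCommGroup F]

/-- The affine map `ξ ↦ β (ξ - y)`, with the dilation factor forced to be at least `1`. -/
def affMap (β : ℝ) (y ξ : E N) : E N := max β 1 • (ξ - y)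

lemma continuous_affMap (β : ℝ) (y : E N) : Continuous (affMap β y) := by
  unfold affMap; fun_prop

lemma max_one_pos (β : ℝ) : 0 < max β 1 := lt_max_of_lt_right one_pos

lemma map_affMap_volume (β : ℝ) (y : E N) :
    Measure.map (affMap β y) volume = ENNReal.ofReal ((max β 1 ^ N)⁻¹) • volume := by
  have h1 : affMap β y = (fun ξ => max β 1 • ξ) ∘ fun ξ => ξ - y := rfl
  have hpos := max_one_pos β
  rw [h1, ← Measure.map_map (by fun_prop) (by fun_prop),
    (measurePreserving_sub_right volume y).map_eq, Measure.map_addHaar_smul _ hpos.ne',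
    finrank_euclideanSpace, Fintype.card_fin, abs_of_pos (by positivity)]

lemma integral_comp_affMap {G : Type*} [NormedAddCommGroup G] [NormedSpace ℝ G] (β : ℝ) (y : E N)
    (f : E N → G) : ∫ ξ, f (affMap β y ξ) = (max β 1 ^ N)⁻¹ • ∫ ξ, f ξ := by
  have hpos := max_one_pos β
  have := integral_sub_right_eq_self (μ := (volume : Measure (E N)))
    (fun ξ => f (max β 1 • ξ)) y
  unfold affMap
  rw [this, Measure.integral_comp_smul, finrank_euclideanSpace, Fintype.card_fin,
    abs_of_pos (by positivity)]

/-- Translation costs `2^{2m} w(y)`, with `w` the weight. Dilation by a factor at least `1` costs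
nothing: it only increases the weight evaluated at the image point, and its Jacobian factor is at
most `1`. This is why the factor is `max β 1`. -/
lemma map_affMap_weightMeasure_le (hm : 0 < m) (β : ℝ) (y : E N) :
    Measure.map (affMap β y) (weightMeasure N m)
      ≤ ENNReal.ofReal (2 ^ (2 * m) * weight N m y) • weightMeasure N m := by
  have hA := (continuous_affMap β y).measurable
  have hpos := max_one_pos β
  refine Measure.le_iff.2 fun s hs => ?_
  rw [Measure.map_apply hA hs, Measure.smul_apply, smul_eq_mul,
    ← lintegral_indicator_one hs, ← lintegral_indicator_one (hA hs), lintegral_weightMeasure,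
    lintegral_weightMeasure, ← lintegral_const_mul]
  swap
  · exact (measurable_weight N m).ennreal_ofReal.mul (measurable_one.indicator hs)
  calc ∫⁻ ξ, ENNReal.ofReal (weight N m ξ) * (affMap β y ⁻¹' s).indicator 1 ξ
      ≤ ∫⁻ ξ, (fun η => ENNReal.ofReal (2 ^ (2 * m) * weight N m y) *
          (ENNReal.ofReal (weight N m η) * s.indicator 1 η)) (affMap β y ξ) := by
        refine lintegral_mono fun ξ => ?_
        have h1 : weight N m ξ ≤ 2 ^ (2 * m) * weight N m y * weight N m (affMap β y ξ) := by
          have h2 := weight_add_le (N := N) hm (ξ - y) y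
          rw [sub_add_cancel] at h2
          have h3 : weight N m (ξ - y) ≤ weight N m (affMap β y ξ) := by
            refine weight_mono hm ?_
            rw [affMap, norm_smul, Real.norm_of_nonneg hpos.le]
            exact le_mul_of_one_le_left (norm_nonneg _) (le_max_right _ _)
          have h4 := weight_pos N m y
          calc _ ≤ _ := h2
            _ ≤ 2 ^ (2 * m) * (weight N m (affMap β y ξ) * weight N m y) := by gcongr
            _ = _ := by ring
        beta_reduce
        rw [← mul_assoc, ← ENNReal.ofReal_mul (by have := weight_pos N m y; positivity)]
        exact mul_le_mul' (ENNReal.ofReal_le_ofReal h1) le_rfl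
    _ = ENNReal.ofReal ((max β 1 ^ N)⁻¹) * ∫⁻ η, ENNReal.ofReal (2 ^ (2 * m) * weight N m y) *
          (ENNReal.ofReal (weight N m η) * s.indicator 1 η) := by
        rw [← lintegral_map (μ := volume) (f := fun η =>
          ENNReal.ofReal (2 ^ (2 * m) * weight N m y) *
            (ENNReal.ofReal (weight N m η) * s.indicator 1 η)) _ hA, map_affMap_volume, lintegral_smul_measure,
          smul_eq_mul]
        exact ((measurable_weight N m).ennreal_ofReal.mul (measurable_one.indicator hs)).const_mul _
    _ ≤ _ := by
        refine mul_le_of_le_one_left' ?_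
        rw [ENNReal.ofReal_le_one]
        exact inv_le_one_of_one_le₀ (one_le_pow₀ (le_max_right _ _))

lemma quasiMeasurePreserving_affMap (hm : 0 < m) (β : ℝ) (y : E N) :
    Measure.QuasiMeasurePreserving (affMap β y) (weightMeasure N m) (weightMeasure N m) :=
  ⟨(continuous_affMap β y).measurable,
    Measure.absolutelyContinuous_of_le_smul (map_affMap_weightMeasure_le hm β y)⟩

lemma memLp_comp_affMap (hm : 0 < m) (β : ℝ) (y : E N) {f : E N → F}
    (hf : MemLp f 2 (weightMeasure N m)) :
    MemLp (fun ξ => f (affMap β y ξ)) 2 (weightMeasure N m) :=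
  (hf.of_measure_le_smul ENNReal.ofReal_ne_top (map_affMap_weightMeasure_le hm β y)).comp_of_map
    (continuous_affMap β y).measurable.aemeasurable

lemma eLpNorm_comp_affMap_le (hm : 0 < m) (β : ℝ) (y : E N) {f : E N → F}
    (hf : MemLp f 2 (weightMeasure N m)) :
    eLpNorm (fun ξ => f (affMap β y ξ)) 2 (weightMeasure N m)
      ≤ ENNReal.ofReal (√(2 ^ (2 * m) * weight N m y)) * eLpNorm f 2 (weightMeasure N m) := by
  have hle := map_affMap_weightMeasure_le hm β y
  have h1 := eLpNorm_le_of_measure_le_smul hle (f := f) (p := 2)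
  rw [eLpNorm_map_measure (hf.of_measure_le_smul ENNReal.ofReal_ne_top hle).1
    (continuous_affMap β y).measurable.aemeasurable] at h1
  refine h1.trans_eq ?_
  have h2 := weight_pos N m y
  rw [smul_eq_mul, Real.sqrt_eq_rpow, ← ENNReal.ofReal_rpow_of_pos (by positivity)]
  congr 2
  simp

/-- The function `f(β(· - y))` as an element of the weighted `L²` space. -/
def dilateFun (hm : 0 < m) (β : ℝ) (y : E N) (f : L2m N m F) : L2m N m F :=
  (memLp_comp_affMap hm β y (Lp.memLp f)).toLp

lemma dilateFun_coeFn (hm : 0 < m) (β : ℝ) (y : E N) (f : L2m N m F) :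
    dilateFun hm β y f =ᵐ[weightMeasure N m] fun ξ => f (affMap β y ξ) :=
  (memLp_comp_affMap hm β y (Lp.memLp f)).coeFn_toLp

lemma norm_dilateFun_le (hm : 0 < m) (β : ℝ) (y : E N) (f : L2m N m F) :
    ‖dilateFun hm β y f‖ ≤ √(2 ^ (2 * m) * weight N m y) * ‖f‖ := by
  have h1 := eLpNorm_comp_affMap_le hm β y (Lp.memLp f)
  rw [dilateFun, Lp.norm_toLp, Lp.norm_def, ← ENNReal.toReal_ofReal (Real.sqrt_nonneg _),
    ← ENNReal.toReal_mul]
  exact ENNReal.toReal_mono (ENNReal.mul_ne_top ENNReal.ofReal_ne_top (Lp.eLpNorm_ne_top f)) h1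

variable [NormedSpace ℝ F]

/-- The operator `f ↦ f(β(· - y))` on the weighted `L²` space. -/
def dilate (hm : 0 < m) (β : ℝ) (y : E N) : L2m N m F →L[ℝ] L2m N m F :=
  LinearMap.mkContinuous
    { toFun := dilateFun hm β y
      map_add' := fun f g => by
        refine Lp.ext ?_
        filter_upwards [dilateFun_coeFn hm β y (f + g), dilateFun_coeFn hm β y f,
          dilateFun_coeFn hm β y g, Lp.coeFn_add (dilateFun hm β y f) (dilateFun hm β y g),
          (quasiMeasurePreserving_affMap hm β y).ae (Lp.coeFn_add f g)] with ξ h1 h2 h3 h4 h5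
        rw [h1, h4, h5, Pi.add_apply, Pi.add_apply, h2, h3]
      map_smul' := fun c f => by
        refine Lp.ext ?_
        filter_upwards [dilateFun_coeFn hm β y (c • f), dilateFun_coeFn hm β y f,
          Lp.coeFn_smul c (dilateFun hm β y f),
          (quasiMeasurePreserving_affMap hm β y).ae (Lp.coeFn_smul c f)] with ξ h1 h2 h4 h5
        rw [RingHom.id_apply, h1, h4, h5, Pi.smul_apply, Pi.smul_apply, h2] }
    (√(2 ^ (2 * m) * weight N m y)) (norm_dilateFun_le hm β y)

lemma norm_dilate_apply_le (hm : 0 < m) (β : ℝ) (y : E N) (f : L2m N m F) :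
    ‖dilate hm β y f‖ ≤ √(2 ^ (2 * m) * weight N m y) * ‖f‖ :=
  norm_dilateFun_le hm β y f

lemma dilate_coeFn (hm : 0 < m) (β : ℝ) (y : E N) (f : L2m N m F) :
    dilate hm β y f =ᵐ[weightMeasure N m] fun ξ => f (affMap β y ξ) :=
  dilateFun_coeFn hm β y f

lemma isLocallyFinite_weightMeasure (hm : 0 < m) :
    IsLocallyFiniteMeasure (weightMeasure N m) :=
  IsLocallyFiniteMeasure.withDensity_ofReal (continuous_weight hm)

/-- On continuous functions with compact support, dilations and translations depend continuously
on the parameters. -/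
lemma continuous_dilate_of_hasCompactSupport (hm : 0 < m) {g : E N → F} (hg : Continuous g)
    (hgc : HasCompactSupport g) (hgL : MemLp g 2 (weightMeasure N m)) :
    Continuous fun p : ℝ × E N => dilate hm p.1 p.2 (hgL.toLp g) := by
  have := isLocallyFinite_weightMeasure (N := N) hm
  refine continuous_iff_continuousAt.2 fun p₀ => ?_
  rw [ContinuousAt, tendsto_iff_norm_sub_tendsto_zero]
  have hd : ∀ p : ℝ × E N, dilate hm p.1 p.2 (hgL.toLp g) =ᵐ[weightMeasure N m]
      fun ξ => g (affMap p.1 p.2 ξ) := fun p =>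
    (dilate_coeFn hm p.1 p.2 _).trans
      ((quasiMeasurePreserving_affMap hm p.1 p.2).ae_eq_comp hgL.coeFn_toLp)
  have hnorm : ∀ p : ℝ × E N, ‖dilate hm p.1 p.2 (hgL.toLp g) - dilate hm p₀.1 p₀.2 (hgL.toLp g)‖
      = ((∫⁻ ξ, ‖g (affMap p.1 p.2 ξ) - g (affMap p₀.1 p₀.2 ξ)‖ₑ ^ (2 : ℝ) ∂weightMeasure N m)
        ^ (1 / 2 : ℝ)).toReal := fun p => by
    rw [Lp.norm_def, eLpNorm_congr_ae ((Lp.coeFn_sub _ _).trans ((hd p).sub (hd p₀))),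
      eLpNorm_eq_lintegral_rpow_enorm_toReal (by norm_num) (by norm_num)]
    simp
  simp only [hnorm]
  obtain ⟨C, hC⟩ := hg.bounded_above_of_compact_support hgc
  have hC0 : 0 ≤ C := (norm_nonneg _).trans (hC 0)
  obtain ⟨R, hR0, hR⟩ : ∃ R > 0, ∀ ξ, R < ‖ξ‖ → g ξ = 0 := by
    obtain ⟨R, hR⟩ := hgc.isCompact.isBounded.exists_norm_le
    refine ⟨max R 1, lt_max_of_lt_right one_pos, fun ξ hξ => ?_⟩
    by_contra hne
    have := hR ξ (subset_tsupport g hne)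
    exact absurd ((le_max_left R 1).trans_lt hξ) (not_lt.2 this)
  -- As the dilation factor is at least `1`, supports only shrink before being translated; all of
  -- them lie in one ball, which carries the majorant for dominated convergence.
  have hzero : ∀ p : ℝ × E N, ‖p.2‖ ≤ ‖p₀.2‖ + 1 → ∀ ξ, R + (‖p₀.2‖ + 1) < ‖ξ‖ →
      g (affMap p.1 p.2 ξ) = 0 := fun p hp ξ hξ => by
    refine hR _ ?_
    rw [affMap, norm_smul, Real.norm_of_nonneg (max_one_pos _).le]
    have h1 := norm_sub_norm_le ξ p.2
    have h2 : ‖ξ - p.2‖ ≤ max p.1 1 * ‖ξ - p.2‖ :=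
      le_mul_of_one_le_left (norm_nonneg _) (le_max_right _ _)
    linarith
  have key : Tendsto (fun p : ℝ × E N => ∫⁻ ξ, ‖g (affMap p.1 p.2 ξ) -
      g (affMap p₀.1 p₀.2 ξ)‖ₑ ^ (2 : ℝ) ∂weightMeasure N m) (𝓝 p₀)
      (𝓝 (∫⁻ _, 0 ∂weightMeasure N m)) := by
    refine tendsto_lintegral_filter_of_dominated_convergence
      (fun ξ => (Metric.closedBall (0 : E N) (R + (‖p₀.2‖ + 1))).indicator
        (fun _ => ENNReal.ofReal (2 * C) ^ (2 : ℝ)) ξ) ?_ ?_ ?_ ?_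
    · refine Eventually.of_forall fun p => ?_
      have := continuous_affMap p.1 p.2
      have := continuous_affMap p₀.1 p₀.2
      have h1 : Continuous fun ξ => g (affMap p.1 p.2 ξ) - g (affMap p₀.1 p₀.2 ξ) := by fun_prop
      exact h1.enorm.measurable.pow_const _
    · have hev : ∀ᶠ p : ℝ × E N in 𝓝 p₀, ‖p.2‖ ≤ ‖p₀.2‖ + 1 :=
        (continuous_snd.norm.tendsto p₀).eventually (ge_mem_nhds (by simp))
      filter_upwards [hev] with p hp
      refine Eventually.of_forall fun ξ => ?_
      by_cases hξ : ξ ∈ Metric.closedBall (0 : E N) (R + (‖p₀.2‖ + 1))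
      · rw [indicator_of_mem hξ]
        refine ENNReal.rpow_le_rpow ?_ (by norm_num)
        rw [← ofReal_norm]
        refine ENNReal.ofReal_le_ofReal ((norm_sub_le _ _).trans ?_)
        linarith [hC (affMap p.1 p.2 ξ), hC (affMap p₀.1 p₀.2 ξ)]
      · rw [indicator_of_notMem hξ]
        rw [mem_closedBall_zero_iff, not_le] at hξ
        rw [hzero p hp ξ hξ, hzero p₀ (by linarith) ξ hξ]
        simp
    · rw [lintegral_indicator_const Metric.isClosed_closedBall.measurableSet]
      exact ENNReal.mul_ne_top (ENNReal.rpow_ne_top_of_nonneg (by norm_num) ENNReal.ofReal_ne_top)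
        (isCompact_closedBall (0 : E N) _).measure_lt_top.ne
    · refine Eventually.of_forall fun ξ => ?_
      have h1 : Continuous fun p : ℝ × E N => ‖g (affMap p.1 p.2 ξ) -
          g (affMap p₀.1 p₀.2 ξ)‖ₑ ^ (2 : ℝ) := by
        have h2 : Continuous fun p : ℝ × E N => affMap p.1 p.2 ξ := by
          unfold affMap; fun_prop
        exact (ENNReal.continuous_rpow_const (y := 2)).comp
          ((hg.comp h2).sub continuous_const).enorm
      have h3 := h1.tendsto p₀
      simpa using h3
  rw [lintegral_zero] at key
  have h4 := ((ENNReal.continuous_rpow_const (y := (1 / 2 : ℝ))).tendsto 0).comp key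
  rw [ENNReal.zero_rpow_of_pos (by norm_num)] at h4
  exact (ENNReal.tendsto_toReal ENNReal.zero_ne_top).comp h4

/-- Density of continuous compactly supported functions, together with an operator bound that is
uniform for `y` near `y₀`. -/
lemma continuous_dilate (hm : 0 < m) (f : L2m N m F) :
    Continuous fun p : ℝ × E N => dilate hm p.1 p.2 f := by
  have := isLocallyFinite_weightMeasure (N := N) hm
  refine continuous_iff_continuousAt.2 fun p₀ => ?_
  rw [Metric.continuousAt_iff']
  intro ε hε
  let M : ℝ := √(2 ^ (2 * m) * weight N m p₀.2) + 1
  have hM : 0 < M := by positivity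
  have hM1 : ∀ᶠ p : ℝ × E N in 𝓝 p₀, √(2 ^ (2 * m) * weight N m p.2) < M := by
    have h1 : Continuous fun p : ℝ × E N => √(2 ^ (2 * m) * weight N m p.2) := by
      have := continuous_weight (N := N) hm
      fun_prop
    exact (h1.tendsto p₀).eventually (gt_mem_nhds (by simp [M]))
  obtain ⟨g, hgc, hfg, hg, hgL⟩ := (Lp.memLp f).exists_hasCompactSupport_eLpNorm_sub_le
    (by norm_num) (ε := ENNReal.ofReal (ε / (4 * M)))
    (by simp only [ne_eq, ENNReal.ofReal_eq_zero, not_le]; positivity)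
  have hfg' : ‖f - hgL.toLp g‖ ≤ ε / (4 * M) := by
    rw [Lp.norm_def, eLpNorm_congr_ae ((Lp.coeFn_sub _ _).trans
      (EventuallyEq.rfl.sub hgL.coeFn_toLp))]
    exact ENNReal.toReal_le_of_le_ofReal (by positivity) hfg
  have hbd : ∀ p : ℝ × E N, √(2 ^ (2 * m) * weight N m p.2) < M →
      ‖dilate hm p.1 p.2 (f - hgL.toLp g)‖ ≤ ε / 4 := fun p hp => by
    refine (norm_dilate_apply_le hm p.1 p.2 _).trans ?_
    calc _ ≤ M * (ε / (4 * M)) := by gcongr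
      _ = ε / 4 := by field_simp
  have hg' := Metric.continuousAt_iff'.1
    ((continuous_dilate_of_hasCompactSupport hm hg hgc hgL).continuousAt (x := p₀)) (ε / 4)
    (by positivity)
  filter_upwards [hM1, hg'] with p hp hgp
  rw [dist_eq_norm] at hgp ⊢
  have h1 := hbd p hp
  have h2 := hbd p₀ (by simp [M])
  rw [map_sub] at h1 h2
  calc ‖dilate hm p.1 p.2 f - dilate hm p₀.1 p₀.2 f‖
      = ‖(dilate hm p.1 p.2 f - dilate hm p.1 p.2 (hgL.toLp g))
        + (dilate hm p.1 p.2 (hgL.toLp g) - dilate hm p₀.1 p₀.2 (hgL.toLp g))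
        - (dilate hm p₀.1 p₀.2 f - dilate hm p₀.1 p₀.2 (hgL.toLp g))‖ := by congr 1; abel
    _ ≤ ε / 4 + ε / 4 + ε / 4 := by
        refine (norm_sub_le _ _).trans (add_le_add ((norm_add_le _ _).trans
          (add_le_add h1 hgp.le)) h2)
    _ < ε := by linarith

end Dilation

/-! ### The Gaussian kernel and Chapman–Kolmogorov -/

section Kernel

open Set Filter Topology

variable {N : ℕ}

lemma one_sub_exp_neg_pos {τ : ℝ} (hτ : 0 < τ) : 0 < 1 - Real.exp (-τ) := by
  have : Real.exp (-τ) < 1 := by simpa using hτ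
  linarith

lemma one_sub_exp_neg_le_one (τ : ℝ) : 1 - Real.exp (-τ) ≤ 1 := by
  have := Real.exp_pos (-τ)
  linarith

lemma integral_exp_neg_norm_sq_div {b : ℝ} (hb : 0 < b) :
    ∫ z : E N, Real.exp (-‖z‖ ^ 2 / b) = (Real.pi * b) ^ ((N : ℝ) / 2) := by
  have h := GaussianFourier.integral_rexp_neg_mul_sq_norm (V := E N) (b := 1 / b) (by positivity)
  rw [finrank_euclideanSpace, Fintype.card_fin, div_div_eq_mul_div, div_one] at h
  rw [← h]
  congr 1
  ext z
  congr 1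
  ring

lemma integrable_exp_neg_norm_sq_div {b : ℝ} (hb : 0 < b) :
    Integrable fun z : E N => Real.exp (-‖z‖ ^ 2 / b) := by
  by_contra h
  have h1 := integral_exp_neg_norm_sq_div (N := N) hb
  rw [integral_undef h] at h1
  have : 0 < (Real.pi * b) ^ ((N : ℝ) / 2) := by positivity
  linarith

lemma rpow_le_exp {t s : ℝ} (ht : 0 ≤ t) (hs : 0 ≤ s) :
    t ^ s ≤ Real.exp (2 * s ^ 2) * Real.exp (t ^ 2 / 8) := by
  calc t ^ s ≤ (Real.exp t) ^ s := by
        refine Real.rpow_le_rpow ht ?_ hs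
        linarith [Real.add_one_le_exp t]
    _ = Real.exp (t * s) := by rw [← Real.exp_mul]
    _ ≤ Real.exp (2 * s ^ 2 + t ^ 2 / 8) := by
        refine Real.exp_le_exp.2 ?_
        nlinarith [sq_nonneg (t - 4 * s)]
    _ = _ := Real.exp_add _ _

/-- Polynomial factors are absorbed by a Gaussian. -/
lemma exists_weight_le_exp {m : ℝ} (hm : 0 < m) : ∃ C, 0 < C ∧ ∀ z : E N,
    (1 + ‖z‖) * weight N m z ≤ C * Real.exp (‖z‖ ^ 2 / 8) := by
  -- The product expands into the four powers of `‖z‖` with exponents `0`, `1`, `2m`, `2m + 1`, each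
  -- bounded by `rpow_le_exp`; whence the factor `4` and the largest exponent.
  refine ⟨4 * Real.exp (2 * (2 * m + 1) ^ 2), by positivity, fun z => ?_⟩
  have hle : ∀ s, 0 ≤ s → s ≤ 2 * m + 1 →
      ‖z‖ ^ s ≤ Real.exp (2 * (2 * m + 1) ^ 2) * Real.exp (‖z‖ ^ 2 / 8) := fun s hs hs' => by
    refine (rpow_le_exp (norm_nonneg z) hs).trans ?_
    gcongr
  have h0 := hle 0 le_rfl (by linarith)
  have h1 := hle 1 zero_le_one (by linarith)
  have h2 := hle (2 * m) (by linarith) (by linarith)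
  have h3 := hle (2 * m + 1) (by linarith) le_rfl
  rw [Real.rpow_zero] at h0
  rw [Real.rpow_one] at h1
  rw [Real.rpow_add_one' (norm_nonneg z) (by linarith)] at h3
  unfold weight
  nlinarith

lemma kernelL_pos {τ : ℝ} (hτ : 0 < τ) (ξ η : E N) : 0 < kernelL τ ξ η := by
  have := one_sub_exp_neg_pos hτ
  unfold kernelL
  positivity

lemma continuous_kernelL (τ : ℝ) : Continuous fun p : E N × E N => kernelL τ p.1 p.2 := by
  unfold kernelL
  fun_prop

lemma kernelL_le {τ : ℝ} (hτ : 0 < τ) (ξ η : E N) :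
    kernelL τ ξ η ≤ (4 * Real.pi * (1 - Real.exp (-τ))) ^ (-(N : ℝ) / 2) := by
  have := one_sub_exp_neg_pos hτ
  unfold kernelL
  refine mul_le_of_le_one_right (by positivity) ?_
  rw [Real.exp_le_one_iff]
  exact div_nonpos_of_nonpos_of_nonneg (by simp) (by positivity)

lemma integrable_kernelL_left {τ : ℝ} (hτ : 0 < τ) (η : E N) :
    Integrable fun ξ => kernelL τ ξ η := by
  have ha := one_sub_exp_neg_pos hτ
  unfold kernelL
  exact ((integrable_exp_neg_norm_sq_div (N := N) (b := 4 * (1 - Real.exp (-τ)))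
    (by positivity)).comp_sub_right (Real.exp (-τ / 2) • η)).const_mul _

lemma integral_kernelL_left {τ : ℝ} (hτ : 0 < τ) (η : E N) : ∫ ξ, kernelL τ ξ η = 1 := by
  have ha := one_sub_exp_neg_pos hτ
  unfold kernelL
  rw [integral_const_mul, integral_sub_right_eq_self
    (fun ξ : E N => Real.exp (-‖ξ‖ ^ 2 / (4 * (1 - Real.exp (-τ))))) (Real.exp (-τ / 2) • η),
    integral_exp_neg_norm_sq_div (by positivity), neg_div, Real.rpow_neg (by positivity)]
  rw [show Real.pi * (4 * (1 - Real.exp (-τ))) = 4 * Real.pi * (1 - Real.exp (-τ)) by ring]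
  exact inv_mul_cancel₀ (by positivity)

lemma integrable_kernelL_mul {τ : ℝ} (hτ : 0 < τ) {f : E N → ℝ} (hf : Integrable f) (ξ : E N) :
    Integrable fun η => kernelL τ ξ η * f η := by
  refine hf.bdd_mul (c := (4 * Real.pi * (1 - Real.exp (-τ))) ^ (-(N : ℝ) / 2)) ?_
    (Eventually.of_forall fun η => ?_)
  · exact ((continuous_kernelL τ).comp (Continuous.prodMk_right ξ)).aestronglyMeasurable
  · rw [Real.norm_of_nonneg (kernelL_pos hτ ξ η).le]
    exact kernelL_le hτ ξ η

/-- Tonelli: the kernel has mass one in `ξ`, so integrating in `ξ` first leaves `∫ |f|`. This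
justifies the interchanges of integrals behind the semigroup law and the weak gradient of `e^{τ𝓛}f`.
-/
lemma integrable_prod_kernelL_mul {τ : ℝ} (hτ : 0 < τ) {f : E N → ℝ} (hf : Integrable f) :
    Integrable (fun p : E N × E N => kernelL τ p.1 p.2 * f p.2) (volume.prod volume) := by
  have hmeas : AEStronglyMeasurable (fun p : E N × E N => kernelL τ p.1 p.2 * f p.2)
      (volume.prod volume) :=
    (continuous_kernelL τ).aestronglyMeasurable.mul hf.1.comp_snd
  refine (integrable_prod_iff' hmeas).2 ⟨Eventually.of_forall fun η =>
    (integrable_kernelL_left hτ η).mul_const (f η), ?_⟩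
  refine hf.norm.congr (Eventually.of_forall fun η => ?_)
  simp only [norm_mul]
  rw [integral_mul_const]
  have : ∫ ξ, ‖kernelL τ ξ η‖ = 1 := by
    rw [← integral_kernelL_left hτ η]
    exact integral_congr_ae (Eventually.of_forall fun ξ =>
      Real.norm_of_nonneg (kernelL_pos hτ ξ η).le)
  rw [this, one_mul]

lemma expL_of_pos {τ : ℝ} (hτ : 0 < τ) (f : E N → ℝ) (ξ : E N) :
    expL τ f ξ = ∫ η, kernelL τ ξ η * f η := by
  rw [expL, if_neg hτ.ne']

lemma integrable_expL {τ : ℝ} (hτ : 0 ≤ τ) {f : E N → ℝ} (hf : Integrable f) :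
    Integrable (expL τ f) := by
  rcases hτ.eq_or_lt with rfl | hτ
  · exact hf.congr (Eventually.of_forall fun ξ => by simp [expL])
  · exact (integrable_prod_kernelL_mul hτ hf).integral_prod_left.congr
      (Eventually.of_forall fun ξ => (expL_of_pos hτ f ξ).symm)

lemma expL_congr_ae {τ : ℝ} (hτ : 0 ≤ τ) {f g : E N → ℝ} (h : f =ᵐ[volume] g) :
    expL τ f =ᵐ[volume] expL τ g := by
  rcases hτ.eq_or_lt with rfl | hτ
  · filter_upwards [h] with ξ hξ
    simpa [expL] using hξ
  · refine Eventually.of_forall fun ξ => ?_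
    rw [expL_of_pos hτ, expL_of_pos hτ]
    refine integral_congr_ae ?_
    filter_upwards [h] with η hη
    rw [hη]

/-- Completing the square in the composition of two Gaussians. -/
lemma norm_sq_div_add_norm_sq_div {a b c α : ℝ} (ha : 0 < a) (hb : 0 < b) (hc : c = a + α ^ 2 * b)
    (x w : E N) :
    ‖x - α • w‖ ^ 2 / (4 * a) + ‖w‖ ^ 2 / (4 * b)
      = ‖w - (α * b / c) • x‖ ^ 2 / (4 * a * b / c) + ‖x‖ ^ 2 / (4 * c) := by
  have hc0 : 0 < c := by rw [hc]; positivity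
  rw [norm_sub_sq_real, norm_sub_sq_real, real_inner_smul_right, real_inner_smul_right,
    norm_smul, norm_smul, mul_pow, mul_pow, Real.norm_eq_abs, Real.norm_eq_abs, sq_abs, sq_abs,
    real_inner_comm x w]
  field_simp
  rw [hc]
  ring

/-- The Chapman–Kolmogorov identity for the kernel. -/
lemma integral_kernelL_mul_kernelL {σ τ : ℝ} (hσ : 0 < σ) (hτ : 0 < τ) (ξ η : E N) :
    ∫ ζ, kernelL σ ξ ζ * kernelL τ ζ η = kernelL (σ + τ) ξ η := by
  have ha := one_sub_exp_neg_pos hσ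
  have hb := one_sub_exp_neg_pos hτ
  have hc := one_sub_exp_neg_pos (add_pos hσ hτ)
  -- The variances add as `a(σ + τ) = a(σ) + e^{-σ} a(τ)`.
  have hcab : 1 - Real.exp (-(σ + τ))
      = (1 - Real.exp (-σ)) + Real.exp (-σ / 2) ^ 2 * (1 - Real.exp (-τ)) := by
    rw [← Real.exp_nat_mul, mul_sub, ← Real.exp_add]
    push_cast
    ring_nf
  have hα : Real.exp (-(σ + τ) / 2) = Real.exp (-σ / 2) * Real.exp (-τ / 2) := by
    rw [← Real.exp_add]; ring_nf
  unfold kernelL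
  rw [hα, mul_smul]
  generalize Real.exp (-σ / 2) = α at *
  generalize Real.exp (-τ / 2) • η = p at *
  generalize 1 - Real.exp (-(σ + τ)) = c at *
  generalize 1 - Real.exp (-σ) = a at *
  generalize 1 - Real.exp (-τ) = b at *
  have hexp : ∀ ζ : E N, (4 * Real.pi * a) ^ (-(N : ℝ) / 2) *
      Real.exp (-‖ξ - α • ζ‖ ^ 2 / (4 * a)) *
      ((4 * Real.pi * b) ^ (-(N : ℝ) / 2) * Real.exp (-‖ζ - p‖ ^ 2 / (4 * b)))
      = (4 * Real.pi * a) ^ (-(N : ℝ) / 2) * (4 * Real.pi * b) ^ (-(N : ℝ) / 2) *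
        Real.exp (-‖ξ - α • p‖ ^ 2 / (4 * c)) *
        Real.exp (-‖ζ - (p + (α * b / c) • (ξ - α • p))‖ ^ 2 / (4 * a * b / c)) := fun ζ => by
    have h1 := norm_sq_div_add_norm_sq_div ha hb hcab (ξ - α • p) (ζ - p)
    have h2 : ξ - α • p - α • (ζ - p) = ξ - α • ζ := by rw [smul_sub]; abel
    rw [h2, sub_sub] at h1
    have h3 : Real.exp (-‖ξ - α • ζ‖ ^ 2 / (4 * a)) * Real.exp (-‖ζ - p‖ ^ 2 / (4 * b))
        = Real.exp (-‖ξ - α • p‖ ^ 2 / (4 * c)) *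
        Real.exp (-‖ζ - (p + (α * b / c) • (ξ - α • p))‖ ^ 2 / (4 * a * b / c)) := by
      rw [← Real.exp_add, ← Real.exp_add]
      congr 1
      simp only [neg_div]
      linarith
    calc _ = (4 * Real.pi * a) ^ (-(N : ℝ) / 2) * (4 * Real.pi * b) ^ (-(N : ℝ) / 2) *
        (Real.exp (-‖ξ - α • ζ‖ ^ 2 / (4 * a)) * Real.exp (-‖ζ - p‖ ^ 2 / (4 * b))) := by ring
      _ = _ := by rw [h3]; ring
  simp only [hexp]
  rw [integral_const_mul, integral_sub_right_eq_self
    (fun ζ : E N => Real.exp (-‖ζ‖ ^ 2 / (4 * a * b / c))),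
    integral_exp_neg_norm_sq_div (by positivity)]
  have hconst : (4 * Real.pi * a) ^ (-(N : ℝ) / 2) * (4 * Real.pi * b) ^ (-(N : ℝ) / 2) *
      (Real.pi * (4 * a * b / c)) ^ ((N : ℝ) / 2) = (4 * Real.pi * c) ^ (-(N : ℝ) / 2) := by
    have h4 : Real.pi * (4 * a * b / c) = (4 * Real.pi * a) * (4 * Real.pi * b) / (4 * Real.pi * c) := by
      have := Real.pi_pos
      field_simp
    rw [h4]
    have hA : 0 < 4 * Real.pi * a := by positivity
    have hB : 0 < 4 * Real.pi * b := by positivity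
    have hC : 0 < 4 * Real.pi * c := by positivity
    generalize 4 * Real.pi * a = A at *
    generalize 4 * Real.pi * b = B at *
    generalize 4 * Real.pi * c = C at *
    rw [Real.div_rpow (by positivity) hC.le, Real.mul_rpow hA.le hB.le, neg_div,
      Real.rpow_neg hA.le, Real.rpow_neg hB.le, Real.rpow_neg hC.le]
    have h5 : 0 < A ^ ((N : ℝ) / 2) := by positivity
    have h6 : 0 < B ^ ((N : ℝ) / 2) := by positivity
    have h7 : 0 < C ^ ((N : ℝ) / 2) := by positivity
    generalize A ^ ((N : ℝ) / 2) = A' at *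
    generalize B ^ ((N : ℝ) / 2) = B' at *
    generalize C ^ ((N : ℝ) / 2) = C' at *
    field_simp
  rw [← hconst]
  ring

/-- The semigroup property of `e^{τ𝓛}` on integrable functions. -/
lemma expL_expL {σ τ : ℝ} (hσ : 0 < σ) (hτ : 0 < τ) {f : E N → ℝ} (hf : Integrable f) (ξ : E N) :
    expL σ (expL τ f) ξ = expL (σ + τ) f ξ := by
  rw [expL_of_pos hσ, expL_of_pos (add_pos hσ hτ)]
  have hcont : Continuous fun p : E N × E N => kernelL σ ξ p.1 :=
    (continuous_kernelL σ).comp (f := fun p : E N × E N => (ξ, p.1)) (by fun_prop)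
  have hInt : Integrable (fun p : E N × E N => kernelL σ ξ p.1 * (kernelL τ p.1 p.2 * f p.2))
      (volume.prod volume) := by
    refine (integrable_prod_kernelL_mul hτ hf).bdd_mul
      (c := (4 * Real.pi * (1 - Real.exp (-σ))) ^ (-(N : ℝ) / 2)) ?_
      (Eventually.of_forall fun p => ?_)
    · exact hcont.aestronglyMeasurable
    · rw [Real.norm_of_nonneg (kernelL_pos hσ ξ p.1).le]
      exact kernelL_le hσ ξ p.1
  calc ∫ ζ, kernelL σ ξ ζ * expL τ f ζ
      = ∫ ζ, ∫ η, kernelL σ ξ ζ * (kernelL τ ζ η * f η) := by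
        refine integral_congr_ae (Eventually.of_forall fun ζ => ?_)
        simp only
        rw [expL_of_pos hτ, integral_const_mul]
    _ = ∫ η, ∫ ζ, kernelL σ ξ ζ * (kernelL τ ζ η * f η) := integral_integral_swap hInt
    _ = ∫ η, kernelL (σ + τ) ξ η * f η := by
        refine integral_congr_ae (Eventually.of_forall fun η => ?_)
        simp only [← mul_assoc]
        rw [integral_mul_const, integral_kernelL_mul_kernelL hσ hτ]

end Kernel

/-! ### Dilations and translations on `H¹_m` -/

section Sobolev

open Set Filter Topology

variable {N : ℕ} {m : ℝ}

/-- An element of `H¹_m` from a function and its weak gradient. -/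
def H1m.mk (f : L2m N m ℝ) (w : L2m N m (E N)) (h : IsWeakGradient f w) : H1m N m :=
  ⟨WithLp.toLp 2 (f, w), h⟩

/-- The inclusion of `H¹_m` into the weighted `L²` space. -/
def fstL (N : ℕ) (m : ℝ) : H1m N m →L[ℝ] L2m N m ℝ :=
  (WithLp.fstL 2 ℝ _ _).comp (H1m N m).subtypeL

/-- The weak gradient as a continuous linear map. -/
def gradL (N : ℕ) (m : ℝ) : H1m N m →L[ℝ] L2m N m (E N) :=
  (WithLp.sndL 2 ℝ _ _).comp (H1m N m).subtypeL

@[simp] lemma fstL_mk (f : L2m N m ℝ) (w : L2m N m (E N)) (h : IsWeakGradient f w) :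
    fstL N m (H1m.mk f w h) = f := rfl

@[simp] lemma gradL_mk (f : L2m N m ℝ) (w : L2m N m (E N)) (h : IsWeakGradient f w) :
    gradL N m (H1m.mk f w h) = w := rfl

lemma isWeakGradient_fstL_gradL (v : H1m N m) : IsWeakGradient (fstL N m v) (gradL N m v) := v.2

lemma H1m.norm_sq_eq (v : H1m N m) : ‖v‖ ^ 2 = ‖fstL N m v‖ ^ 2 + ‖gradL N m v‖ ^ 2 :=
  WithLp.prod_norm_sq_eq_of_L2 _

lemma H1m.norm_fstL_le (v : H1m N m) : ‖fstL N m v‖ ≤ ‖v‖ := by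
  have := H1m.norm_sq_eq v
  exact abs_le_of_sq_le_sq' (by nlinarith [sq_nonneg ‖gradL N m v‖]) (norm_nonneg _) |>.2

lemma H1m.norm_gradL_le (v : H1m N m) : ‖gradL N m v‖ ≤ ‖v‖ := by
  have := H1m.norm_sq_eq v
  exact abs_le_of_sq_le_sq' (by nlinarith [sq_nonneg ‖fstL N m v‖]) (norm_nonneg _) |>.2

lemma H1m.norm_le_add (v : H1m N m) : ‖v‖ ≤ ‖fstL N m v‖ + ‖gradL N m v‖ := by
  have := H1m.norm_sq_eq v
  refine (abs_le_of_sq_le_sq' ?_ (by positivity)).2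
  nlinarith [norm_nonneg (fstL N m v), norm_nonneg (gradL N m v)]

lemma H1m.ext_of_eq {v w : H1m N m} (h1 : fstL N m v = fstL N m w)
    (h2 : gradL N m v = gradL N m w) : v = w := by
  have h : ‖v - w‖ ^ 2 = 0 := by
    rw [H1m.norm_sq_eq, map_sub, map_sub, h1, h2]
    simp
  exact sub_eq_zero.1 (norm_eq_zero.1 (pow_eq_zero_iff (by norm_num) |>.1 h))

/-- The weak gradient is determined by the function. -/
lemma gradL_eq_zero (hm : (N : ℝ) / 2 < m) (v : H1m N m) (h : fstL N m v = 0) :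
    gradL N m v = 0 := by
  have hi := integrable_L2m hm (gradL N m v)
  have h0 : ((fstL N m v : L2m N m ℝ) : E N → ℝ) =ᵐ[volume] 0 := by
    rw [h]
    exact volume_ac_weightMeasure.ae_le (Lp.coeFn_zero ℝ 2 (weightMeasure N m))
  have key : (gradL N m v : E N → E N) =ᵐ[volume] 0 := by
    refine ae_eq_zero_of_integral_contDiff_smul_eq_zero hi.locallyIntegrable fun φ hφ hφc => ?_
    refine ext_inner_right ℝ fun e => ?_
    have hInt : Integrable fun ξ => φ ξ • (gradL N m v : E N → E N) ξ := by
      obtain ⟨C, hC⟩ := hφ.continuous.bounded_above_of_compact_support hφc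
      exact hi.bdd_smul C hφ.continuous.aestronglyMeasurable (Eventually.of_forall hC)
    rw [real_inner_comm, ← integral_inner hInt, inner_zero_left]
    have h1 := isWeakGradient_fstL_gradL v φ hφ hφc e
    have h2 : ∫ ξ, (fstL N m v : E N → ℝ) ξ * fderiv ℝ φ ξ e = 0 := by
      rw [← integral_zero (E N) ℝ (μ := volume)]
      refine integral_congr_ae ?_
      filter_upwards [h0] with ξ hξ
      rw [hξ]; simp
    rw [h2, zero_eq_neg] at h1
    rw [← h1]
    refine integral_congr_ae (Eventually.of_forall fun ξ => ?_)
    simp only [real_inner_smul_right, real_inner_comm e]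
    ring
  refine Lp.ext ?_
  have key' : (gradL N m v : E N → E N) =ᵐ[weightMeasure N m] 0 :=
    weightMeasure_ac_volume.ae_le key
  exact key'.trans (Lp.coeFn_zero (E N) 2 (weightMeasure N m)).symm

/-- The weak gradient is determined by the function, so identities in `H¹_m` reduce to almost
everywhere identities of kernel integrals. -/
lemma H1m.ext_fn (hm : (N : ℝ) / 2 < m) {v w : H1m N m} (h : H1m.fn v =ᵐ[volume] H1m.fn w) : v = w := by
  have h1 : fstL N m v = fstL N m w := Lp.ext (weightMeasure_ac_volume.ae_le h)
  refine H1m.ext_of_eq h1 ?_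
  have h2 := gradL_eq_zero hm (v - w) (by rw [map_sub, h1, sub_self])
  rwa [map_sub, sub_eq_zero] at h2

lemma IsWeakGradient.congr {v v' : E N → ℝ} {w w' : E N → E N} (h : IsWeakGradient v w)
    (hv : v' =ᵐ[volume] v) (hw : w' =ᵐ[volume] w) : IsWeakGradient v' w' := by
  intro φ hφ hφc e
  have h1 : ∫ ξ, v' ξ * fderiv ℝ φ ξ e = ∫ ξ, v ξ * fderiv ℝ φ ξ e := by
    refine integral_congr_ae ?_
    filter_upwards [hv] with ξ hξ
    rw [hξ]
  have h2 : ∫ ξ, ⟪w' ξ, e⟫ * φ ξ = ∫ ξ, ⟪w ξ, e⟫ * φ ξ := by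
    refine integral_congr_ae ?_
    filter_upwards [hw] with ξ hξ
    rw [hξ]
  rw [h1, h2, h φ hφ hφc e]

/-- The chain rule, obtained by moving the affine map onto the test function: with `ψ(η) = φ(η/b +
y)`, `b = max β 1`, both sides pick up the same Jacobian, and differentiating `φ` brings out the
factor `b`. -/
lemma IsWeakGradient.comp_affMap {v : E N → ℝ} {w : E N → E N} (h : IsWeakGradient v w)
    (β : ℝ) (y : E N) :
    IsWeakGradient (fun ξ => v (affMap β y ξ)) (fun ξ => max β 1 • w (affMap β y ξ)) := by
  intro φ hφ hφc e
  have hpos := max_one_pos β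
  set b := max β 1 with hb
  let ψ : E N → ℝ := fun η => φ (b⁻¹ • η + y)
  have hψ : ContDiff ℝ ∞ ψ := hφ.comp (by fun_prop)
  have hψc : HasCompactSupport ψ := by
    let e₁ : E N ≃ₜ E N := (Homeomorph.smulOfNeZero b⁻¹ (inv_ne_zero hpos.ne')).trans
      (Homeomorph.addRight y)
    exact hφc.comp_homeomorph e₁
  have hφψ : ∀ ξ, φ ξ = ψ (affMap β y ξ) := fun ξ => by
    simp only [ψ, affMap, ← hb, smul_smul, inv_mul_cancel₀ hpos.ne', one_smul, sub_add_cancel]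
  have hder : ∀ ξ, fderiv ℝ φ ξ e = b * fderiv ℝ ψ (affMap β y ξ) e := fun ξ => by
    have h1 : HasFDerivAt (affMap β y) (b • ContinuousLinearMap.id ℝ (E N)) ξ :=
      ((hasFDerivAt_id ξ).sub_const y).const_smul b
    have h2 := ((hψ.differentiable (by simp)) (affMap β y ξ)).hasFDerivAt.comp ξ h1
    have h3 : ψ ∘ affMap β y = φ := funext fun ξ => (hφψ ξ).symm
    rw [h3] at h2
    rw [h2.fderiv]
    simp
  have h1 := h ψ hψ hψc e
  have h2 := integral_comp_affMap β y (fun η => v η * fderiv ℝ ψ η e)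
  have h3 := integral_comp_affMap β y (fun η => ⟪w η, e⟫ * ψ η)
  calc ∫ ξ, v (affMap β y ξ) * fderiv ℝ φ ξ e
      = ∫ ξ, b * (v (affMap β y ξ) * fderiv ℝ ψ (affMap β y ξ) e) := by
        refine integral_congr_ae (Eventually.of_forall fun ξ => ?_)
        simp only [hder]; ring
    _ = -(b * ∫ ξ, ⟪w (affMap β y ξ), e⟫ * ψ (affMap β y ξ)) := by
        rw [integral_const_mul, h2, h3, h1, smul_neg, mul_neg]
    _ = -∫ ξ, ⟪b • w (affMap β y ξ), e⟫ * φ ξ := by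
        rw [← integral_const_mul]
        congr 1
        refine integral_congr_ae (Eventually.of_forall fun ξ => ?_)
        simp only [real_inner_smul_left, hφψ]; ring

lemma isWeakGradient_dilate (hm : 0 < m) (β : ℝ) (y : E N) (v : H1m N m) :
    IsWeakGradient (dilate hm β y (fstL N m v))
      (max β 1 • dilate hm β y (gradL N m v) : L2m N m (E N)) := by
  refine ((isWeakGradient_fstL_gradL v).comp_affMap β y).congr
    (volume_ac_weightMeasure.ae_le (dilate_coeFn hm β y _))
    ((volume_ac_weightMeasure (m := m)).ae_le ?_)
  filter_upwards [Lp.coeFn_smul (max β 1) (dilate hm β y (gradL N m v)),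
    dilate_coeFn hm β y (gradL N m v)] with ξ h1 h2
  rw [h1, Pi.smul_apply, h2]

/-- The function `β^N v(β(· - y))` as an element of `H¹_m`. -/
def dilateH1Fun (hm : 0 < m) (β : ℝ) (y : E N) (v : H1m N m) : H1m N m :=
  max β 1 ^ N • H1m.mk _ _ (isWeakGradient_dilate hm β y v)

lemma fstL_dilateH1Fun (hm : 0 < m) (β : ℝ) (y : E N) (v : H1m N m) :
    fstL N m (dilateH1Fun hm β y v) = max β 1 ^ N • dilate hm β y (fstL N m v) := by
  rw [dilateH1Fun, map_smul, fstL_mk]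

lemma gradL_dilateH1Fun (hm : 0 < m) (β : ℝ) (y : E N) (v : H1m N m) :
    gradL N m (dilateH1Fun hm β y v) = max β 1 ^ N • max β 1 • dilate hm β y (gradL N m v) := by
  rw [dilateH1Fun, map_smul, gradL_mk]

lemma norm_dilateH1Fun_le (hm : 0 < m) (β : ℝ) (y : E N) (v : H1m N m) :
    ‖dilateH1Fun hm β y v‖
      ≤ max β 1 ^ N * (1 + max β 1) * √(2 ^ (2 * m) * weight N m y) * ‖v‖ := by
  have hpos := max_one_pos β
  refine (H1m.norm_le_add _).trans ?_
  rw [fstL_dilateH1Fun, gradL_dilateH1Fun, norm_smul, norm_smul, norm_smul, norm_pow,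
    Real.norm_of_nonneg hpos.le]
  have h1 : ‖dilate hm β y (fstL N m v)‖ ≤ √(2 ^ (2 * m) * weight N m y) * ‖v‖ :=
    (norm_dilate_apply_le hm β y _).trans
      (mul_le_mul_of_nonneg_left (H1m.norm_fstL_le v) (Real.sqrt_nonneg _))
  have h2 : ‖dilate hm β y (gradL N m v)‖ ≤ √(2 ^ (2 * m) * weight N m y) * ‖v‖ :=
    (norm_dilate_apply_le hm β y _).trans
      (mul_le_mul_of_nonneg_left (H1m.norm_gradL_le v) (Real.sqrt_nonneg _))
  calc _ ≤ max β 1 ^ N * (√(2 ^ (2 * m) * weight N m y) * ‖v‖)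
        + max β 1 ^ N * (max β 1 * (√(2 ^ (2 * m) * weight N m y) * ‖v‖)) := by gcongr
    _ = _ := by ring

/-- The operator `v ↦ β^N v(β(· - y))` on `H¹_m`. -/
def dilateH1 (hm : 0 < m) (β : ℝ) (y : E N) : H1m N m →L[ℝ] H1m N m :=
  LinearMap.mkContinuous
    { toFun := dilateH1Fun hm β y
      map_add' := fun v w => by
        refine H1m.ext_of_eq ?_ ?_
        · rw [map_add, fstL_dilateH1Fun, fstL_dilateH1Fun, fstL_dilateH1Fun, map_add, map_add,
            smul_add]
        · rw [map_add, gradL_dilateH1Fun, gradL_dilateH1Fun, gradL_dilateH1Fun, map_add, map_add,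
            smul_add, smul_add]
      map_smul' := fun c v => by
        rw [RingHom.id_apply]
        refine H1m.ext_of_eq ?_ ?_
        · rw [map_smul, fstL_dilateH1Fun, fstL_dilateH1Fun, map_smul, map_smul, smul_comm]
        · rw [map_smul, gradL_dilateH1Fun, gradL_dilateH1Fun, map_smul, map_smul, smul_comm c,
            smul_comm c] }
    (max β 1 ^ N * (1 + max β 1) * √(2 ^ (2 * m) * weight N m y)) (norm_dilateH1Fun_le hm β y)

lemma norm_dilateH1_apply_le (hm : 0 < m) (β : ℝ) (y : E N) (v : H1m N m) :
    ‖dilateH1 hm β y v‖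
      ≤ max β 1 ^ N * (1 + max β 1) * √(2 ^ (2 * m) * weight N m y) * ‖v‖ :=
  norm_dilateH1Fun_le hm β y v

lemma fstL_dilateH1 (hm : 0 < m) (β : ℝ) (y : E N) (v : H1m N m) :
    fstL N m (dilateH1 hm β y v) = max β 1 ^ N • dilate hm β y (fstL N m v) :=
  fstL_dilateH1Fun hm β y v

lemma gradL_dilateH1 (hm : 0 < m) (β : ℝ) (y : E N) (v : H1m N m) :
    gradL N m (dilateH1 hm β y v) = max β 1 ^ N • max β 1 • dilate hm β y (gradL N m v) :=
  gradL_dilateH1Fun hm β y v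

lemma continuous_dilateH1 (hm : 0 < m) (v : H1m N m) :
    Continuous fun p : ℝ × E N => dilateH1 hm p.1 p.2 v := by
  have h1 := continuous_dilate hm (fstL N m v)
  have h2 := continuous_dilate hm (gradL N m v)
  refine continuous_iff_continuousAt.2 fun p₀ => ?_
  rw [ContinuousAt, tendsto_iff_norm_sub_tendsto_zero]
  have h3 : Continuous fun p : ℝ × E N =>
      ‖max p.1 1 ^ N • dilate hm p.1 p.2 (fstL N m v)
        - max p₀.1 1 ^ N • dilate hm p₀.1 p₀.2 (fstL N m v)‖
      + ‖max p.1 1 ^ N • max p.1 1 • dilate hm p.1 p.2 (gradL N m v)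
        - max p₀.1 1 ^ N • max p₀.1 1 • dilate hm p₀.1 p₀.2 (gradL N m v)‖ := by
    have h4 : Continuous fun p : ℝ × E N => max p.1 1 := by fun_prop
    exact (((h4.pow N).smul h1).sub continuous_const).norm.add
      (((h4.pow N).smul (h4.smul h2)).sub continuous_const).norm
  have h5 := h3.tendsto p₀
  simp only [sub_self, norm_zero, add_zero] at h5
  refine squeeze_zero (fun _ => norm_nonneg _) (fun p => ?_) h5
  refine (H1m.norm_le_add _).trans_eq ?_
  rw [map_sub, map_sub, fstL_dilateH1, fstL_dilateH1, gradL_dilateH1, gradL_dilateH1]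

lemma dilate_one_zero (hm : 0 < m) {F : Type} [NormedAddCommGroup F] [NormedSpace ℝ F]
    (f : L2m N m F) : dilate hm 1 (0 : E N) f = f := by
  refine Lp.ext ?_
  filter_upwards [dilate_coeFn hm 1 (0 : E N) f] with ξ hξ
  rw [hξ]
  simp [affMap]

lemma dilateH1_one_zero (hm : 0 < m) (v : H1m N m) : dilateH1 hm 1 (0 : E N) v = v := by
  refine H1m.ext_of_eq ?_ ?_
  · rw [fstL_dilateH1, dilate_one_zero]; simp
  · rw [gradL_dilateH1, dilate_one_zero]; simp

end Sobolev

/-! ### The semigroup as a Gaussian average of dilations and translations -/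

section HeatSemigroup

open Set Filter Topology

variable {N : ℕ} {m : ℝ}

/-- The standard Gaussian density `(4π)^{-N/2} e^{-|z|²/4}`. -/
def gauss (N : ℕ) (z : E N) : ℝ := (4 * Real.pi) ^ (-(N : ℝ) / 2) * Real.exp (-‖z‖ ^ 2 / 4)

lemma gauss_nonneg (z : E N) : 0 ≤ gauss N z := by
  unfold gauss; positivity

lemma continuous_gauss : Continuous (gauss N) := by
  unfold gauss; fun_prop

lemma integrable_gauss : Integrable (gauss N) :=
  (integrable_exp_neg_norm_sq_div (by norm_num : (0 : ℝ) < 4)).const_mul _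

lemma integral_gauss : ∫ z, gauss N z = 1 := by
  unfold gauss
  rw [integral_const_mul, integral_exp_neg_norm_sq_div (by norm_num), mul_comm Real.pi 4, neg_div,
    Real.rpow_neg (by positivity)]
  exact inv_mul_cancel₀ (by positivity)

/-- The square root bounds the norm of translation by `z`. Its polynomial growth is absorbed by half
of the Gaussian exponent, so the averaging integral converges absolutely. -/
lemma integrable_gauss_mul_sqrt_weight (hm : 0 < m) :
    Integrable fun z : E N => gauss N z * √(2 ^ (2 * m) * weight N m z) := by
  obtain ⟨C, hC0, hC⟩ := exists_weight_le_exp (N := N) hm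
  have h1 : Integrable fun z : E N =>
      (4 * Real.pi) ^ (-(N : ℝ) / 2) * (2 ^ (2 * m) * C) * Real.exp (-‖z‖ ^ 2 / 8) :=
    (integrable_exp_neg_norm_sq_div (by norm_num : (0 : ℝ) < 8)).const_mul _
  refine h1.mono' ?_ (Eventually.of_forall fun z => ?_)
  · have := continuous_weight (N := N) hm
    have := continuous_gauss (N := N)
    exact Continuous.aestronglyMeasurable (by fun_prop)
  · rw [Real.norm_of_nonneg (mul_nonneg (gauss_nonneg z) (Real.sqrt_nonneg _))]
    have hw := one_le_weight N m z
    have h2 : (1 : ℝ) ≤ 2 ^ (2 * m) := Real.one_le_rpow (by norm_num) (by linarith)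
    have h3 : √(2 ^ (2 * m) * weight N m z) ≤ 2 ^ (2 * m) * weight N m z := by
      rw [Real.sqrt_le_left (by positivity)]
      nlinarith [mul_le_mul h2 hw zero_le_one (by linarith)]
    have h4 : weight N m z ≤ C * Real.exp (‖z‖ ^ 2 / 8) := by
      refine le_trans ?_ (hC z)
      exact le_mul_of_one_le_left (by linarith) (by linarith [norm_nonneg z])
    have h5 : Real.exp (-‖z‖ ^ 2 / 4) * Real.exp (‖z‖ ^ 2 / 8) = Real.exp (-‖z‖ ^ 2 / 8) := by
      rw [← Real.exp_add]; ring_nf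
    unfold gauss
    calc _ ≤ (4 * Real.pi) ^ (-(N : ℝ) / 2) * Real.exp (-‖z‖ ^ 2 / 4) *
          (2 ^ (2 * m) * (C * Real.exp (‖z‖ ^ 2 / 8))) := by
          refine mul_le_mul_of_nonneg_left (h3.trans ?_) (by positivity)
          gcongr
      _ = _ := by rw [← h5]; ring

instance instSecondCountableTopologyEitherH1m :
    SecondCountableTopologyEither (E N) (H1m N m) :=
  secondCountableTopologyEither_of_left (E N) (H1m N m)

/-- The integrand in the representation of the semigroup by dilations and translations. -/
def heatIntegrand (hm : 0 < m) (τ : ℝ) (v : H1m N m) (z : E N) : H1m N m :=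
  gauss N z • dilateH1 hm (Real.exp (τ / 2)) (√(1 - Real.exp (-τ)) • z) v

lemma continuous_heatIntegrand (hm : 0 < m) (v : H1m N m) :
    Continuous fun p : ℝ × E N => heatIntegrand hm p.1 v p.2 := by
  unfold heatIntegrand
  refine (continuous_gauss.comp continuous_snd).smul ?_
  exact (continuous_dilateH1 hm v).comp (f := fun p : ℝ × E N =>
    (Real.exp (p.1 / 2), √(1 - Real.exp (-p.1)) • p.2)) (by fun_prop)

/-- Since `√(1 - e^{-τ}) ≤ 1`, the translations are dominated by those by `z`; the majorant depends
on `τ` only through `B`, which gives local uniformity in time. -/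
lemma norm_heatIntegrand_le (hm : 0 < m) {τ B : ℝ} (hB : max (Real.exp (τ / 2)) 1 ≤ B)
    (v : H1m N m) (z : E N) :
    ‖heatIntegrand hm τ v z‖
      ≤ B ^ N * (1 + B) * ‖v‖ * (gauss N z * √(2 ^ (2 * m) * weight N m z)) := by
  have hpos := max_one_pos (Real.exp (τ / 2))
  unfold heatIntegrand
  rw [norm_smul, Real.norm_of_nonneg (gauss_nonneg z)]
  have hg := gauss_nonneg z
  have h1 : weight N m (√(1 - Real.exp (-τ)) • z) ≤ weight N m z := by
    refine weight_mono hm ?_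
    rw [norm_smul, Real.norm_of_nonneg (Real.sqrt_nonneg _)]
    refine mul_le_of_le_one_left (norm_nonneg _) ?_
    rw [Real.sqrt_le_left zero_le_one, one_pow]
    exact one_sub_exp_neg_le_one τ
  have hB0 : 0 ≤ B := hpos.le.trans hB
  calc _ ≤ gauss N z * (B ^ N * (1 + B) * √(2 ^ (2 * m) * weight N m z) * ‖v‖) := by
        refine mul_le_mul_of_nonneg_left ?_ hg
        refine (norm_dilateH1_apply_le hm _ _ v).trans ?_
        gcongr
    _ = _ := by ring

lemma integrable_heatIntegrand (hm : 0 < m) (τ : ℝ) (v : H1m N m) :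
    Integrable (heatIntegrand hm τ v) := by
  refine ((integrable_gauss_mul_sqrt_weight hm).const_mul _).mono' ?_
    (Eventually.of_forall fun z => norm_heatIntegrand_le hm le_rfl v z)
  exact ((continuous_heatIntegrand hm v).comp (Continuous.prodMk_right τ)).aestronglyMeasurable

/-- The semigroup `e^{τ𝓛}` on `H¹_m`. -/
def heat (hm : 0 < m) (τ : ℝ) : H1m N m →L[ℝ] H1m N m :=
  LinearMap.mkContinuous
    { toFun := fun v => ∫ z, heatIntegrand hm τ v z
      map_add' := fun v w => by
        rw [← integral_add (integrable_heatIntegrand hm τ v) (integrable_heatIntegrand hm τ w)]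
        simp [heatIntegrand, smul_add]
      map_smul' := fun c v => by
        rw [RingHom.id_apply, ← integral_smul]
        simp [heatIntegrand, smul_comm c] }
    (max (Real.exp (τ / 2)) 1 ^ N * (1 + max (Real.exp (τ / 2)) 1) *
      ∫ z : E N, gauss N z * √(2 ^ (2 * m) * weight N m z)) fun v => by
      refine (norm_integral_le_of_norm_le
        ((integrable_gauss_mul_sqrt_weight hm).const_mul _)
        (Eventually.of_forall fun z => norm_heatIntegrand_le hm le_rfl v z)).trans_eq ?_
      rw [integral_const_mul]
      ring

lemma heat_apply (hm : 0 < m) (τ : ℝ) (v : H1m N m) :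
    heat hm τ v = ∫ z, heatIntegrand hm τ v z := rfl

lemma heat_zero (hm : 0 < m) (v : H1m N m) : heat hm 0 v = v := by
  rw [heat_apply]
  simp only [heatIntegrand, zero_div, Real.exp_zero, neg_zero, sub_self, Real.sqrt_zero, zero_smul,
    dilateH1_one_zero]
  rw [integral_smul_const, integral_gauss, one_smul]

/-- Continuity holds on all of `ℝ`: for `τ ≤ 0` the dilation factor is clamped to `1` and the square
root of a nonpositive number is `0`, so `heat` is the identity there. -/
lemma continuous_heat (hm : 0 < m) (v : H1m N m) : Continuous fun τ => heat hm τ v := by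
  refine continuous_iff_continuousAt.2 fun τ₀ => ?_
  simp only [heat_apply]
  refine continuousAt_of_dominated (bound := fun z =>
    max (Real.exp ((τ₀ + 1) / 2)) 1 ^ N * (1 + max (Real.exp ((τ₀ + 1) / 2)) 1) * ‖v‖ *
      (gauss N z * √(2 ^ (2 * m) * weight N m z))) ?_ ?_
    ((integrable_gauss_mul_sqrt_weight hm).const_mul _) ?_
  · exact Eventually.of_forall fun τ => (integrable_heatIntegrand hm τ v).1
  · filter_upwards [gt_mem_nhds (show τ₀ < τ₀ + 1 by linarith)] with τ hτ
    refine Eventually.of_forall fun z => norm_heatIntegrand_le hm ?_ v z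
    gcongr
  · exact Eventually.of_forall fun z =>
      ((continuous_heatIntegrand hm v).comp (Continuous.prodMk_left z)).continuousAt

/-- The change of variables behind the representation of the semigroup. -/
lemma expL_eq_integral_gauss {τ : ℝ} (hτ : 0 < τ) (f : E N → ℝ) (ξ : E N) :
    expL τ f ξ = ∫ z, gauss N z * (max (Real.exp (τ / 2)) 1 ^ N *
      f (affMap (Real.exp (τ / 2)) (√(1 - Real.exp (-τ)) • z) ξ)) := by
  have ha := one_sub_exp_neg_pos hτ
  have hβ : max (Real.exp (τ / 2)) 1 = Real.exp (τ / 2) :=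
    max_eq_left (Real.one_le_exp (by positivity))
  rw [expL_of_pos hτ]
  unfold affMap
  rw [hβ]
  set β := Real.exp (τ / 2) with hβdef
  have hβ0 : 0 < β := Real.exp_pos _
  have hinv : Real.exp (-τ / 2) = β⁻¹ := by rw [hβdef, ← Real.exp_neg, neg_div]
  set a := 1 - Real.exp (-τ) with hadef
  have hb : 0 < √a := Real.sqrt_pos.2 ha
  have hsq : √a ^ 2 = a := Real.sq_sqrt ha.le
  let k : E N → ℝ := fun η => kernelL τ ξ η * f η
  -- The substitution is `η = β(ξ - √a z)`, under which `ξ - e^{-τ/2} η = √a z` and the kernel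
  -- becomes the standard Gaussian.
  have h1 : ∫ z, k (β • ξ - (β * √a) • z) = ((β * √a) ^ N)⁻¹ * ∫ η, k η := by
    rw [Measure.integral_comp_smul (μ := volume) (fun z => k (β • ξ - z)),
      integral_sub_left_eq_self k volume (β • ξ),
      finrank_euclideanSpace, Fintype.card_fin, abs_of_pos (by positivity), smul_eq_mul]
  have h2 : ∫ η, k η = (β * √a) ^ N * ∫ z, k (β • ξ - (β * √a) • z) := by
    rw [h1, mul_inv_cancel_left₀ (by positivity)]
  change ∫ η, k η = _
  rw [h2, ← integral_const_mul]
  refine integral_congr_ae (Eventually.of_forall fun z => ?_)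
  have h3 : β • ξ - (β * √a) • z = β • (ξ - √a • z) := by rw [smul_sub, smul_smul]
  have h4 : kernelL τ ξ (β • (ξ - √a • z)) = a ^ (-(N : ℝ) / 2) * gauss N z := by
    unfold kernelL gauss
    rw [hinv, smul_smul, inv_mul_cancel₀ hβ0.ne', one_smul, sub_sub_cancel, norm_smul,
      Real.norm_of_nonneg hb.le, mul_pow, ← hadef, hsq, Real.mul_rpow (by positivity) ha.le]
    have h5 : -(a * ‖z‖ ^ 2) / (4 * a) = -‖z‖ ^ 2 / 4 := by field_simp
    rw [h5]
    ring
  have h6 : √a ^ N * a ^ (-(N : ℝ) / 2) = 1 := by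
    rw [← Real.rpow_natCast, Real.sqrt_eq_rpow, ← Real.rpow_mul ha.le, ← Real.rpow_add ha]
    rw [show 1 / 2 * (N : ℝ) + -(N : ℝ) / 2 = 0 by ring, Real.rpow_zero]
  simp only [k]
  rw [h3, h4, mul_pow]
  linear_combination (gauss N z * β ^ N * f (β • (ξ - √a • z))) * h6

end HeatSemigroup

/-! ### Agreement with the kernel formula, and the semigroup law -/

section HeatIdentification

open Set Filter Topology

variable {N : ℕ} {m : ℝ}

lemma pos_of_half_lt (hm : (N : ℝ) / 2 < m) : 0 < m :=
  lt_of_le_of_lt (by positivity) hm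

lemma integrable_fn (hm : (N : ℝ) / 2 < m) (v : H1m N m) : Integrable (H1m.fn v) :=
  integrable_L2m hm (fstL N m v)

lemma stronglyMeasurable_fn (v : H1m N m) : StronglyMeasurable (H1m.fn v) :=
  Lp.stronglyMeasurable (fstL N m v)

lemma integrable_comp_affMap {f : E N → ℝ} (hf : Integrable f) (β : ℝ) (y : E N) :
    Integrable fun ξ => f (affMap β y ξ) := by
  have h := (hf.comp_smul (R := max β 1) (max_one_pos β).ne').comp_sub_right y
  exact h

lemma integrable_prod_gauss_comp_affMap {f : E N → ℝ} (hf : Integrable f)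
    (hfm : StronglyMeasurable f) {ψ : E N → ℝ} (hψ : Continuous ψ) {C : ℝ} (hC : ∀ ξ, ‖ψ ξ‖ ≤ C)
    (β s : ℝ) :
    Integrable (Function.uncurry fun z ξ : E N => ψ ξ * (gauss N z *
      (max β 1 ^ N * f (affMap β (s • z) ξ)))) (volume.prod volume) := by
  have hβ := max_one_pos β
  have hmeas : Continuous fun p : E N × E N => affMap β (s • p.1) p.2 := by
    unfold affMap; fun_prop
  have h0 : AEStronglyMeasurable (Function.uncurry fun z ξ : E N => gauss N z *
      (max β 1 ^ N * f (affMap β (s • z) ξ))) (volume.prod volume) := by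
    refine StronglyMeasurable.aestronglyMeasurable ?_
    exact (continuous_gauss.comp continuous_fst).stronglyMeasurable.mul
      ((hfm.comp_measurable hmeas.measurable).const_mul _)
  have h1 : Integrable (Function.uncurry fun z ξ : E N => gauss N z *
      (max β 1 ^ N * f (affMap β (s • z) ξ))) (volume.prod volume) := by
    rw [integrable_prod_iff h0]
    refine ⟨Eventually.of_forall fun z => ?_, ?_⟩
    · exact ((integrable_comp_affMap hf β (s • z)).const_mul (max β 1 ^ N)).const_mul (gauss N z)
    · have : (fun z : E N => ∫ ξ, ‖Function.uncurry (fun z ξ : E N => gauss N z *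
          (max β 1 ^ N * f (affMap β (s • z) ξ))) (z, ξ)‖) = fun z => gauss N z * ∫ ξ, ‖f ξ‖ := by
        funext z
        simp only [Function.uncurry_apply_pair, norm_mul, norm_pow, Real.norm_of_nonneg hβ.le,
          Real.norm_of_nonneg (gauss_nonneg z)]
        rw [integral_const_mul, integral_const_mul,
          integral_comp_affMap β (s • z) (fun ξ => ‖f ξ‖), smul_eq_mul,
          mul_inv_cancel_left₀ (by positivity)]
      rw [this]
      exact integrable_gauss.mul_const _
  exact h1.bdd_mul (hψ.comp continuous_snd).aestronglyMeasurable
    (Eventually.of_forall fun p => hC p.2)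

/-- `heat` is the semigroup `e^{τ𝓛}`. -/
theorem fn_heat (hm : (N : ℝ) / 2 < m) {τ : ℝ} (hτ : 0 ≤ τ) (v : H1m N m) :
    H1m.fn (heat (pos_of_half_lt hm) τ v) =ᵐ[volume] expL τ (H1m.fn v) := by
  have hm0 := pos_of_half_lt hm
  rcases hτ.eq_or_lt with rfl | hτ
  · rw [heat_zero]
    exact Eventually.of_forall fun ξ => by simp [expL]
  refine ae_eq_of_integral_contDiff_smul_eq (integrable_fn hm _).locallyIntegrable
    (integrable_expL hτ.le (integrable_fn hm v)).locallyIntegrable fun ψ hψ hc => ?_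
  -- A Bochner integral has no pointwise values to compare, so both sides are tested against `ψ`.
  -- That pairing is a bounded functional on the weighted `L²` space and passes under the Bochner
  -- integral; Fubini then exchanges `z` and `ξ`.
  obtain ⟨g, hg⟩ := exists_inner_eq_integral (m := m) ψ hψ.continuous hc
  obtain ⟨C, hC⟩ := hψ.continuous.bounded_above_of_compact_support hc
  set β := Real.exp (τ / 2)
  set s := √(1 - Real.exp (-τ))
  have h1 : ∀ u : L2m N m ℝ, ∫ ξ, ψ ξ • u ξ = ⟪g, u⟫ := fun u => by
    rw [real_inner_comm, ← hg u]
    simp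
  have h2 : ∀ z, ⟪g, fstL N m (heatIntegrand hm0 τ v z)⟫
      = ∫ ξ, ψ ξ * (gauss N z * (max β 1 ^ N * H1m.fn v (affMap β (s • z) ξ))) := fun z => by
    rw [← h1]
    refine integral_congr_ae ((volume_ac_weightMeasure (m := m)).ae_le ?_)
    unfold heatIntegrand
    rw [map_smul, fstL_dilateH1]
    filter_upwards [Lp.coeFn_smul (gauss N z) (max β 1 ^ N • dilate hm0 β (s • z) (fstL N m v)),
      Lp.coeFn_smul (max β 1 ^ N) (dilate hm0 β (s • z) (fstL N m v)),
      dilate_coeFn hm0 β (s • z) (fstL N m v)] with ξ e1 e2 e3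
    rw [e1, Pi.smul_apply, e2, Pi.smul_apply, e3]
    rfl
  calc ∫ ξ, ψ ξ • H1m.fn (heat hm0 τ v) ξ
      = ⟪g, fstL N m (∫ z, heatIntegrand hm0 τ v z)⟫ := h1 (fstL N m (heat hm0 τ v))
    _ = ∫ z, ⟪g, fstL N m (heatIntegrand hm0 τ v z)⟫ := by
        rw [← ContinuousLinearMap.integral_comp_comm _ (integrable_heatIntegrand hm0 τ v),
          integral_inner ((fstL N m).integrable_comp (integrable_heatIntegrand hm0 τ v))]
    _ = ∫ z, ∫ ξ, ψ ξ * (gauss N z * (max β 1 ^ N * H1m.fn v (affMap β (s • z) ξ))) :=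
        integral_congr_ae (Eventually.of_forall h2)
    _ = ∫ ξ, ∫ z, ψ ξ * (gauss N z * (max β 1 ^ N * H1m.fn v (affMap β (s • z) ξ))) :=
        integral_integral_swap (integrable_prod_gauss_comp_affMap (integrable_fn hm v)
          (stronglyMeasurable_fn v) hψ.continuous hC β s)
    _ = ∫ ξ, ψ ξ • expL τ (H1m.fn v) ξ := by
        refine integral_congr_ae (Eventually.of_forall fun ξ => ?_)
        simp only [smul_eq_mul]
        rw [integral_const_mul, expL_eq_integral_gauss hτ]

lemma heat_add (hm : (N : ℝ) / 2 < m) {σ τ : ℝ} (hσ : 0 ≤ σ) (hτ : 0 ≤ τ) (v : H1m N m) :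
    heat (pos_of_half_lt hm) (σ + τ) v
      = heat (pos_of_half_lt hm) σ (heat (pos_of_half_lt hm) τ v) := by
  rcases hσ.eq_or_lt with rfl | hσ
  · rw [zero_add, heat_zero]
  rcases hτ.eq_or_lt with rfl | hτ
  · rw [add_zero, heat_zero]
  refine H1m.ext_fn hm ?_
  refine (fn_heat hm (by positivity) v).trans ?_
  refine .symm ((fn_heat hm hσ.le _).trans ?_)
  refine (expL_congr_ae hσ.le (fn_heat hm hτ.le v)).trans ?_
  exact Eventually.of_forall fun ξ => expL_expL hσ hτ (integrable_fn hm v) ξ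

end HeatIdentification

/-! ### Young's inequality for integral operators -/

section Young

open Set Filter Topology

variable {α β : Type*} [MeasurableSpace α] [MeasurableSpace β]

/-- A form of Young's inequality for integral operators from `L^{2/q}` to `L²`. -/
theorem lintegral_sq_lintegral_mul_le {μ : Measure α} {ν : Measure β} [SFinite μ] [SFinite ν]
    {κ : α → β → ℝ≥0∞} (hκ : Measurable (Function.uncurry κ)) {h : β → ℝ≥0∞}
    (hh : AEMeasurable h ν) {q : ℝ} (hq : 1 < q) (hq2 : q < 2) {A B : ℝ≥0∞}
    (hA : ∀ x, ∫⁻ y, κ x y ^ (2 / (3 - q)) ∂ν ≤ A) (hB : ∀ y, ∫⁻ x, κ x y ^ (2 / (3 - q)) ∂μ ≤ B) :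
    ∫⁻ x, (∫⁻ y, κ x y * h y ∂ν) ^ (2 : ℝ) ∂μ
      ≤ A ^ (2 - q) * B * (∫⁻ y, h y ^ (2 / q) ∂ν) ^ q := by
  set r := 2 / (3 - q) with hr
  set p := 2 / q with hp
  have hr0 : 0 < r := by rw [hr]; exact div_pos two_pos (by linarith)
  have hp0 : 0 < p := by rw [hp]; positivity
  have hκx : ∀ x, Measurable (κ x) := fun x => hκ.comp measurable_prodMk_left
  -- Three-factor Hölder with exponents `1/2`, `(q-1)/2`, `(2-q)/2`, of sum `1`. The value of `r` is
  -- forced by Young's relation `1 + 1/2 = 1/p + 1/r` with `p = 2/q`.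
  have hsplit : ∀ k t : ℝ≥0∞,
      k * t = (k ^ r * t ^ p) ^ (1 / 2 : ℝ) * (t ^ p) ^ ((q - 1) / 2) * (k ^ r) ^ ((2 - q) / 2) := by
    intro k t
    rw [ENNReal.mul_rpow_of_nonneg _ _ (by norm_num)]
    simp only [← ENNReal.rpow_mul]
    have h1 : k ^ (r * (1 / 2)) * k ^ (r * ((2 - q) / 2)) = k := by
      rw [← ENNReal.rpow_add_of_nonneg _ _ (by positivity)
        (mul_nonneg hr0.le (by linarith)), hr]
      have : 2 / (3 - q) * (1 / 2) + 2 / (3 - q) * ((2 - q) / 2) = 1 := by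
        have : 3 - q ≠ 0 := by linarith
        field_simp
        ring
      rw [this, ENNReal.rpow_one]
    have h2 : t ^ (p * (1 / 2)) * t ^ (p * ((q - 1) / 2)) = t := by
      rw [← ENNReal.rpow_add_of_nonneg _ _ (by positivity)
        (mul_nonneg hp0.le (by linarith)), hp]
      have : 2 / q * (1 / 2) + 2 / q * ((q - 1) / 2) = 1 := by
        have : q ≠ 0 := by linarith
        field_simp
        ring
      rw [this, ENNReal.rpow_one]
    conv_lhs => rw [← h1, ← h2]
    ring
  have hpt : ∀ x, (∫⁻ y, κ x y * h y ∂ν) ^ (2 : ℝ) ≤ (∫⁻ y, κ x y ^ r * h y ^ p ∂ν) *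
      ((∫⁻ y, h y ^ p ∂ν) ^ (q - 1) * A ^ (2 - q)) := by
    intro x
    have h1 := ENNReal.lintegral_prod_norm_pow_le (μ := ν) (Finset.univ : Finset (Fin 3))
      (f := ![fun y => κ x y ^ r * h y ^ p, fun y => h y ^ p, fun y => κ x y ^ r])
      (p := ![1 / 2, (q - 1) / 2, (2 - q) / 2])
      (by
        intro i _
        fin_cases i
        · exact ((hκx x).pow_const r).aemeasurable.mul (hh.pow_const p)
        · exact hh.pow_const p
        · exact ((hκx x).pow_const r).aemeasurable)
      (by rw [Fin.sum_univ_three]; simp; ring)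
      (by
        intro i _
        fin_cases i
        · simp
        · simp; linarith
        · simp; linarith)
    simp only [Fin.prod_univ_three, Matrix.cons_val_zero, Matrix.cons_val_one,
      Matrix.cons_val_two, Matrix.tail_cons, Matrix.head_cons] at h1
    simp only [← hsplit] at h1
    have h2 := ENNReal.rpow_le_rpow h1 (zero_le_two (α := ℝ))
    refine h2.trans ?_
    rw [ENNReal.mul_rpow_of_nonneg _ _ zero_le_two, ENNReal.mul_rpow_of_nonneg _ _ zero_le_two]
    simp only [← ENNReal.rpow_mul]
    rw [show (1 / 2 * 2 : ℝ) = 1 by norm_num, show (q - 1) / 2 * 2 = q - 1 by ring,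
      show (2 - q) / 2 * 2 = 2 - q by ring, ENNReal.rpow_one, mul_assoc]
    gcongr
    exact hA x
  have hmeas : AEMeasurable (fun z : α × β => κ z.1 z.2 ^ r * h z.2 ^ p) (μ.prod ν) :=
    (hκ.pow_const r).aemeasurable.mul (hh.pow_const p).comp_snd
  calc ∫⁻ x, (∫⁻ y, κ x y * h y ∂ν) ^ (2 : ℝ) ∂μ
      ≤ ∫⁻ x, (∫⁻ y, κ x y ^ r * h y ^ p ∂ν) *
        ((∫⁻ y, h y ^ p ∂ν) ^ (q - 1) * A ^ (2 - q)) ∂μ := lintegral_mono hpt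
    _ = (∫⁻ x, ∫⁻ y, κ x y ^ r * h y ^ p ∂ν ∂μ) *
        ((∫⁻ y, h y ^ p ∂ν) ^ (q - 1) * A ^ (2 - q)) :=
        lintegral_mul_const'' _ hmeas.lintegral_prod_right'
    _ = (∫⁻ y, ∫⁻ x, κ x y ^ r * h y ^ p ∂μ ∂ν) *
        ((∫⁻ y, h y ^ p ∂ν) ^ (q - 1) * A ^ (2 - q)) := by
        rw [lintegral_lintegral_swap hmeas]
    _ ≤ (∫⁻ y, B * h y ^ p ∂ν) * ((∫⁻ y, h y ^ p ∂ν) ^ (q - 1) * A ^ (2 - q)) := by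
        gcongr with y
        have hy : Measurable fun x => κ x y := hκ.comp measurable_prodMk_right
        rw [lintegral_mul_const _ (hy.pow_const r)]
        gcongr
        exact hB y
    _ = A ^ (2 - q) * B * (∫⁻ y, h y ^ p ∂ν) ^ q := by
        rw [lintegral_const_mul'' _ (hh.pow_const p)]
        have : (∫⁻ y, h y ^ p ∂ν) ^ q = (∫⁻ y, h y ^ p ∂ν) * (∫⁻ y, h y ^ p ∂ν) ^ (q - 1) := by
          conv_rhs => rw [← ENNReal.rpow_one (∫⁻ y, h y ^ p ∂ν), ← ENNReal.rpow_mul, one_mul,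
            ← ENNReal.rpow_add_of_nonneg _ _ zero_le_one (by linarith)]
          rw [add_sub_cancel]
        rw [this]
        ring

end Young

/-! ### The weighted estimate for Gaussian kernels -/

section WeightedYoung

open Set Filter Topology

variable {N : ℕ} {m : ℝ}

lemma lintegral_exp_neg_norm_sub_sq_div {b : ℝ} (hb : 0 < b) (p : E N) :
    ∫⁻ ξ : E N, ENNReal.ofReal (Real.exp (-‖ξ - p‖ ^ 2 / b))
      = ENNReal.ofReal ((Real.pi * b) ^ ((N : ℝ) / 2)) := by
  rw [← ofReal_integral_eq_lintegral_ofReal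
    ((integrable_exp_neg_norm_sq_div hb).comp_sub_right p)
    (Eventually.of_forall fun _ => (Real.exp_pos _).le),
    integral_sub_right_eq_self (fun z : E N => Real.exp (-‖z‖ ^ 2 / b)) p,
    integral_exp_neg_norm_sq_div hb]

lemma lintegral_exp_neg_norm_sub_smul_sq_div {b c : ℝ} (hb : 0 < b) (hc : 0 < c) (ξ : E N) :
    ∫⁻ η : E N, ENNReal.ofReal (Real.exp (-‖ξ - c • η‖ ^ 2 / b))
      = ENNReal.ofReal ((c ^ N)⁻¹ * (Real.pi * b) ^ ((N : ℝ) / 2)) := by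
  have h1 := (integrable_exp_neg_norm_sq_div (N := N) hb).comp_sub_left ξ
  rw [← ofReal_integral_eq_lintegral_ofReal (h1.comp_smul hc.ne')
    (Eventually.of_forall fun _ => (Real.exp_pos _).le),
    Measure.integral_comp_smul (μ := volume) (fun z : E N => Real.exp (-‖ξ - z‖ ^ 2 / b)),
    integral_sub_left_eq_self (fun z : E N => Real.exp (-‖z‖ ^ 2 / b)) volume ξ,
    integral_exp_neg_norm_sq_div hb, finrank_euclideanSpace, Fintype.card_fin,
    abs_of_pos (by positivity), smul_eq_mul]

lemma sqrt_weight_le (hm : 0 < m) {c : ℝ} (hc : 0 ≤ c) (hc1 : c ≤ 1) (ξ η : E N) :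
    √(weight N m ξ) ≤ 2 ^ m * (√(weight N m (ξ - c • η)) * √(weight N m η)) := by
  have h1 : weight N m (c • η) ≤ weight N m η := by
    refine weight_mono hm ?_
    rw [norm_smul, Real.norm_of_nonneg hc]
    exact mul_le_of_le_one_left (norm_nonneg _) hc1
  have h2 := weight_add_le hm (ξ - c • η) (c • η)
  rw [sub_add_cancel] at h2
  have h3 := weight_pos N m (ξ - c • η)
  have h4 := weight_pos N m η
  rw [Real.sqrt_le_left (by positivity), mul_pow, mul_pow, Real.sq_sqrt h3.le, Real.sq_sqrt h4.le,
    ← Real.rpow_natCast, ← Real.rpow_mul (by norm_num)]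
  refine h2.trans ?_
  rw [show m * ((2 : ℕ) : ℝ) = 2 * m by push_cast; ring]
  gcongr

/-- As `r ≥ 1` and `g ≥ 0`, `e^{-rg} ≤ e^{-g}`; the `r`-th power of the Gaussian therefore needs no
integral of its own. -/
lemma lintegral_gaussian_rpow_le {α : Type*} [MeasurableSpace α] {μ : Measure α} {C r D : ℝ}
    (hC : 0 ≤ C) (hr : 1 ≤ r) {g : α → ℝ} (hg : ∀ x, 0 ≤ g x)
    (h : ∫⁻ x, ENNReal.ofReal (Real.exp (-g x)) ∂μ ≤ ENNReal.ofReal D) :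
    ∫⁻ x, ENNReal.ofReal (C * Real.exp (-g x)) ^ r ∂μ ≤ ENNReal.ofReal (C ^ r * D) := by
  calc ∫⁻ x, ENNReal.ofReal (C * Real.exp (-g x)) ^ r ∂μ
      ≤ ∫⁻ x, ENNReal.ofReal (C ^ r) * ENNReal.ofReal (Real.exp (-g x)) ∂μ := by
        refine lintegral_mono fun x => ?_
        rw [ENNReal.ofReal_rpow_of_nonneg (by positivity) (by linarith),
          Real.mul_rpow hC (Real.exp_pos _).le, ENNReal.ofReal_mul (by positivity)]
        gcongr
        rw [← Real.exp_mul]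
        refine Real.exp_le_exp.2 ?_
        nlinarith [hg x]
    _ = ENNReal.ofReal (C ^ r) * ∫⁻ x, ENNReal.ofReal (Real.exp (-g x)) ∂μ :=
        lintegral_const_mul' _ _ ENNReal.ofReal_ne_top
    _ ≤ _ := by
        rw [ENNReal.ofReal_mul (by positivity)]
        gcongr

/-- Weighted estimate for integral operators with a kernel of Gaussian type. -/
theorem eLpNorm_weightMeasure_le (hm : 0 < m) {q : ℝ} (hq : 1 < q) (hq2 : q < 2) {b c C : ℝ}
    (hb : 0 < b) (hc : 0 < c) (hc1 : c ≤ 1) (hC : 0 ≤ C) {F : Type*} [NormedAddCommGroup F]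
    {f : E N → ℝ} (hf : AEStronglyMeasurable f) {G : E N → F}
    (hG : ∀ ξ, ‖G ξ‖ₑ ≤ ∫⁻ η, ENNReal.ofReal (C * Real.exp (-‖ξ - c • η‖ ^ 2 / b) /
      √(weight N m (ξ - c • η))) * ‖f η‖ₑ) :
    eLpNorm G 2 (weightMeasure N m) ≤ ENNReal.ofReal (2 ^ m * C *
      ((c ^ N)⁻¹ ^ ((2 - q) / 2) * ((Real.pi * b) ^ ((N : ℝ) / 2)) ^ ((3 - q) / 2))) *
      eLpNorm f (ENNReal.ofReal (2 / q)) (weightMeasure N m) := by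
  set D := (Real.pi * b) ^ ((N : ℝ) / 2) with hD
  have hD0 : 0 < D := by positivity
  set p := 2 / q with hp
  have hp0 : 0 < p := by positivity
  have hp2 : p ≤ 2 := by rw [hp, div_le_iff₀ (by linarith)]; linarith
  set r := 2 / (3 - q) with hr
  have hr1 : 1 ≤ r := by rw [hr, le_div_iff₀ (by linarith)]; linarith
  let κ : E N → E N → ℝ≥0∞ := fun ξ η =>
    ENNReal.ofReal (2 ^ m * C * Real.exp (-(‖ξ - c • η‖ ^ 2 / b)))
  -- The weight at `ξ` is split by `sqrt_weight_le`: one part cancels the denominator of the kernel,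
  -- the other goes to `f`. What remains is Young's inequality for Lebesgue measure.
  let h : E N → ℝ≥0∞ := fun η => ENNReal.ofReal (√(weight N m η)) * ‖f η‖ₑ
  have hκ : Measurable (Function.uncurry κ) := by
    refine Measurable.ennreal_ofReal (Continuous.measurable ?_)
    fun_prop
  have hh : AEMeasurable h volume :=
    (measurable_weight N m).sqrt.ennreal_ofReal.aemeasurable.mul hf.enorm
  have hpt : ∀ ξ, ENNReal.ofReal (weight N m ξ) * ‖G ξ‖ₑ ^ (2 : ℝ)
      ≤ (∫⁻ η, κ ξ η * h η) ^ (2 : ℝ) := by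
    intro ξ
    have h1 : ENNReal.ofReal (√(weight N m ξ)) * ‖G ξ‖ₑ ≤ ∫⁻ η, κ ξ η * h η := by
      refine (mul_le_mul_right (hG ξ) _).trans ?_
      rw [← lintegral_const_mul' _ _ ENNReal.ofReal_ne_top]
      refine lintegral_mono fun η => ?_
      simp only [κ, h]
      rw [← mul_assoc, ← mul_assoc, ← ENNReal.ofReal_mul (Real.sqrt_nonneg _),
        ← ENNReal.ofReal_mul (by positivity)]
      refine mul_le_mul_left (ENNReal.ofReal_le_ofReal ?_) _
      have h3 : 0 < √(weight N m (ξ - c • η)) := Real.sqrt_pos.2 (weight_pos N m _)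
      rw [mul_div_assoc', div_le_iff₀ h3, neg_div]
      calc _ ≤ (2 ^ m * (√(weight N m (ξ - c • η)) * √(weight N m η))) *
            (C * Real.exp (-(‖ξ - c • η‖ ^ 2 / b))) := by
            gcongr
            exact sqrt_weight_le hm hc.le hc1 ξ η
        _ = _ := by ring
    refine le_trans (le_of_eq ?_) (ENNReal.rpow_le_rpow h1 zero_le_two)
    rw [ENNReal.mul_rpow_of_nonneg _ _ zero_le_two,
      ENNReal.ofReal_rpow_of_nonneg (Real.sqrt_nonneg _) zero_le_two, Real.rpow_two,
      Real.sq_sqrt (weight_pos N m ξ).le]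
  have hC' : 0 ≤ 2 ^ m * C := by positivity
  have hY := lintegral_sq_lintegral_mul_le (μ := volume) (ν := volume) hκ hh hq hq2
    (A := ENNReal.ofReal ((2 ^ m * C) ^ r * ((c ^ N)⁻¹ * D)))
    (B := ENNReal.ofReal ((2 ^ m * C) ^ r * D))
    (fun ξ => lintegral_gaussian_rpow_le hC' hr1 (fun η => by positivity)
      (by simp only [← neg_div]; exact (lintegral_exp_neg_norm_sub_smul_sq_div hb hc ξ).le))
    (fun η => lintegral_gaussian_rpow_le hC' hr1 (fun ξ => by positivity)
      (by simp only [← neg_div]; exact (lintegral_exp_neg_norm_sub_sq_div hb (c • η)).le))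
  -- As `p ≤ 2` and the weight is at least `1`, its power `p/2` is bounded by the weight itself.
  have hhp : (∫⁻ η, h η ^ p) ≤ ∫⁻ η, ‖f η‖ₑ ^ p ∂weightMeasure N m := by
    rw [lintegral_weightMeasure]
    refine lintegral_mono fun η => ?_
    simp only [h]
    rw [ENNReal.mul_rpow_of_nonneg _ _ hp0.le,
      ENNReal.ofReal_rpow_of_nonneg (Real.sqrt_nonneg _) hp0.le]
    gcongr
    have hw := one_le_weight N m η
    have h1 : 1 ≤ √(weight N m η) := Real.one_le_sqrt.2 hw
    calc √(weight N m η) ^ p ≤ √(weight N m η) ^ (2 : ℝ) :=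
          Real.rpow_le_rpow_of_exponent_le h1 hp2
      _ = weight N m η := by rw [Real.rpow_two, Real.sq_sqrt (by linarith)]
  have hconst : ENNReal.ofReal ((2 ^ m * C) ^ r * ((c ^ N)⁻¹ * D)) ^ (2 - q) *
      ENNReal.ofReal ((2 ^ m * C) ^ r * D)
      = ENNReal.ofReal (2 ^ m * C * ((c ^ N)⁻¹ ^ ((2 - q) / 2) * D ^ ((3 - q) / 2))) ^ (2 : ℝ) := by
    rw [ENNReal.ofReal_rpow_of_nonneg (by positivity) (by linarith),
      ENNReal.ofReal_rpow_of_nonneg (by positivity) (by norm_num),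
      ← ENNReal.ofReal_mul (by positivity)]
    congr 1
    have e1 : (2 ^ m * C) ^ (2 : ℝ) = ((2 ^ m * C) ^ r) ^ (2 - q) * (2 ^ m * C) ^ r := by
      rw [← Real.rpow_mul hC', ← Real.rpow_add_of_nonneg hC'
        (mul_nonneg (by linarith) (by linarith)) (by linarith)]
      congr 1
      have : 3 - q ≠ 0 := by linarith
      rw [hr]; field_simp; ring
    have e2 : D ^ (2 - q) * D = D ^ (3 - q) := by
      conv_lhs => rw [← Real.rpow_one D, ← Real.rpow_mul hD0.le, one_mul, ← Real.rpow_add hD0]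
      congr 1; ring
    have hcN : 0 ≤ (c ^ N)⁻¹ := by positivity
    generalize (c ^ N)⁻¹ = c' at hcN
    generalize 2 ^ m * C = P at hC' e1
    rw [Real.mul_rpow (by positivity) (by positivity), Real.mul_rpow (by positivity) hD0.le,
      Real.mul_rpow hC' (by positivity), Real.mul_rpow (by positivity) (by positivity),
      ← Real.rpow_mul hcN, ← Real.rpow_mul hD0.le, e1,
      show (2 - q) / 2 * 2 = 2 - q by ring, show (3 - q) / 2 * 2 = 3 - q by ring, ← e2]
    ring
  have hfin : ∫⁻ ξ, ‖G ξ‖ₑ ^ (2 : ℝ) ∂weightMeasure N m ≤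
      ENNReal.ofReal (2 ^ m * C * ((c ^ N)⁻¹ ^ ((2 - q) / 2) * D ^ ((3 - q) / 2))) ^ (2 : ℝ) *
      (∫⁻ η, ‖f η‖ₑ ^ p ∂weightMeasure N m) ^ q := by
    rw [lintegral_weightMeasure, ← hconst]
    refine (lintegral_mono hpt).trans (hY.trans ?_)
    gcongr
  rw [eLpNorm_eq_lintegral_rpow_enorm_toReal (by norm_num) (by norm_num),
    eLpNorm_eq_lintegral_rpow_enorm_toReal (by simpa using hp0) (by simp),
    ENNReal.toReal_ofReal hp0.le, ENNReal.toReal_ofNat]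
  refine (ENNReal.rpow_le_rpow hfin (by norm_num)).trans_eq ?_
  rw [ENNReal.mul_rpow_of_nonneg _ _ (by norm_num), ← ENNReal.rpow_mul, ← ENNReal.rpow_mul]
  congr 2
  · norm_num
  · rw [hp]; field_simp

end WeightedYoung

/-! ### Gaussian bounds for the kernel and the weak gradient of `e^{τ𝓛} f` -/

section KernelGradient

open Set Filter Topology

variable {N : ℕ} {m : ℝ}

/-- The gradient of the kernel of `e^{τ𝓛}` in its first variable. -/
def gradKernelL (τ : ℝ) (ξ η : E N) : E N :=
  (kernelL τ ξ η * (-2 / (4 * (1 - Real.exp (-τ))))) • (ξ - Real.exp (-τ / 2) • η)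

lemma hasFDerivAt_kernelL (τ : ℝ) (ξ η : E N) :
    HasFDerivAt (fun ξ => kernelL τ ξ η) (innerSL ℝ (gradKernelL τ ξ η)) ξ := by
  refine (hasFDerivAt_gaussian _ _ _ ξ).congr_fderiv ?_
  rw [gradKernelL, map_smul]
  rfl

lemma continuous_gradKernelL (τ : ℝ) :
    Continuous fun p : E N × E N => gradKernelL τ p.1 p.2 := by
  unfold gradKernelL
  exact ((continuous_kernelL τ).mul continuous_const).smul (by fun_prop)

/-- The kernel and its gradient, with the weight, are bounded by a Gaussian. -/
lemma exists_kernelL_le (N : ℕ) (hm : 0 < m) : ∃ C : ℝ, 0 < C ∧ ∀ τ, 0 < τ → ∀ ξ η : E N,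
    kernelL τ ξ η ≤ C * (1 - Real.exp (-τ)) ^ (-((N : ℝ) + 1) / 2) *
      Real.exp (-‖ξ - Real.exp (-τ / 2) • η‖ ^ 2 / (8 * (1 - Real.exp (-τ)))) /
        √(weight N m (ξ - Real.exp (-τ / 2) • η)) ∧
    ‖gradKernelL τ ξ η‖ ≤ C * (1 - Real.exp (-τ)) ^ (-((N : ℝ) + 1) / 2) *
      Real.exp (-‖ξ - Real.exp (-τ / 2) • η‖ ^ 2 / (8 * (1 - Real.exp (-τ)))) /
        √(weight N m (ξ - Real.exp (-τ / 2) • η)) := by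
  obtain ⟨C, hC0, hC⟩ := exists_weight_le_exp (N := N) hm
  refine ⟨C, hC0, fun τ hτ ξ η => ?_⟩
  have ha := one_sub_exp_neg_pos hτ
  have ha1 := one_sub_exp_neg_le_one τ
  have hK0 := kernelL_pos hτ ξ η
  have hG : ‖gradKernelL τ ξ η‖ = kernelL τ ξ η *
      (‖ξ - Real.exp (-τ / 2) • η‖ / (2 * (1 - Real.exp (-τ)))) := by
    rw [gradKernelL, norm_smul, norm_mul, Real.norm_of_nonneg hK0.le, norm_div, norm_neg,
      Real.norm_of_nonneg (by positivity : 0 ≤ 4 * (1 - Real.exp (-τ))), Real.norm_two]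
    field_simp
    ring
  rw [hG]
  unfold kernelL at hK0 ⊢
  generalize ξ - Real.exp (-τ / 2) • η = z at *
  generalize 1 - Real.exp (-τ) = a at *
  set K := (4 * Real.pi * a) ^ (-(N : ℝ) / 2) * Real.exp (-‖z‖ ^ 2 / (4 * a)) with hK
  have hb : 0 < √a := Real.sqrt_pos.2 ha
  have hb1 : √a ≤ 1 := Real.sqrt_le_one.2 ha1
  have hsq : √a * √a = a := Real.mul_self_sqrt ha.le
  have hw : 0 < √(weight N m z) := Real.sqrt_pos.2 (weight_pos N m z)
  -- The polynomial bound is used at the rescaled point `z/√a`; since `a ≤ 1`, rescaling only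
  -- increases the weight. The price is half of the Gaussian exponent, from `4a` to `8a`.
  have h1 : (1 + ‖z‖ / √a) * √(weight N m z) ≤ C * Real.exp (‖z‖ ^ 2 / (8 * a)) := by
    have h2 := hC ((√a)⁻¹ • z)
    have hn : ‖(√a)⁻¹ • z‖ = ‖z‖ / √a := by
      rw [norm_smul, norm_inv, Real.norm_of_nonneg hb.le, inv_mul_eq_div]
    have h3 : weight N m z ≤ weight N m ((√a)⁻¹ • z) := by
      refine weight_mono hm ?_
      rw [hn, le_div_iff₀ hb]
      exact mul_le_of_le_one_right (norm_nonneg _) hb1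
    have h4 : √(weight N m z) ≤ weight N m z := by
      rw [Real.sqrt_le_left (weight_pos N m z).le]
      nlinarith [one_le_weight N m z]
    rw [hn, div_pow, Real.sq_sqrt ha.le] at h2
    calc _ ≤ (1 + ‖z‖ / √a) * weight N m ((√a)⁻¹ • z) := by gcongr; exact h4.trans h3
      _ ≤ _ := h2
      _ = _ := by rw [div_div, mul_comm a 8]
  have h5 : K * (1 + ‖z‖ / √a) * √(weight N m z) ≤
      a ^ (-(N : ℝ) / 2) * (C * Real.exp (-‖z‖ ^ 2 / (8 * a))) := by
    have h6 : (4 * Real.pi * a) ^ (-(N : ℝ) / 2) ≤ a ^ (-(N : ℝ) / 2) := by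
      refine Real.rpow_le_rpow_of_nonpos ha ?_ ?_
      · nlinarith [Real.pi_gt_three]
      · rw [neg_div, neg_nonpos]; positivity
    have h7 : Real.exp (-‖z‖ ^ 2 / (4 * a)) * Real.exp (‖z‖ ^ 2 / (8 * a))
        = Real.exp (-‖z‖ ^ 2 / (8 * a)) := by
      rw [← Real.exp_add]
      congr 1
      field_simp
      ring
    rw [mul_assoc, hK, ← h7]
    calc _ ≤ a ^ (-(N : ℝ) / 2) * Real.exp (-‖z‖ ^ 2 / (4 * a)) *
          (C * Real.exp (‖z‖ ^ 2 / (8 * a))) := by gcongr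
      _ = _ := by ring
  -- The extra factor `a^{-1/2}` is what one derivative costs; the bound for the kernel itself
  -- accepts the same loss because `a ≤ 1`.
  have h8 : a ^ (-((N : ℝ) + 1) / 2) = a ^ (-(N : ℝ) / 2) * (√a)⁻¹ := by
    rw [Real.sqrt_eq_rpow, ← Real.rpow_neg ha.le, ← Real.rpow_add ha]
    congr 1
    ring
  have h9 : K * (1 + ‖z‖ / √a) * (√a)⁻¹ ≤
      C * a ^ (-((N : ℝ) + 1) / 2) * Real.exp (-‖z‖ ^ 2 / (8 * a)) / √(weight N m z) := by
    rw [le_div_iff₀ hw, h8]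
    calc _ = K * (1 + ‖z‖ / √a) * √(weight N m z) * (√a)⁻¹ := by ring
      _ ≤ a ^ (-(N : ℝ) / 2) * (C * Real.exp (-‖z‖ ^ 2 / (8 * a))) * (√a)⁻¹ := by gcongr
      _ = _ := by ring
  have h10 : 1 ≤ (√a)⁻¹ := (one_le_inv₀ hb).2 hb1
  have h11 : 0 ≤ ‖z‖ / √a := by positivity
  refine ⟨le_trans ?_ h9, le_trans ?_ h9⟩
  · rw [mul_assoc]
    refine le_mul_of_one_le_right hK0.le ?_
    nlinarith
  · refine le_trans (mul_le_mul_of_nonneg_left ?_ hK0.le) (mul_assoc K _ _).ge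
    have h12 : ‖z‖ / (2 * a) = ‖z‖ / √a * (√a)⁻¹ / 2 := by
      rw [show 2 * a = 2 * (√a * √a) by rw [hsq]]; field_simp
    rw [h12]
    have : 0 ≤ ‖z‖ / √a * (√a)⁻¹ := by positivity
    nlinarith

lemma exists_norm_gradKernelL_le {τ : ℝ} (hτ : 0 < τ) :
    ∃ C : ℝ, ∀ ξ η : E N, ‖gradKernelL τ ξ η‖ ≤ C := by
  obtain ⟨C, hC0, hC⟩ := exists_kernelL_le N (m := 1) one_pos
  have ha := one_sub_exp_neg_pos hτ
  refine ⟨C * (1 - Real.exp (-τ)) ^ (-((N : ℝ) + 1) / 2), fun ξ η => (hC τ hτ ξ η).2.trans ?_⟩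
  refine (div_le_self (by positivity) (Real.one_le_sqrt.2 (one_le_weight _ _ _))).trans ?_
  refine mul_le_of_le_one_right (by positivity) (Real.exp_le_one_iff.2 ?_)
  rw [neg_div, neg_nonpos]
  positivity

/-- The gradient of `e^{τ𝓛} f`. -/
def gradExpL (τ : ℝ) (f : E N → ℝ) (ξ : E N) : E N := ∫ η, f η • gradKernelL τ ξ η

lemma integrable_smul_gradKernelL {τ : ℝ} (hτ : 0 < τ) {f : E N → ℝ} (hf : Integrable f)
    (ξ : E N) : Integrable fun η => f η • gradKernelL τ ξ η := by
  obtain ⟨C, hC⟩ := exists_norm_gradKernelL_le (N := N) hτ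
  exact hf.smul_bdd C ((continuous_gradKernelL τ).comp
    (Continuous.prodMk_right ξ)).aestronglyMeasurable (Eventually.of_forall fun η => hC ξ η)

lemma aestronglyMeasurable_gradExpL (τ : ℝ) {f : E N → ℝ} (hf : Integrable f) :
    AEStronglyMeasurable (gradExpL τ f) := by
  have h : AEStronglyMeasurable (fun p : E N × E N => f p.2 • gradKernelL τ p.1 p.2)
      (volume.prod volume) :=
    hf.1.comp_snd.smul (continuous_gradKernelL τ).aestronglyMeasurable
  exact h.integral_prod_right'

lemma integral_kernelL_mul_fderiv (τ : ℝ) {φ : E N → ℝ} (hφ : ContDiff ℝ ∞ φ)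
    (hc : HasCompactSupport φ) (e η : E N) :
    ∫ ξ, kernelL τ ξ η * fderiv ℝ φ ξ e = -∫ ξ, ⟪gradKernelL τ ξ η, e⟫ * φ ξ := by
  have hφ' : Continuous fun ξ => fderiv ℝ φ ξ e :=
    (hφ.continuous_fderiv (by simp)).clm_apply continuous_const
  have hd : ∀ ξ, fderiv ℝ (fun ξ => kernelL τ ξ η) ξ e = ⟪gradKernelL τ ξ η, e⟫ := fun ξ => by
    rw [(hasFDerivAt_kernelL τ ξ η).fderiv, innerSL_apply_apply]
  have hKc : Continuous fun ξ : E N => kernelL τ ξ η :=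
    Continuous.comp (g := fun p : E N × E N => kernelL τ p.1 p.2) (f := fun ξ => (ξ, η))
      (continuous_kernelL τ) (by fun_prop)
  have hGc : Continuous fun ξ : E N => ⟪gradKernelL τ ξ η, e⟫ :=
    ((continuous_gradKernelL τ).comp (Continuous.prodMk_left η)).inner continuous_const
  have h1 : Integrable (fun ξ => ⟪gradKernelL τ ξ η, e⟫ * φ ξ) :=
    (hGc.mul hφ.continuous).integrable_of_hasCompactSupport hc.mul_left
  have h2 : Integrable (fun ξ => kernelL τ ξ η * fderiv ℝ φ ξ e) :=
    (hKc.mul hφ').integrable_of_hasCompactSupport (hc.fderiv_apply ℝ e).mul_left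
  have h3 : Integrable (fun ξ => kernelL τ ξ η * φ ξ) :=
    (hKc.mul hφ.continuous).integrable_of_hasCompactSupport hc.mul_left
  have hdiff : Differentiable ℝ φ := hφ.differentiable (by simp)
  have hdiff' : Differentiable ℝ fun ξ : E N => kernelL τ ξ η := fun ξ =>
    (hasFDerivAt_kernelL τ ξ η).differentiableAt
  have h4 : (fun ξ => ⟪gradKernelL τ ξ η, e⟫ * φ ξ)
      = fun ξ => fderiv ℝ (fun ξ => kernelL τ ξ η) ξ e * φ ξ := funext fun ξ => by rw [hd]
  rw [h4] at h1 ⊢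
  exact integral_mul_fderiv_eq_neg_fderiv_mul_of_integrable h1 h2 h3
    (fun ξ _ => hdiff' ξ) (fun ξ _ => hdiff ξ)

/-- Integration by parts in `ξ` for each fixed `η`, between two applications of Fubini; the
derivative falls on the smooth kernel, so `f` need only be integrable. -/
theorem isWeakGradient_expL {τ : ℝ} (hτ : 0 < τ) {f : E N → ℝ} (hf : Integrable f) :
    IsWeakGradient (expL τ f) (gradExpL τ f) := by
  intro φ hφ hc e
  obtain ⟨C, hC⟩ := exists_norm_gradKernelL_le (N := N) hτ
  have hφ' : Continuous fun ξ => fderiv ℝ φ ξ e :=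
    (hφ.continuous_fderiv (by simp)).clm_apply continuous_const
  obtain ⟨C', hC'⟩ := hφ'.bounded_above_of_compact_support (hc.fderiv_apply ℝ e)
  have hφi : Integrable φ := hφ.continuous.integrable_of_hasCompactSupport hc
  have hφ'i : Integrable fun ξ => fderiv ℝ φ ξ e :=
    hφ'.integrable_of_hasCompactSupport (hc.fderiv_apply ℝ e)
  have hGc : Continuous fun p : E N × E N => ⟪gradKernelL τ p.1 p.2, e⟫ :=
    (continuous_gradKernelL τ).inner continuous_const
  have hGb : ∀ ξ η : E N, ‖⟪gradKernelL τ ξ η, e⟫‖ ≤ C * ‖e‖ := fun ξ η =>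
    (norm_inner_le_norm _ _).trans (by gcongr; exact hC ξ η)
  have hI1 : Integrable (Function.uncurry fun ξ η : E N =>
      fderiv ℝ φ ξ e * (kernelL τ ξ η * f η)) (volume.prod volume) :=
    (integrable_prod_kernelL_mul hτ hf).bdd_mul (hφ'.comp continuous_fst).aestronglyMeasurable
      (Eventually.of_forall fun p => hC' p.1)
  have hI2 : Integrable (Function.uncurry fun ξ η : E N =>
      ⟪gradKernelL τ ξ η, e⟫ * (φ ξ * f η)) (volume.prod volume) :=
    (hφi.mul_prod hf).bdd_mul hGc.aestronglyMeasurable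
      (Eventually.of_forall fun p => hGb p.1 p.2)
  have hparts := fun η => integral_kernelL_mul_fderiv (N := N) τ hφ hc e η
  calc ∫ ξ, expL τ f ξ * fderiv ℝ φ ξ e
      = ∫ ξ, ∫ η, fderiv ℝ φ ξ e * (kernelL τ ξ η * f η) := by
        refine integral_congr_ae (Eventually.of_forall fun ξ => ?_)
        simp only
        rw [expL_of_pos hτ, integral_const_mul, mul_comm]
    _ = ∫ η, ∫ ξ, fderiv ℝ φ ξ e * (kernelL τ ξ η * f η) := integral_integral_swap hI1
    _ = ∫ η, -∫ ξ, ⟪gradKernelL τ ξ η, e⟫ * (φ ξ * f η) := by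
        refine integral_congr_ae (Eventually.of_forall fun η => ?_)
        have h1 : ∀ ξ, fderiv ℝ φ ξ e * (kernelL τ ξ η * f η)
            = kernelL τ ξ η * fderiv ℝ φ ξ e * f η := fun ξ => by ring
        simp only [h1, ← mul_assoc]
        rw [integral_mul_const, integral_mul_const, hparts, neg_mul]
    _ = -∫ ξ, ∫ η, ⟪gradKernelL τ ξ η, e⟫ * (φ ξ * f η) := by
        rw [integral_neg, integral_integral_swap hI2]
    _ = -∫ ξ, ⟪gradExpL τ f ξ, e⟫ * φ ξ := by
        congr 1
        refine integral_congr_ae (Eventually.of_forall fun ξ => ?_)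
        simp only
        rw [gradExpL, real_inner_comm, ← integral_inner (integrable_smul_gradKernelL hτ hf ξ),
          ← integral_mul_const]
        refine integral_congr_ae (Eventually.of_forall fun η => ?_)
        simp only
        rw [inner_smul_right, real_inner_comm]
        ring

end KernelGradient

/-! ### Smoothing from the weighted `L^{2/q}` space to `H¹_m` -/

section Smoothing

open Set Filter Topology

variable {N : ℕ} {m q : ℝ}

/-- Smoothing estimate for `e^{τ𝓛}` from the weighted `L^{2/q}` space to the weighted `H¹` space. -/
theorem exists_eLpNorm_expL_le (N : ℕ) (hm : 0 < m) (hq : 1 < q) (hq2 : q < 2) :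
    ∃ C : ℝ, 0 ≤ C ∧ ∀ τ, 0 < τ → ∀ f : E N → ℝ, Integrable f →
      eLpNorm (expL τ f) 2 (weightMeasure N m) ≤ ENNReal.ofReal (C * Real.exp (τ / 2) ^ N *
        (1 - Real.exp (-τ)) ^ (-(1 / 2 + N * (q - 1) / 4))) *
        eLpNorm f (ENNReal.ofReal (2 / q)) (weightMeasure N m) ∧
      eLpNorm (gradExpL τ f) 2 (weightMeasure N m) ≤ ENNReal.ofReal (C * Real.exp (τ / 2) ^ N *
        (1 - Real.exp (-τ)) ^ (-(1 / 2 + N * (q - 1) / 4))) *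
        eLpNorm f (ENNReal.ofReal (2 / q)) (weightMeasure N m) := by
  obtain ⟨C, hC0, hC⟩ := exists_kernelL_le N hm
  refine ⟨2 ^ m * C * ((Real.pi * 8) ^ ((N : ℝ) / 2)) ^ ((3 - q) / 2), by positivity,
    fun τ hτ f hf => ?_⟩
  have ha := one_sub_exp_neg_pos hτ
  have hc1 : Real.exp (-τ / 2) ≤ 1 := Real.exp_le_one_iff.2 (by linarith)
  have hC' : 0 ≤ C * (1 - Real.exp (-τ)) ^ (-((N : ℝ) + 1) / 2) := by positivity
  -- The exponent of `1 - e^{-τ}` is `-(N+1)/2` from the kernel bound plus `N(3-q)/4` from Young's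
  -- inequality, in total `-(1/2 + N(q-1)/4)`.
  have hconst : 2 ^ m * (C * (1 - Real.exp (-τ)) ^ (-((N : ℝ) + 1) / 2)) *
      ((Real.exp (-τ / 2) ^ N)⁻¹ ^ ((2 - q) / 2) *
        ((Real.pi * (8 * (1 - Real.exp (-τ)))) ^ ((N : ℝ) / 2)) ^ ((3 - q) / 2)) ≤
      2 ^ m * C * ((Real.pi * 8) ^ ((N : ℝ) / 2)) ^ ((3 - q) / 2) * Real.exp (τ / 2) ^ N *
        (1 - Real.exp (-τ)) ^ (-(1 / 2 + N * (q - 1) / 4)) := by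
    have h1 : (Real.exp (-τ / 2) ^ N)⁻¹ = Real.exp (τ / 2) ^ N := by
      rw [← inv_pow, ← Real.exp_neg]
      congr 2
      ring
    have h2 : (1 : ℝ) ≤ Real.exp (τ / 2) ^ N := one_le_pow₀ (Real.one_le_exp (by positivity))
    have h3 : (Real.exp (τ / 2) ^ N) ^ ((2 - q) / 2) ≤ Real.exp (τ / 2) ^ N := by
      conv_rhs => rw [← Real.rpow_one (Real.exp (τ / 2) ^ N)]
      exact Real.rpow_le_rpow_of_exponent_le h2 (by linarith)
    rw [h1]
    generalize 1 - Real.exp (-τ) = a at ha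
    have h4 : a ^ (-((N : ℝ) + 1) / 2) * ((Real.pi * (8 * a)) ^ ((N : ℝ) / 2)) ^ ((3 - q) / 2)
        = ((Real.pi * 8) ^ ((N : ℝ) / 2)) ^ ((3 - q) / 2) *
          a ^ (-(1 / 2 + N * (q - 1) / 4)) := by
      rw [← mul_assoc, Real.mul_rpow (by positivity) ha.le, Real.mul_rpow (by positivity)
        (by positivity), ← Real.rpow_mul ha.le, mul_left_comm, ← Real.rpow_add ha]
      congr 2
      ring
    calc _ = 2 ^ m * C * (Real.exp (τ / 2) ^ N) ^ ((2 - q) / 2) * (a ^ (-((N : ℝ) + 1) / 2) *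
          ((Real.pi * (8 * a)) ^ ((N : ℝ) / 2)) ^ ((3 - q) / 2)) := by ring
      _ = 2 ^ m * C * (Real.exp (τ / 2) ^ N) ^ ((2 - q) / 2) *
          (((Real.pi * 8) ^ ((N : ℝ) / 2)) ^ ((3 - q) / 2) *
          a ^ (-(1 / 2 + N * (q - 1) / 4))) := by rw [h4]
      _ ≤ 2 ^ m * C * Real.exp (τ / 2) ^ N *
          (((Real.pi * 8) ^ ((N : ℝ) / 2)) ^ ((3 - q) / 2) *
          a ^ (-(1 / 2 + N * (q - 1) / 4))) := by gcongr
      _ = _ := by ring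
  constructor
  · refine (eLpNorm_weightMeasure_le hm hq hq2 (b := 8 * (1 - Real.exp (-τ))) (by positivity)
      (Real.exp_pos (-τ / 2)) hc1 hC' hf.1 fun ξ => ?_).trans
      (mul_le_mul_left (ENNReal.ofReal_le_ofReal hconst) _)
    rw [expL_of_pos hτ]
    refine (enorm_integral_le_lintegral_enorm _).trans (lintegral_mono fun η => ?_)
    rw [enorm_mul]
    gcongr
    rw [Real.enorm_of_nonneg (kernelL_pos hτ ξ η).le]
    exact ENNReal.ofReal_le_ofReal (hC τ hτ ξ η).1
  · refine (eLpNorm_weightMeasure_le hm hq hq2 (b := 8 * (1 - Real.exp (-τ))) (by positivity)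
      (Real.exp_pos (-τ / 2)) hc1 hC' hf.1 fun ξ => ?_).trans
      (mul_le_mul_left (ENNReal.ofReal_le_ofReal hconst) _)
    refine (enorm_integral_le_lintegral_enorm _).trans (lintegral_mono fun η => ?_)
    rw [enorm_smul, mul_comm]
    gcongr
    rw [← ofReal_norm]
    exact ENNReal.ofReal_le_ofReal (hC τ hτ ξ η).2

/-- The domain of the smoothing operators. -/
abbrev LqM (N : ℕ) (m q : ℝ) : Type := Lp ℝ (ENNReal.ofReal (2 / q)) (weightMeasure N m)

lemma integrable_LqM (hm : (N : ℝ) / 2 < m) (hq : 1 < q) (hq2 : q < 2) (f : LqM N m q) :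
    Integrable f :=
  integrable_of_memLp_weightMeasure hm (by rw [le_div_iff₀ (by linarith)]; linarith)
    (by rw [div_le_iff₀ (by linarith)]; linarith) (Lp.memLp f)

lemma memLp_expL (hm : (N : ℝ) / 2 < m) (hq : 1 < q) (hq2 : q < 2) {τ : ℝ} (hτ : 0 < τ)
    (f : LqM N m q) : MemLp (expL τ f) 2 (weightMeasure N m) := by
  obtain ⟨C, -, hC⟩ := exists_eLpNorm_expL_le N (pos_of_half_lt hm) hq hq2
  have hf := integrable_LqM hm hq hq2 f
  exact ⟨(integrable_expL hτ.le hf).1.mono_ac weightMeasure_ac_volume,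
    (hC τ hτ f hf).1.trans_lt (ENNReal.mul_lt_top ENNReal.ofReal_lt_top (Lp.memLp f).2)⟩

lemma memLp_gradExpL (hm : (N : ℝ) / 2 < m) (hq : 1 < q) (hq2 : q < 2) {τ : ℝ} (hτ : 0 < τ)
    (f : LqM N m q) : MemLp (gradExpL τ f) 2 (weightMeasure N m) := by
  obtain ⟨C, -, hC⟩ := exists_eLpNorm_expL_le N (pos_of_half_lt hm) hq hq2
  have hf := integrable_LqM hm hq hq2 f
  exact ⟨(aestronglyMeasurable_gradExpL τ hf).mono_ac weightMeasure_ac_volume,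
    (hC τ hτ f hf).2.trans_lt (ENNReal.mul_lt_top ENNReal.ofReal_lt_top (Lp.memLp f).2)⟩

/-- `e^{τ𝓛} f` as an element of `H¹_m`. -/
def smoothingFun (hm : (N : ℝ) / 2 < m) (hq : 1 < q) (hq2 : q < 2) {τ : ℝ} (hτ : 0 < τ)
    (f : LqM N m q) : H1m N m :=
  H1m.mk ((memLp_expL hm hq hq2 hτ f).toLp _) ((memLp_gradExpL hm hq hq2 hτ f).toLp _)
    ((isWeakGradient_expL hτ (integrable_LqM hm hq hq2 f)).congr
      (volume_ac_weightMeasure.ae_le (MemLp.coeFn_toLp _))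
      (volume_ac_weightMeasure.ae_le (MemLp.coeFn_toLp _)))

lemma fn_smoothingFun (hm : (N : ℝ) / 2 < m) (hq : 1 < q) (hq2 : q < 2) {τ : ℝ} (hτ : 0 < τ)
    (f : LqM N m q) : H1m.fn (smoothingFun hm hq hq2 hτ f) =ᵐ[volume] expL τ f :=
  volume_ac_weightMeasure.ae_le (MemLp.coeFn_toLp (memLp_expL hm hq hq2 hτ f))

lemma exists_norm_smoothingFun_le (hm : (N : ℝ) / 2 < m) (hq : 1 < q) (hq2 : q < 2) :
    ∃ C : ℝ, 0 ≤ C ∧ ∀ τ (hτ : 0 < τ) (f : LqM N m q), ‖smoothingFun hm hq hq2 hτ f‖ ≤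
      C * Real.exp (τ / 2) ^ N * (1 - Real.exp (-τ)) ^ (-(1 / 2 + N * (q - 1) / 4)) * ‖f‖ := by
  obtain ⟨C, hC0, hC⟩ := exists_eLpNorm_expL_le N (pos_of_half_lt hm) hq hq2
  refine ⟨2 * C, by positivity, fun τ hτ f => ?_⟩
  have ha := one_sub_exp_neg_pos hτ
  obtain ⟨h1, h2⟩ := hC τ hτ f (integrable_LqM hm hq hq2 f)
  have hB : 0 ≤ C * Real.exp (τ / 2) ^ N *
      (1 - Real.exp (-τ)) ^ (-(1 / 2 + N * (q - 1) / 4)) := by positivity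
  have key : ∀ x : ℝ≥0∞, x ≤ ENNReal.ofReal (C * Real.exp (τ / 2) ^ N *
      (1 - Real.exp (-τ)) ^ (-(1 / 2 + N * (q - 1) / 4))) *
      eLpNorm f (ENNReal.ofReal (2 / q)) (weightMeasure N m) →
      x.toReal ≤ C * Real.exp (τ / 2) ^ N *
      (1 - Real.exp (-τ)) ^ (-(1 / 2 + N * (q - 1) / 4)) * ‖f‖ := fun x hx => by
    refine (ENNReal.toReal_mono (ENNReal.mul_lt_top ENNReal.ofReal_lt_top
      (Lp.memLp f).2).ne hx).trans_eq ?_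
    rw [ENNReal.toReal_mul, ENNReal.toReal_ofReal hB, Lp.norm_def]
  refine (H1m.norm_le_add _).trans ?_
  rw [smoothingFun, fstL_mk, gradL_mk, Lp.norm_toLp, Lp.norm_toLp]
  linarith [key _ h1, key _ h2]

lemma expL_add {τ : ℝ} (hτ : 0 < τ) {f g : E N → ℝ} (hf : Integrable f) (hg : Integrable g) :
    expL τ (f + g) = expL τ f + expL τ g := by
  funext ξ
  rw [Pi.add_apply, expL_of_pos hτ, expL_of_pos hτ, expL_of_pos hτ,
    ← integral_add (integrable_kernelL_mul hτ hf ξ) (integrable_kernelL_mul hτ hg ξ)]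
  simp only [Pi.add_apply, mul_add]

lemma expL_smul {τ : ℝ} (hτ : 0 < τ) (c : ℝ) (f : E N → ℝ) :
    expL τ (c • f) = c • expL τ f := by
  funext ξ
  rw [Pi.smul_apply, expL_of_pos hτ, expL_of_pos hτ, ← integral_smul]
  simp only [Pi.smul_apply, smul_eq_mul, mul_left_comm]

lemma fn_add (v w : H1m N m) : H1m.fn (v + w) =ᵐ[volume] H1m.fn v + H1m.fn w :=
  volume_ac_weightMeasure.ae_le (Lp.coeFn_add (fstL N m v) (fstL N m w))

lemma fn_smul (c : ℝ) (v : H1m N m) : H1m.fn (c • v) =ᵐ[volume] c • H1m.fn v :=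
  volume_ac_weightMeasure.ae_le (Lp.coeFn_smul c (fstL N m v))

/-- The operators `e^{τ𝓛}`, `τ > 0`, from the weighted `L^{2/q}` space to `H¹_m`. -/
def smoothing [Fact (1 ≤ ENNReal.ofReal (2 / q))] (hm : (N : ℝ) / 2 < m) (hq : 1 < q)
    (hq2 : q < 2) (τ : ℝ) : LqM N m q →L[ℝ] H1m N m :=
  if hτ : 0 < τ then
    LinearMap.mkContinuousOfExistsBound
      { toFun := smoothingFun hm hq hq2 hτ
        map_add' := fun f g => by
          refine H1m.ext_fn hm ((fn_smoothingFun hm hq hq2 hτ _).trans ?_)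
          refine (expL_congr_ae hτ.le (volume_ac_weightMeasure.ae_le (Lp.coeFn_add f g))).trans ?_
          rw [expL_add hτ (integrable_LqM hm hq hq2 f) (integrable_LqM hm hq hq2 g)]
          exact (((fn_smoothingFun hm hq hq2 hτ f).add (fn_smoothingFun hm hq hq2 hτ g)).symm).trans
            (fn_add _ _).symm
        map_smul' := fun c f => by
          refine H1m.ext_fn hm ((fn_smoothingFun hm hq hq2 hτ _).trans ?_)
          refine (expL_congr_ae hτ.le (volume_ac_weightMeasure.ae_le (Lp.coeFn_smul c f))).trans ?_
          rw [expL_smul hτ]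
          exact ((fn_smoothingFun hm hq hq2 hτ f).const_smul c).symm.trans (fn_smul c _).symm }
      (by
        obtain ⟨C, -, hC⟩ := exists_norm_smoothingFun_le hm hq hq2
        exact ⟨_, fun f => hC τ hτ f⟩)
  else 0

variable [Fact (1 ≤ ENNReal.ofReal (2 / q))]

lemma smoothing_apply (hm : (N : ℝ) / 2 < m) (hq : 1 < q) (hq2 : q < 2) {τ : ℝ} (hτ : 0 < τ)
    (f : LqM N m q) : smoothing hm hq hq2 τ f = smoothingFun hm hq hq2 hτ f := by
  rw [smoothing, dif_pos hτ]
  rfl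

lemma fn_smoothing (hm : (N : ℝ) / 2 < m) (hq : 1 < q) (hq2 : q < 2) {τ : ℝ} (hτ : 0 < τ)
    (f : LqM N m q) : H1m.fn (smoothing hm hq hq2 τ f) =ᵐ[volume] expL τ f := by
  rw [smoothing_apply hm hq hq2 hτ]
  exact fn_smoothingFun hm hq hq2 hτ f

/-- Converts negative powers of `1 - e^{-τ}` into powers of `τ` on a bounded time interval. -/
lemma mul_exp_neg_le_one_sub_exp_neg {τ t : ℝ} (hτ : 0 ≤ τ) (ht : τ ≤ t) :
    τ * Real.exp (-t) ≤ 1 - Real.exp (-τ) := by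
  have h1 : Real.exp (-t) ≤ Real.exp (-τ) := Real.exp_le_exp.2 (by linarith)
  have h2 := Real.add_one_le_exp τ
  have h3 : Real.exp τ * Real.exp (-τ) = 1 := by rw [← Real.exp_add]; simp
  nlinarith [Real.exp_pos (-τ), mul_le_mul_of_nonneg_right h2 (Real.exp_pos (-τ)).le]

/-- `e^{τ𝓛}` is a smoothing semigroup as long as `N (q - 1) < 2`. -/
theorem isSmoothingSemigroup_heat (hm : (N : ℝ) / 2 < m) (hq : 1 < q) (hq2 : q < 2)
    (hqN : N * (q - 1) < 2) :
    IsSmoothingSemigroup (heat (N := N) (pos_of_half_lt hm)) (smoothing hm hq hq2) where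
  zero := heat_zero _
  add _ _ hσ hτ v := heat_add hm hσ hτ v
  continuous := continuous_heat _
  comp σ τ hσ hτ f := by
    have hf := integrable_LqM hm hq hq2 f
    rcases hσ.eq_or_lt with rfl | hσ
    · rw [heat_zero, zero_add]
    refine H1m.ext_fn hm ((fn_heat hm hσ.le _).trans ?_)
    refine (expL_congr_ae hσ.le (fn_smoothing hm hq hq2 hτ f)).trans ?_
    refine .trans (Eventually.of_forall fun ξ => expL_expL hσ hτ hf ξ) ?_
    exact (fn_smoothing hm hq hq2 (add_pos hσ hτ) f).symm
  bound := by
    obtain ⟨C, hC0, hC⟩ := exists_norm_smoothingFun_le hm hq hq2 (N := N)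
    -- This `γ` is below `1` precisely when `N (q - 1) < 2`.
    refine ⟨1 / 2 + N * (q - 1) / 4, by linarith, fun t => ?_⟩
    refine ⟨C * Real.exp (t / 2) ^ N * Real.exp (-t) ^ (-(1 / 2 + N * (q - 1) / 4)),
      fun τ hτ => ?_⟩
    have hτ0 : 0 < τ := hτ.1
    have ha := one_sub_exp_neg_pos hτ0
    refine ContinuousLinearMap.opNorm_le_bound _ (by positivity) fun f => ?_
    rw [smoothing_apply hm hq hq2 hτ0]
    refine (hC τ hτ0 f).trans (mul_le_mul_of_nonneg_right ?_ (norm_nonneg _))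
    have h1 : (1 - Real.exp (-τ)) ^ (-(1 / 2 + N * (q - 1) / 4)) ≤
        (τ * Real.exp (-t)) ^ (-(1 / 2 + N * (q - 1) / 4)) := by
      refine Real.rpow_le_rpow_of_nonpos (by positivity)
        (mul_exp_neg_le_one_sub_exp_neg hτ0.le hτ.2) ?_
      have : 0 ≤ N * (q - 1) := mul_nonneg (Nat.cast_nonneg _) (by linarith)
      linarith
    rw [Real.mul_rpow hτ0.le (Real.exp_pos _).le] at h1
    calc _ ≤ C * Real.exp (t / 2) ^ N * (τ ^ (-(1 / 2 + N * (q - 1) / 4)) *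
          Real.exp (-t) ^ (-(1 / 2 + N * (q - 1) / 4))) := by
          gcongr
          exact hτ.2
      _ = _ := by ring

end Smoothing

/-! ### Application to the truncated equation -/

section TruncatedProblem

open Set Filter Topology

variable {N : ℕ} {m : ℝ}

lemma one_lt_qStar (N : ℕ) : 1 < qStar N := by
  rw [qStar, lt_div_iff₀ (by positivity)]
  linarith

/-- Here `N ≥ 1` enters: for `N = 0` the exponent would equal `2`. -/
lemma qStar_lt_two (hN : 1 ≤ N) : qStar N < 2 := by
  have : (1 : ℝ) ≤ N := by exact_mod_cast hN
  rw [qStar, div_lt_iff₀ (by positivity)]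
  linarith

/-- `N (q⋆ - 1) = N/(N + 1)`, so the critical exponent is well inside the range where the
singularity is integrable. -/
lemma mul_qStar_sub_one_lt_two (N : ℕ) : N * (qStar N - 1) < 2 := by
  have h : qStar N - 1 = 1 / (N + 1) := by
    rw [qStar]
    field_simp
    ring
  rw [h, mul_one_div, div_lt_iff₀ (by positivity)]
  have : (0 : ℝ) ≤ N := Nat.cast_nonneg N
  linarith

/-- The truncated nonlinearity with values in the weighted `L^{2/q⋆}` space. -/
def truncOp (χ : ℝ → ℝ) (ρ : ℝ) (v : H1m N m) : LqM N m (qStar N) :=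
  χ (‖v‖ ^ 2 / ρ ^ 2) • powOp (one_lt_qStar N) (gradL N m v)

lemma truncOp_coeFn (χ : ℝ → ℝ) (ρ : ℝ) (v : H1m N m) :
    truncOp χ ρ v =ᵐ[volume] truncF χ ρ v := by
  refine (volume_ac_weightMeasure (m := m)).ae_le ?_
  refine (Lp.coeFn_smul _ (powOp (one_lt_qStar N) (gradL N m v))).trans ?_
  filter_upwards [MemLp.coeFn_toLp (memLp_rpow (one_lt_qStar N) (gradL N m v))] with ξ hξ
  rw [Pi.smul_apply, powOp, hξ]
  rfl

theorem contDiff_lipschitz_truncOp (hN : 1 ≤ N) [Fact (1 ≤ ENNReal.ofReal (2 / qStar N))]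
    {χ : ℝ → ℝ} (hχ : IsCutoff χ) {ρ : ℝ} (hρ : 0 < ρ) :
    ContDiff ℝ 1 (truncOp (N := N) (m := m) χ ρ) ∧
      ∃ L : ℝ≥0, LipschitzWith L (truncOp (N := N) (m := m) χ ρ) := by
  have hq := one_lt_qStar N
  obtain ⟨D, hD, hDd, hDb⟩ := exists_hasFDerivAt_powOp (V := E N) (μ := weightMeasure N m)
    hq (qStar_lt_two hN)
  have hg : ∀ v : H1m N m, ‖v‖ ≤ 2 * ρ → ‖gradL N m v‖ ≤ 2 * ρ := fun v hv =>
    (H1m.norm_gradL_le v).trans hv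
  have hq0 : 0 ≤ qStar N - 1 := by linarith
  refine contDiff_lipschitz_truncation hχ hρ (P := fun v => powOp hq (gradL N m v))
    (D := fun v => (D (gradL N m v)).comp (gradL N m))
    (M := max ((2 * ρ) ^ qStar N) (qStar N * (2 * ρ) ^ (qStar N - 1)))
    ((hD.comp (gradL N m).continuous).clm_comp continuous_const)
    (fun v => (hDd (gradL N m v)).comp v (gradL N m).hasFDerivAt)
    (fun v hv => ?_) (fun v hv => ?_)
  · refine ((norm_powOp_le hq (gradL N m v)).trans ?_).trans (le_max_left _ _)
    exact Real.rpow_le_rpow (norm_nonneg _) (hg v hv) (by linarith)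
  · refine le_trans ?_ (le_max_right _ _)
    refine ContinuousLinearMap.opNorm_le_bound _ (by positivity) fun w => ?_
    calc ‖D (gradL N m v) (gradL N m w)‖ ≤ ‖D (gradL N m v)‖ * ‖gradL N m w‖ :=
          ContinuousLinearMap.le_opNorm _ _
      _ ≤ qStar N * (2 * ρ) ^ (qStar N - 1) * ‖w‖ := by
          gcongr
          · refine (hDb _).trans ?_
            gcongr
            exact hg v hv
          · exact H1m.norm_gradL_le w

/-- The two formulations of mild solutions agree. -/
theorem isMildSolution_iff (hN : 1 ≤ N) (hm : (N : ℝ) / 2 < m)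
    [Fact (1 ≤ ENNReal.ofReal (2 / qStar N))] {χ : ℝ → ℝ} (hχ : IsCutoff χ) {ρ : ℝ} (hρ : 0 < ρ)
    (v₀ : H1m N m) (v : C(ℝ≥0, H1m N m)) :
    IsMildSolution χ ρ v₀ v ↔ IsMild (heat (pos_of_half_lt hm))
      (smoothing hm (one_lt_qStar N) (qStar_lt_two hN)) (truncOp χ ρ) v₀ v := by
  have hS := isSmoothingSemigroup_heat hm (one_lt_qStar N) (qStar_lt_two hN)
    (mul_qStar_sub_one_lt_two N)
  have hfn : ∀ (τ s : ℝ≥0), s < τ → H1m.fn (smoothing hm (one_lt_qStar N) (qStar_lt_two hN)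
      ((τ : ℝ) - s) (truncOp χ ρ (v s))) =ᵐ[volume] expL ((τ : ℝ) - s) (truncF χ ρ (v s)) := by
    intro τ s hs
    have hpos : 0 < (τ : ℝ) - s := sub_pos.2 (by exact_mod_cast hs)
    exact (fn_smoothing hm _ _ hpos _).trans (expL_congr_ae hpos.le (truncOp_coeFn χ ρ (v s)))
  refine forall_congr' fun τ => ⟨?_, fun h => ?_⟩
  · rintro ⟨w, g, hw, hg, -, hv⟩
    rw [hv]
    congr 1
    · exact H1m.ext_fn hm (hw.trans (fn_heat hm τ.2 v₀).symm)
    · refine intervalIntegral.integral_congr_ae ?_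
      filter_upwards [Measure.ae_ne volume (τ : ℝ)] with s hne hs
      rw [uIoc_of_le (NNReal.coe_nonneg τ)] at hs
      have hs0 : ((s.toNNReal : ℝ≥0) : ℝ) = s := Real.coe_toNNReal s hs.1.le
      have hlt : s.toNNReal < τ := by
        rw [← NNReal.coe_lt_coe, hs0]
        exact lt_of_le_of_ne hs.2 hne
      have h := (hg _ hlt).trans (hfn τ _ hlt).symm
      rw [hs0] at h
      exact H1m.ext_fn hm h
  · refine ⟨heat (pos_of_half_lt hm) τ v₀, fun s => smoothing hm (one_lt_qStar N)
      (qStar_lt_two hN) (τ - s) (truncOp χ ρ (v s.toNNReal)), fn_heat hm τ.2 v₀, fun s hs => ?_,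
      IsMild.intervalIntegrable hS (contDiff_lipschitz_truncOp hN hχ hρ).1.continuous v τ, h⟩
    simp only [Real.toNNReal_coe]
    exact hfn τ s hs

end TruncatedProblem

end ViscousHJ

end

theorem mainTheorem3 (N : ℕ) (hN : 1 ≤ N) (m : ℝ) (hm : (N : ℝ) / 2 < m)
    (χ : ℝ → ℝ) (hχ : ViscousHJ.IsCutoff χ) (ρ : ℝ) (hρ0 : 0 < ρ) (hρ1 : ρ < 1) :
    (∀ v₀ : ViscousHJ.H1m N m, ∃! v : C(ℝ≥0, ViscousHJ.H1m N m),
      ViscousHJ.IsMildSolution χ ρ v₀ v) ∧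
    ∃ φ : ℝ≥0 → ViscousHJ.H1m N m → ViscousHJ.H1m N m,
      (∀ (v₀ : ViscousHJ.H1m N m) (v : C(ℝ≥0, ViscousHJ.H1m N m)),
        ViscousHJ.IsMildSolution χ ρ v₀ v → ∀ τ, φ τ v₀ = v τ) ∧
      (∀ T : ℝ≥0, ∃ K : ℝ≥0, ∀ τ ≤ T, LipschitzWith K (φ τ)) ∧
      ViscousHJ.IsC1Semiflow φ := by
  have : Fact (1 ≤ ENNReal.ofReal (2 / ViscousHJ.qStar N)) :=
    ⟨ViscousHJ.one_le_ofReal_two_div (zero_lt_one.trans (ViscousHJ.one_lt_qStar N))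
      (ViscousHJ.qStar_lt_two hN).le⟩
  obtain ⟨hF, L, hL⟩ := ViscousHJ.contDiff_lipschitz_truncOp (N := N) (m := m) hN hχ hρ0
  simp only [ViscousHJ.isMildSolution_iff hN hm hχ hρ0]
  exact ViscousHJ.exists_semiflow (ViscousHJ.isSmoothingSemigroup_heat hm (ViscousHJ.one_lt_qStar N)
    (ViscousHJ.qStar_lt_two hN) (ViscousHJ.mul_qStar_sub_one_lt_two N)) hF hL
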